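/- **Model.** Let $F\in[0,1]^{n\times n}$ be a Robinson matrix: $F$ is symmetric, $F_{jk}\le F_{ik}$ for $k\le i<j$, and $F_{ik}\le F_{jk}$ for $i<j\le k$. Let $\pi$ be a permutation of $[n]$. One observes $A=F_\pi+\sigma E$, where $(F_\pi)_{ij}=F_{\pi_i\pi_j}$, $\sigma>0$, and $E$ is a symmetric random matrix whose entries $E_{ij}$, $i\le j$, are independent, centered, and satisfy $\mathbb E[e^{sE_{ij}}]\le e^{s^2/2}$ for all $s\in\mathbb R$. For $\alpha,\beta,r,r'>0$, the class $\mathcal{AL}(\alpha,\beta,r,r')$ consists of the matrices $F\in[0,1]^{n\times n}$, with rows $F_i$, such that, with $c_0=1/32$ and $\|\cdot\|$ the Euclidean norm: * for all $i<j$ with $j-i\le rn$: $\ \|F_i-F_j\|\le\beta|i-j|/\sqrt n\ $ and $\ \Big(\sum_{k<i-c_0n}(F_{ik}-F_{jk})\Big)\vee\Big(\sum_{k>j+c_0n}(F_{jk}-F_{ik})\Big)\ge\alpha|i-j|$; * if $|i-j|>rn$, then $\|F_i-F_j\|>r'\sqrt n$. For $\hat\pi\in\mathbb R^n$ let $L_{\max}(\hat\pi,\pi)=\frac1n\big(\max_i|\hat\pi_i-\pi_i|\wedge\max_i|\hat\pi_i-(n+1-\pi_i)|\big)$.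 **Algorithm SABRE** (input $A$, $\sigma$, $\delta_1,\dots,\delta_4$). In every $\arg\min$ or $\arg\max$ below, ties are broken by a fixed deterministic rule. 1. *Distance estimate.* For $S\subset[n]$ let $A^S$ be $A$ with all entries outside $S\times S$ replaced by $0$. For $i\in S$ let $\hat m_i=\arg\min_{j\in S,\,j\ne i}\max_{k\in S\setminus\{i,j\}}|\langle A^S_k,A^S_i-A^S_j\rangle|$. For distinct $i,j\in S$ let $\widehat D(S)_{ij}=\sqrt{n\,\big(\langle A^S_i,A^S_{\hat m_i}\rangle+\langle A^S_j,A^S_{\hat m_j}\rangle-2\langle A^S_i,A^S_j\rangle\big)_+}$; all other entries of $\widehat D(S)$ are $0$. Put $\widehat D=\widehat D([n])$. 2. *First seriation.* For each $i$, consider the graph on $[n]\setminus\{i\}$ in which $k\neq l$ are adjacent if $\widehat D_{kl}\le\delta_1$ and $\widehat D_{ik}\vee\widehat D_{il}\ge\delta_2$. Let $G_i,G_i'$ be the largest and the second largest of its connected components containing some $k$ with $\widehat D_{ik}\ge\delta_3$ (empty where there is none). Choose $c$ maximizing $|G_c|\wedge|G'_c|$ and set $(L_c,R_c)=(G_c,G_c')$.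 For $i\ne c$ with $G_i'=\emptyset$, set $(L_i,R_i)=(\emptyset,G_i)$ if $i\in L_c$, and $(G_i,\emptyset)$ otherwise. For $i\neq c$ with $G'_i\ne\emptyset$, set $(L_i,R_i)=(G_i',G_i)$ if $G_i\cap L_c=\emptyset$ or $G_i'\cap R_c=\emptyset$, and $(G_i,G_i')$ otherwise. For $i\ne j$ with $L_i\cup R_i\neq\emptyset$, set $H_{ij}=-1$ if $i\in L_j$ or $j\in R_i$, and otherwise $H_{ij}=1$ if $i\in R_j$ or $j\in L_i$. All other entries of $H$ are $0$. 3. *Refined seriation.* Draw, independently of $A$, a uniformly random partition $[n]=S^1\cup S^2\cup S^3$ with $\lfloor n/3\rfloor\le|S^t|\le\lceil n/3\rceil$, and compute $\widehat D^t=\widehat D(S^t)$. For each $i<j$ with $H_{ij}=0$, take the least $t$ with $i,j\notin S^t$, take $p\in\arg\min_{p\in S^t}\widehat D_{ip}$, and let $l$ (respectively $r$) be the sum of $A_{ik}-A_{jk}$ over the $k\in S^t$ with $\widehat D^t_{pk}\ge\delta_4$ and $H_{ik}=H_{jk}=1$ (respectively $H_{ik}=H_{jk}=-1$). Set $\widetilde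 H_{ij}=-\mathrm{sign}(l)$ if $|l|\ge5\sigma\sqrt{n\log n}$; otherwise $\widetilde H_{ij}=\mathrm{sign}(r)$ if $|r|\ge5\sigma\sqrt{n\log n}$; otherwise $\widetilde H_{ij}=0$. Set $\widetilde H_{ji}=-\widetilde H_{ij}$, and let all other entries of $\widetilde H$ be $0$. With $\widehat H=H+\widetilde H$, output $\hat\pi_i=\frac12\big(\sum_j\widehat H_{ij}+n+1\big)$ for $i\in[n]$. **Theorem 4.1.** * SABRE can be implemented to run in time $O(n^3)$: on a unit-cost random access machine with real arithmetic ($+,-,\times,/$, square root, logarithm, comparisons), the number of steps is at most $Kn^3$ for a universal constant $K$ and all $n\ge1$ and all inputs (the draw of the random partition being charged $n$ steps). * For all $\alpha,\beta,r,r',\sigma>0$ there is a constant $C$ depending only on $(\alpha,\beta,r,r',\sigma)$ such that for all $n\ge C$, every Robinson matrix $F\in\mathcal{AL}(\alpha,\beta,r,r')$, every permutation $\pi$ of $[n]$ and every noise distribution as above, the output $\hat\pi$ of SABRE with $\delta_1=n^{3/4}\log n$ and $\delta_{k+1}=\delta_k\log n$ for $k=1,2,3$ satisfies, with probability at least $1-1/n^2$,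 $$L_{\max}(\hat\pi,\pi)\ \le\ 40\,\frac{\sigma}{\alpha}\sqrt{\frac{\log n}{n}}.$$ -/

import Mathlib

open MeasureTheory ProbabilityTheory

namespace Seriation

/-- An `n × n` array (indices run from `0` to `n - 1`). -/
abbrev Mat (n : ℕ) (α : Type) : Type := Fin n → Fin n → α

/-! ## Cost model

A unit-cost random access machine working with real numbers and with integers of size `O(n)`.
A value of type `Timed α` is a result together with the number of steps spent on it. The
algorithms below are written only with the instructions of this section: an array entry is
available only through `read` / `read₂`, and `scalar` and `branch` are applied only to expressions
of constant size (arithmetic operations, absolute value, square root, logarithm, comparisons) in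
scalars already at hand. -/

/-- A result together with the number of elementary steps spent to compute it. -/
structure Timed (α : Type) where
  val : α
  steps : ℕ

namespace Timed

/-- Sequential composition adds the numbers of steps. -/
instance : Monad Timed where
  pure a := ⟨a, 0⟩
  bind x f := ⟨(f x.val).val, x.steps + (f x.val).steps⟩

variable {n : ℕ} {α β : Type}

/-- Evaluate an expression of constant size in scalars at hand. -/
def scalar (a : α) : Timed α := ⟨a, 1⟩

/-- Read an entry of an array. -/
def read (a : Fin n → α) (i : Fin n) : Timed α := ⟨a i, 1⟩

/-- Read an entry of a two-dimensional array. -/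
def read₂ (a : Mat n α) (i j : Fin n) : Timed α := ⟨a i j, 1⟩

/-- Overwrite an entry of an array. -/
def write (a : Fin n → α) (i : Fin n) (x : α) : Timed (Fin n → α) := ⟨Function.update a i x, 1⟩

/-- Test a condition of constant size and run one of two programs. -/
def branch (p : Prop) [Decidable p] (x y : Timed α) : Timed α :=
  ⟨if p then x.val else y.val, 1 + if p then x.steps else y.steps⟩

/-- `for i = 0, …, n - 1`, with a state that is passed from one round to the next. -/
def loop (start : β) (body : Fin n → β → Timed β) : Timed β :=
  (List.finRange n).foldlM (fun state i => do
    let state' ← body i state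
    scalar state') start

/-- Compute and store the `n` entries of a new array. -/
def tabulate (f : Fin n → Timed α) : Timed (Fin n → α) :=
  ⟨fun i => (f i).val, ∑ i, ((f i).steps + 1)⟩

/-- Compute and store the `n²` entries of a new two-dimensional array. -/
def tabulate₂ (f : Fin n → Fin n → Timed α) : Timed (Mat n α) :=
  tabulate fun i => tabulate fun j => f i j

/-- Compute `n` terms and add them up. -/
def sum [AddCommMonoid α] (f : Fin n → Timed α) : Timed α :=
  ⟨∑ i, (f i).val, ∑ i, ((f i).steps + 1)⟩

/-- Compute `n` nonnegative numbers and their maximum (`0` if there are none). -/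
noncomputable def maximum (f : Fin n → Timed ℝ) : Timed ℝ :=
  ⟨Finset.univ.fold max 0 fun i => (f i).val, ∑ i, ((f i).steps + 1)⟩

/-- Compute `n` truth values and their disjunction. -/
def any (f : Fin n → Timed Bool) : Timed Bool :=
  ⟨decide (∃ i, (f i).val = true), ∑ i, ((f i).steps + 1)⟩

/-- Scan the indices whose key is not `none` and keep a best key, together with its index; among
equally good keys the first one is kept. -/
def pickBest (better : α → α → Prop) [DecidableRel better] (key : Fin n → Timed (Option α)) :
    Timed (Option (Fin n × α)) :=
  loop none fun i best => do
    let k ← key i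
    match k, best with
    | none, _ => pure best
    | some x, none => pure (some (i, x))
    | some x, some (_, y) => branch (better x y) (pure (some (i, x))) (pure best)

end Timed

open Timed

/-! ## The algorithm SABRE -/

section Algorithm

variable {n : ℕ}

/-- **Estimate Distance**, on the rows and columns in `S`. With `A^S` the matrix `A` with all
entries outside `S × S` replaced by `0`, and
`m i = argmin_{j ∈ S, j ≠ i} max_{k ∈ S \ {i, j}} |⟨A^S_k, A^S_i - A^S_j⟩|` for `i ∈ S`, the output is
`D i j = √(n (⟨A^S_i, A^S_{m i}⟩ + ⟨A^S_j, A^S_{m j}⟩ - 2 ⟨A^S_i, A^S_j⟩))` for distinct `i, j ∈ S`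
(`0` if the radicand is negative), and `D i j = 0` otherwise. All inner products are computed
once and stored in `G`. -/
noncomputable def estimateDistance (A : Mat n ℝ) (S : Fin n → Bool) : Timed (Mat n ℝ) := do
  let AS ← tabulate₂ fun i j => do
    let si ← read S i
    let sj ← read S j
    branch (si = true ∧ sj = true) (read₂ A i j) (pure 0)
  let G ← tabulate₂ fun i j => sum fun k => do
    let x ← read₂ AS i k
    let y ← read₂ AS j k
    scalar (x * y)
  let m ← tabulate fun i => do
    let si ← read S i
    branch (si = true)
      (do
        let best ← pickBest (fun x y : ℝ => x < y) fun j => do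
          let sj ← read S j
          branch (sj = true ∧ j ≠ i)
            (do
              let score ← maximum fun k => do
                let sk ← read S k
                branch (sk = true ∧ k ≠ i ∧ k ≠ j)
                  (do
                    let x ← read₂ G k i
                    let y ← read₂ G k j
                    scalar |x - y|)
                  (pure 0)
              pure (some score))
            (pure none)
        match best with
        | some (j, _) => pure j
        | none => pure i)
      (pure i)
  tabulate₂ fun i j => do
    let si ← read S i
    let sj ← read S j
    branch (si = true ∧ sj = true ∧ i ≠ j)
      (do
        let mi ← read m i
        let mj ← read m j
        let gi ← read₂ G i mi
        let gj ← read₂ G j mj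
        let gij ← read₂ G i j
        scalar (Real.sqrt (n * (gi + gj - 2 * gij))))
      (pure 0)

/-- The connected components of the graph on `Fin n` with the given (symmetric) edge relation: the
output assigns to every vertex a label, and two vertices have the same label if and only if they
are connected. Starting from singletons, the round of `v` merges the components that contain `v`
or a neighbour of `v`, and gives them the label `v`. -/
def components (edge : Fin n → Fin n → Timed Bool) : Timed (Fin n → Fin n) := do
  let start ← tabulate fun v => pure v
  loop start fun v label => do
    let none' ← tabulate fun _ => pure false
    let lv ← read label v
    let own ← write none' lv true
    let touched ← loop own fun u T => do
      let e ← edge v u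
      branch (e = true)
        (do
          let lu ← read label u
          write T lu true)
        (pure T)
    tabulate fun u => do
      let lu ← read label u
      let b ← read touched lu
      branch (b = true) (pure v) (pure lu)

/-- The two sets `G`, `G'` found for an index, with their cardinalities. -/
structure Bisection (n : ℕ) where
  G : Fin n → Bool
  G' : Fin n → Bool
  card : ℕ
  card' : ℕ

/-- The bisection of an index `i`: in the graph on `[n] \ {i}` in which distinct `k`, `l` are
adjacent when `D k l ≤ δ₁` and `max (D i k) (D i l) ≥ δ₂`, consider the connected components that
contain some `k` with `D i k ≥ δ₃`, and return the largest one and the second largest one (the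
empty set where there is none). -/
noncomputable def bisection (D : Mat n ℝ) (δ₁ δ₂ δ₃ : ℝ) (i : Fin n) : Timed (Bisection n) := do
  let label ← components fun k l => do
    let x ← read₂ D k l
    let y ← read₂ D i k
    let z ← read₂ D i l
    scalar (decide (k ≠ i ∧ l ≠ i ∧ k ≠ l ∧ x ≤ δ₁ ∧ δ₂ ≤ max y z))
  let zeros ← tabulate fun _ => pure 0
  let size ← loop zeros fun u (s : Fin n → ℕ) =>
    branch (u ≠ i)
      (do
        let c ← read label u
        let m ← read s c
        write s c (m + 1))
      (pure s)
  let near ← tabulate fun _ => pure false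
  let far ← loop near fun u T => do
    let y ← read₂ D i u
    branch (u ≠ i ∧ δ₃ ≤ y)
      (do
        let c ← read label u
        write T c true)
      (pure T)
  let first ← pickBest (fun x y : ℕ => y < x) fun c => do
    let f ← read far c
    branch (f = true)
      (do
        let m ← read size c
        pure (some m))
      (pure none)
  let second ← pickBest (fun x y : ℕ => y < x) fun c => do
    let f ← read far c
    branch (f = true ∧ first.map Prod.fst ≠ some c)
      (do
        let m ← read size c
        pure (some m))
      (pure none)
  let G ← tabulate fun u => do
    let c ← read label u
    scalar (decide (first.map Prod.fst = some c))
  let G' ← tabulate fun u => do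
    let c ← read label u
    scalar (decide (second.map Prod.fst = some c))
  pure ⟨G, G', (first.map Prod.snd).getD 0, (second.map Prod.snd).getD 0⟩

/-- The subroutine **Orientation**. The index `c` maximizes `min |G c| |G' c|`, with
`(L c, R c) = (G c, G' c)`. For `i ≠ c` the pair `(G i, G' i)` is flipped, that is
`(L i, R i) = (G' i, G i)`, in the following cases, and `(L i, R i) = (G i, G' i)` otherwise: if
`G' i = ∅`, when `i ∈ L c`; if `G' i ≠ ∅`, when `G i ∩ L c = ∅` or `G' i ∩ R c = ∅`. -/
def orientation (B : Fin n → Bisection n) : Timed (Mat n Bool × Mat n Bool) := do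
  let best ← pickBest (fun x y : ℕ => y < x) fun i => do
    let b ← read B i
    scalar (some (min b.card b.card'))
  match best with
  | none => pure (fun _ _ => false, fun _ _ => false)
  | some (c, _) => do
    let bc ← read B c
    let flip ← tabulate fun i => do
      let b ← read B i
      branch (i = c) (pure false)
        (branch (b.card' = 0) (read bc.G i)
          (do
            let meetsL ← any fun k => do
              let x ← read b.G k
              let y ← read bc.G k
              scalar (x && y)
            let meetsR ← any fun k => do
              let x ← read b.G' k
              let y ← read bc.G' k
              scalar (x && y)
            scalar (!meetsL || !meetsR)))
    let L ← tabulate₂ fun i k => do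
      let b ← read B i
      let f ← read flip i
      branch (f = true) (read b.G' k) (read b.G k)
    let R ← tabulate₂ fun i k => do
      let b ← read B i
      let f ← read flip i
      branch (f = true) (read b.G k) (read b.G' k)
    pure (L, R)

/-- **Aggregate Bisections**: the partial comparison matrix `H`, with entries in `{-1, 0, 1}`. -/
noncomputable def aggregateBisections (D : Mat n ℝ) (δ₁ δ₂ δ₃ : ℝ) : Timed (Mat n ℤ) := do
  let B ← tabulate fun i => bisection D δ₁ δ₂ δ₃ i
  let LR ← orientation B
  let nonempty ← tabulate fun i => any fun k => do
    let x ← read₂ LR.1 i k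
    let y ← read₂ LR.2 i k
    scalar (x || y)
  tabulate₂ fun i j => do
    let ne ← read nonempty i
    branch (i ≠ j ∧ ne = true)
      (do
        let i_in_Lj ← read₂ LR.1 j i
        let j_in_Ri ← read₂ LR.2 i j
        let i_in_Rj ← read₂ LR.2 j i
        let j_in_Li ← read₂ LR.1 i j
        scalar (if i_in_Lj = true ∨ j_in_Ri = true then -1
          else if i_in_Rj = true ∨ j_in_Li = true then 1 else 0))
      (pure 0)

/-- The decision rule of **Evaluate Comparison**. -/
noncomputable def decideComparison (threshold l r : ℝ) : ℤ :=
  if threshold ≤ |l| then -(SignType.sign l : ℤ)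
  else if threshold ≤ |r| then (SignType.sign r : ℤ)
  else 0

/-- The first of the three blocks that is different from the blocks `a` and `b`. -/
def otherBlock (a b : Fin 3) : Fin 3 :=
  if a ≠ 0 ∧ b ≠ 0 then 0 else if a ≠ 1 ∧ b ≠ 1 then 1 else 2

/-- **Re-evaluate Comparisons**. The partition `(S⁰, S¹, S²)` of `[n]` is given as the map `part`
that sends an index to the number of its block. For `i < j` with `H i j = 0`, `t` is the number of a
block that contains neither `i` nor `j`, `p` minimizes `D i p` over `p ∈ Sᵗ`, and `l` (respectively
`r`) is the sum of `A i k - A j k` over the `k ∈ Sᵗ` with `H i k = H j k = 1` (respectively `-1`)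
and `Dᵗ p k ≥ δ₄`. -/
noncomputable def reevaluateComparisons (H : Mat n ℤ) (D A : Mat n ℝ) (σ δ₄ : ℝ)
    (part : Fin n → Fin 3) : Timed (Mat n ℤ) := do
  let Dblock ← tabulate fun t : Fin 3 => do
    let S ← tabulate fun k => do
      let s ← read part k
      scalar (decide (s = t))
    estimateDistance A S
  let threshold ← scalar (5 * σ * Real.sqrt (n * Real.log n))
  let Htilde ← tabulate₂ fun i j => do
    let h ← read₂ H i j
    branch (i < j ∧ h = 0)
      (do
        let a ← read part i
        let b ← read part j
        let t ← scalar (otherBlock a b)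
        let Dt ← read Dblock t
        let best ← pickBest (fun x y : ℝ => x < y) fun p => do
          let s ← read part p
          branch (s = t)
            (do
              let x ← read₂ D i p
              pure (some x))
            (pure none)
        match best with
        | none => pure 0
        | some (p, _) => do
          let side (v : ℤ) : Timed ℝ := sum fun k => do
            let s ← read part k
            let hik ← read₂ H i k
            let hjk ← read₂ H j k
            let d ← read₂ Dt p k
            branch (s = t ∧ hik = v ∧ hjk = v ∧ δ₄ ≤ d)
              (do
                let x ← read₂ A i k
                let y ← read₂ A j k
                scalar (x - y))
              (pure 0)
          let l ← side 1
          let r ← side (-1)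
          scalar (decideComparison threshold l r))
      (pure 0)
  tabulate₂ fun i j => do
    let h ← read₂ H i j
    let u ← read₂ Htilde i j
    let u' ← read₂ Htilde j i
    scalar (if i < j then h + u else if j < i then h - u' else h)

/-- **SABRE**, run on the matrix `A` with noise level `σ` and tuning parameters `δ₁, …, δ₄`; `part`
is the partition drawn at random by the algorithm, and the draw is charged `n` steps. The output is
the vector `(π̂ᵢ)`, with `π̂ᵢ = (∑ⱼ Ĥᵢⱼ + n + 1) / 2`. -/
noncomputable def sabre (A : Mat n ℝ) (σ δ₁ δ₂ δ₃ δ₄ : ℝ) (part : Fin n → Fin 3) :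
    Timed (Fin n → ℝ) := do
  let D ← estimateDistance A fun _ => true
  let H ← aggregateBisections D δ₁ δ₂ δ₃
  let part ← (⟨part, n⟩ : Timed (Fin n → Fin 3))
  let Hhat ← reevaluateComparisons H D A σ δ₄ part
  tabulate fun i => do
    let s ← sum fun j => read₂ Hhat i j
    scalar (((s : ℝ) + n + 1) / 2)

/-- The tuning parameters: `δ_1 = n^{3/4} log n` and `δ_{k+1} = δ_k log n`. -/
noncomputable def tuning (n : ℕ) : ℕ → ℝ
  | 0 => (n : ℝ) ^ (3 / 4 : ℝ)
  | k + 1 => tuning n k * Real.log n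

end Algorithm

/-! ## The statistical model -/

/-- Robinson matrices: symmetric matrices whose entries decrease (in the wide sense) when one moves
away from the diagonal along a row or a column. -/
structure IsRobinson {n : ℕ} (F : Mat n ℝ) : Prop where
  symm : ∀ i j, F i j = F j i
  left : ∀ k i j, k ≤ i → i < j → F j k ≤ F i k
  right : ∀ i j k, i < j → j ≤ k → F i k ≤ F j k

/-- The Euclidean distance between the rows `i` and `j`. -/
noncomputable def rowDist {n : ℕ} (F : Mat n ℝ) (i j : Fin n) : ℝ :=
  Real.sqrt (∑ k, (F i k - F j k) ^ 2)

/-- The class `AL(α, β, r, r')` of average-Lipschitz matrices, with trimming constant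
`c₀ = 1 / 32`. -/
structure IsAverageLipschitz {n : ℕ} (α β r r' : ℝ) (F : Mat n ℝ) : Prop where
  mem_Icc : ∀ i j, F i j ∈ Set.Icc (0 : ℝ) 1
  upper : ∀ i j : Fin n, i < j → (j : ℝ) - i ≤ r * n →
    rowDist F i j ≤ β * ((j : ℝ) - i) / Real.sqrt n
  lower : ∀ i j : Fin n, i < j → (j : ℝ) - i ≤ r * n →
    α * ((j : ℝ) - i) ≤
      max (∑ k with ((k : Fin n) : ℝ) < (i : ℝ) - (1 / 32) * n, (F i k - F j k))
        (∑ k with (j : ℝ) + (1 / 32) * n < ((k : Fin n) : ℝ), (F j k - F i k))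
  noncollapse : ∀ i j : Fin n, r * n < |(i : ℝ) - j| → r' * Real.sqrt n < rowDist F i j

/-- The noise: a symmetric random matrix whose entries on and above the diagonal are independent,
centered, and sub-Gaussian with variance proxy at most `1`, i.e. `𝔼 exp (s E i j) ≤ exp (s² / 2)`
for all real `s`. -/
structure IsNoise {n : ℕ} {Ω : Type*} [MeasurableSpace Ω] (E : Ω → Mat n ℝ) (μ : Measure Ω) :
    Prop where
  measurable : Measurable E
  symm : ∀ ω i j, E ω i j = E ω j i
  indep : iIndepFun (fun (p : {p : Fin n × Fin n // p.1 ≤ p.2}) ω => E ω p.1.1 p.1.2) μ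
  centered : ∀ i j, ∫ ω, E ω i j ∂μ = 0
  subgaussian : ∀ i j, HasSubgaussianMGF (fun ω => E ω i j) 1 μ

/-- The observed matrix `A = F_π + σ E`, with `(F_π) i j = F (π i) (π j)`. -/
def observation {n : ℕ} (F : Mat n ℝ) (π : Equiv.Perm (Fin n)) (σ : ℝ) (E : Mat n ℝ) : Mat n ℝ :=
  fun i j => F (π i) (π j) + σ * E i j

/-- Maps `[n] → [3]` whose three fibres have size between `⌊n / 3⌋` and `⌈n / 3⌉`. -/
def balancedPartitions (n : ℕ) : Set (Fin n → Fin 3) :=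
  {s | ∀ t, n / 3 ≤ (Finset.univ.filter fun k => s k = t).card ∧
    (Finset.univ.filter fun k => s k = t).card ≤ (n + 2) / 3}

/-- A uniformly distributed random balanced partition. -/
structure IsUniformPartition {n : ℕ} {Ω : Type*} [MeasurableSpace Ω] (part : Ω → Fin n → Fin 3)
    (μ : Measure Ω) : Prop where
  measurable : Measurable part
  law : μ.map part = uniformOn (balancedPartitions n)

/-- The normalized maximum error, up to reversal. The permutation acts on `{0, …, n - 1}`, so the
latent position of `i` is `π i + 1 ∈ {1, …, n}`, and `n - π i` is its position in the reversed
order. -/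
noncomputable def maxLoss {n : ℕ} (πhat : Fin n → ℝ) (π : Equiv.Perm (Fin n)) : ℝ :=
  (1 / n) * min (⨆ i, |πhat i - (((π i : ℕ) : ℝ) + 1)|) (⨆ i, |πhat i - ((n : ℝ) - ((π i : ℕ) : ℝ))|)

end Seriation

/-!
Running time. A program of the cost model is a term built from a few instructions, so a bound for its
number of steps is composed along the term, one rule per instruction. The cubic terms come from the
inner products and from the minimax in the distance estimate, from the components of `n` graphs with
`n` vertices, and from the two sums computed for every pair of indices in the refined seriation.

Correctness. Everything random is collected in one event (`IsGood`), on which the analysis is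
deterministic. The event has three parts.

* The inner products of distinct rows of the observation, on all indices or on a block of the
  partition, are those of the signal up to `η`, of order `√n log n`. A row and its approximate nearest
  neighbour then have an inner product close to the unobserved squared norm of the row
  (`estimateDistance_accurate`), so the estimated distances are those of the signal up to `√(n η)`, of
  order `n^{3/4} √(log n)`, which is less than `δ₁ / 4`. For an average-Lipschitz matrix the latter
  are comparable to the distances in the latent order (`IsAverageLipschitz.distance_bounds`).
  Therefore the graph of an index `i` connects far indices on the same side of `i`, and never indices
  on different sides (`Resolves`): its components are the two sides of `i`. The central index fixes one
  direction for all of them (`orientation_isSides`), which may be that of the latent order or the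
  opposite one, and `H` compares correctly all pairs at distance at least `2 δ₃ / min α r'`
  (`Resolves.aggregateBisections`).
* The noise in the sums that compare `i` and `j` is at most `3 σ √(n log n)`. By the Robinson property
  the signal part of these sums has the correct sign, so a comparison that passes the threshold
  `5 σ √(n log n)` is correct, and one that does not has a signal part of at most `8 σ √(n log n)`.
* A block of the random partition receives at least a quarter of each of finitely many weights. In
  particular it receives a quarter of the signal guaranteed by the average-Lipschitz condition, so
  that `i` and `j` are compared as soon as their distance exceeds `32 (σ / α) √(n log n)`
  (`IsGood.decide_correct`). The rank of an index is the sum of its comparisons, and its error is at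
  most this distance (`rank_accurate`).

Probability. All noise terms are linear forms in entries of `E` whose coefficients are functions of
other entries: the rows of the signal, another row of the noise, or the set of summation, which
depends only on the entries inside a block that contains neither `i` nor `j`. Conditioning on the
coefficients gives sub-Gaussian tails (`IsNoise.measure_weighted_sum_le`). The balanced partitions make
up a fraction of at least `1 / (n + 1)²` of all maps to three blocks
(`three_pow_le_card_balancedPartitions`), so a Chernoff bound for independent uniform labels
(`card_light_le`) survives the restriction to balanced partitions. Since the direction found by the
algorithm is random, all bounds are used for the latent order and for its reversal.
-/

namespace Seriation

/-! ### Running time -/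

namespace Timed

variable {n : ℕ} {α β : Type}

theorem steps_pure_le (a : α) : (pure a : Timed α).steps ≤ 0 := le_rfl

theorem steps_scalar_le (a : α) : (scalar a).steps ≤ 1 := le_rfl

theorem steps_read_le (a : Fin n → α) (i : Fin n) : (read a i).steps ≤ 1 := le_rfl

theorem steps_read₂_le (a : Mat n α) (i j : Fin n) : (read₂ a i j).steps ≤ 1 := le_rfl

theorem steps_write_le (a : Fin n → α) (i : Fin n) (x : α) : (write a i x).steps ≤ 1 := le_rfl

theorem steps_bind_le {x : Timed α} {f : α → Timed β} {a b : ℕ} (hx : x.steps ≤ a)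
    (hf : ∀ v, (f v).steps ≤ b) : (x >>= f).steps ≤ a + b :=
  Nat.add_le_add hx (hf _)

theorem steps_branch_le {p : Prop} [Decidable p] {x y : Timed α} {a b : ℕ} (hx : x.steps ≤ a)
    (hy : y.steps ≤ b) : (branch p x y).steps ≤ 1 + a + b := by
  unfold branch
  dsimp only
  split_ifs <;> omega

theorem sum_steps_le {f : Fin n → Timed α} {b : ℕ} (hf : ∀ i, (f i).steps ≤ b) :
    ∑ i, ((f i).steps + 1) ≤ n * (b + 1) := by
  simpa using Finset.sum_le_card_nsmul Finset.univ (fun i => (f i).steps + 1) (b + 1)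
    fun i _ => Nat.succ_le_succ (hf i)

theorem steps_tabulate_le {f : Fin n → Timed α} {b : ℕ} (hf : ∀ i, (f i).steps ≤ b) :
    (tabulate f).steps ≤ n * (b + 1) := sum_steps_le hf

theorem steps_tabulate₂_le {f : Fin n → Fin n → Timed α} {b : ℕ}
    (hf : ∀ i j, (f i j).steps ≤ b) : (tabulate₂ f).steps ≤ n * (n * (b + 1) + 1) :=
  steps_tabulate_le fun i => steps_tabulate_le (hf i)

theorem steps_sum_le [AddCommMonoid α] {f : Fin n → Timed α} {b : ℕ}
    (hf : ∀ i, (f i).steps ≤ b) : (sum f).steps ≤ n * (b + 1) := sum_steps_le hf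

theorem steps_maximum_le {f : Fin n → Timed ℝ} {b : ℕ} (hf : ∀ i, (f i).steps ≤ b) :
    (maximum f).steps ≤ n * (b + 1) := sum_steps_le hf

theorem steps_any_le {f : Fin n → Timed Bool} {b : ℕ} (hf : ∀ i, (f i).steps ≤ b) :
    (any f).steps ≤ n * (b + 1) := sum_steps_le hf

theorem steps_loop_le {start : β} {body : Fin n → β → Timed β} {b : ℕ}
    (hb : ∀ i s, (body i s).steps ≤ b) : (loop start body).steps ≤ n * (b + 1) := by
  have key : ∀ (l : List (Fin n)) (s : β), (l.foldlM (fun state i => do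
      let state' ← body i state
      scalar state') s : Timed β).steps ≤ l.length * (b + 1) := by
    intro l
    induction l with
    | nil => intro s; exact Nat.zero_le _
    | cons i l ih =>
      intro s
      rw [List.foldlM_cons, List.length_cons, Nat.succ_mul, Nat.add_comm]
      exact steps_bind_le (steps_bind_le (hb i s) fun _ => steps_scalar_le _) fun _ => ih _
  simpa [loop] using key (List.finRange n) start

theorem steps_pickBest_le {better : α → α → Prop} [DecidableRel better]
    {key : Fin n → Timed (Option α)} {b : ℕ} (hk : ∀ i, (key i).steps ≤ b) :
    (pickBest better key).steps ≤ n * (b + 1 + 1) := by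
  refine steps_loop_le fun i best => steps_bind_le (hk i) fun k => ?_
  rcases k with _ | x <;> rcases best with _ | ⟨_, y⟩
  · exact Nat.zero_le _
  · exact Nat.zero_le _
  · exact Nat.zero_le _
  · exact steps_branch_le (a := 0) (b := 0) le_rfl le_rfl

end Timed

open Timed

variable {n : ℕ}

theorem estimateDistance_steps_le (A : Mat n ℝ) (S : Fin n → Bool) (hn : 1 ≤ n) :
    (estimateDistance A S).steps ≤ 100 * n ^ 3 := by
  unfold estimateDistance
  refine (steps_bind_le (steps_tabulate₂_le fun i j => steps_bind_le (steps_read_le _ _) fun _ =>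
    steps_bind_le (steps_read_le _ _) fun _ => steps_branch_le (steps_read₂_le _ _ _)
      (steps_pure_le _)) fun AS => steps_bind_le (steps_tabulate₂_le fun i j =>
      steps_sum_le fun k => steps_bind_le (steps_read₂_le _ _ _) fun _ =>
        steps_bind_le (steps_read₂_le _ _ _) fun _ => steps_scalar_le _) fun G =>
    steps_bind_le (steps_tabulate_le fun i => steps_bind_le (steps_read_le _ _) fun _ =>
      steps_branch_le (steps_bind_le (b := 0) (steps_pickBest_le fun j =>
        steps_bind_le (steps_read_le _ _) fun _ => steps_branch_le
          (steps_bind_le (steps_maximum_le fun k => steps_bind_le (steps_read_le _ _) fun _ =>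
            steps_branch_le (steps_bind_le (steps_read₂_le _ _ _) fun _ =>
              steps_bind_le (steps_read₂_le _ _ _) fun _ => steps_scalar_le _)
              (steps_pure_le _)) fun _ => steps_pure_le _) (steps_pure_le _)) fun best => ?_)
        (steps_pure_le _)) fun m => steps_tabulate₂_le fun i j =>
      steps_bind_le (steps_read_le _ _) fun _ => steps_bind_le (steps_read_le _ _) fun _ =>
        steps_branch_le (steps_bind_le (steps_read_le _ _) fun _ =>
          steps_bind_le (steps_read_le _ _) fun _ => steps_bind_le (steps_read₂_le _ _ _) fun _ =>
            steps_bind_le (steps_read₂_le _ _ _) fun _ =>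
              steps_bind_le (steps_read₂_le _ _ _) fun _ => steps_scalar_le _)
          (steps_pure_le _)).trans ?_
  · rcases best with _ | ⟨_, _⟩ <;> exact le_rfl
  · nlinarith [Nat.mul_le_mul hn hn, Nat.mul_le_mul (Nat.mul_le_mul hn hn) hn,
      Nat.mul_le_mul (le_refl n) hn, Nat.mul_le_mul (le_refl (n * n)) hn]

theorem components_steps_le (edge : Fin n → Fin n → Timed Bool) {b : ℕ} (hn : 1 ≤ n)
    (he : ∀ k l, (edge k l).steps ≤ b) : (components edge).steps ≤ (b + 20) * n ^ 2 := by
  unfold components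
  refine (steps_bind_le (steps_tabulate_le fun v => steps_pure_le _) fun start =>
    steps_loop_le fun v label => steps_bind_le (steps_tabulate_le fun _ => steps_pure_le _) fun _ =>
      steps_bind_le (steps_read_le _ _) fun lv => steps_bind_le (steps_write_le _ _ _) fun own =>
        steps_bind_le (steps_loop_le fun u T => steps_bind_le (he v u) fun e =>
          steps_branch_le (steps_bind_le (steps_read_le _ _) fun _ => steps_write_le _ _ _)
            (steps_pure_le _)) fun touched =>
          steps_tabulate_le fun u => steps_bind_le (steps_read_le _ _) fun _ =>
            steps_bind_le (steps_read_le _ _) fun _ =>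
              steps_branch_le (steps_pure_le _) (steps_pure_le _)).trans ?_
  nlinarith [Nat.mul_le_mul hn hn, Nat.mul_le_mul (le_refl n) hn,
    Nat.mul_le_mul (Nat.mul_le_mul (le_refl n) hn) (le_refl b)]

theorem bisection_steps_le (D : Mat n ℝ) (δ₁ δ₂ δ₃ : ℝ) (i : Fin n) (hn : 1 ≤ n) :
    (bisection D δ₁ δ₂ δ₃ i).steps ≤ 100 * n ^ 2 := by
  unfold bisection
  refine (steps_bind_le (components_steps_le _ hn fun k l =>
    steps_bind_le (steps_read₂_le _ _ _) fun _ => steps_bind_le (steps_read₂_le _ _ _) fun _ =>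
      steps_bind_le (steps_read₂_le _ _ _) fun _ => steps_scalar_le _) fun label =>
    steps_bind_le (steps_tabulate_le fun _ => steps_pure_le _) fun zeros =>
    steps_bind_le (steps_loop_le fun u s => steps_branch_le
      (steps_bind_le (steps_read_le _ _) fun _ => steps_bind_le (steps_read_le _ _) fun _ =>
        steps_write_le _ _ _) (steps_pure_le _)) fun size =>
    steps_bind_le (steps_tabulate_le fun _ => steps_pure_le _) fun near =>
    steps_bind_le (steps_loop_le fun u T => steps_bind_le (steps_read₂_le _ _ _) fun _ =>
      steps_branch_le (steps_bind_le (steps_read_le _ _) fun _ => steps_write_le _ _ _)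
        (steps_pure_le _)) fun far =>
    steps_bind_le (steps_pickBest_le fun c => steps_bind_le (steps_read_le _ _) fun _ =>
      steps_branch_le (steps_bind_le (steps_read_le _ _) fun _ => steps_pure_le _)
        (steps_pure_le _)) fun first =>
    steps_bind_le (steps_pickBest_le fun c => steps_bind_le (steps_read_le _ _) fun _ =>
      steps_branch_le (steps_bind_le (steps_read_le _ _) fun _ => steps_pure_le _)
        (steps_pure_le _)) fun second =>
    steps_bind_le (steps_tabulate_le fun u => steps_bind_le (steps_read_le _ _) fun _ =>
      steps_scalar_le _) fun G =>
    steps_bind_le (steps_tabulate_le fun u => steps_bind_le (steps_read_le _ _) fun _ =>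
      steps_scalar_le _) fun G' => steps_pure_le _).trans ?_
  nlinarith [Nat.mul_le_mul hn hn, Nat.mul_le_mul (le_refl n) hn]

theorem orientation_steps_le (B : Fin n → Bisection n) (hn : 1 ≤ n) :
    (orientation B).steps ≤ 100 * n ^ 2 := by
  unfold orientation
  refine (steps_bind_le (b := 50 * n ^ 2) (steps_pickBest_le fun i =>
    steps_bind_le (steps_read_le _ _) fun _ => steps_scalar_le _) fun best => ?_).trans ?_
  · rcases best with _ | ⟨c, _⟩
    · exact Nat.zero_le _
    · refine (steps_bind_le (steps_read_le _ _) fun bc =>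
        steps_bind_le (steps_tabulate_le fun i => steps_bind_le (steps_read_le _ _) fun _ =>
          steps_branch_le (steps_pure_le _) (steps_branch_le (steps_read_le _ _)
            (steps_bind_le (steps_any_le fun k => steps_bind_le (steps_read_le _ _) fun _ =>
              steps_bind_le (steps_read_le _ _) fun _ => steps_scalar_le _) fun _ =>
            steps_bind_le (steps_any_le fun k => steps_bind_le (steps_read_le _ _) fun _ =>
              steps_bind_le (steps_read_le _ _) fun _ => steps_scalar_le _) fun _ =>
            steps_scalar_le _))) fun flip =>
        steps_bind_le (steps_tabulate₂_le fun i k => steps_bind_le (steps_read_le _ _) fun _ =>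
          steps_bind_le (steps_read_le _ _) fun _ =>
            steps_branch_le (steps_read_le _ _) (steps_read_le _ _)) fun L =>
        steps_bind_le (steps_tabulate₂_le fun i k => steps_bind_le (steps_read_le _ _) fun _ =>
          steps_bind_le (steps_read_le _ _) fun _ =>
            steps_branch_le (steps_read_le _ _) (steps_read_le _ _)) fun R =>
        steps_pure_le _).trans ?_
      nlinarith [Nat.mul_le_mul hn hn, Nat.mul_le_mul (le_refl n) hn]
  · nlinarith [Nat.mul_le_mul hn hn, Nat.mul_le_mul (le_refl n) hn]

theorem aggregateBisections_steps_le (D : Mat n ℝ) (δ₁ δ₂ δ₃ : ℝ) (hn : 1 ≤ n) :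
    (aggregateBisections D δ₁ δ₂ δ₃).steps ≤ 300 * n ^ 3 := by
  unfold aggregateBisections
  refine (steps_bind_le (steps_tabulate_le fun i => bisection_steps_le D δ₁ δ₂ δ₃ i hn) fun B =>
    steps_bind_le (orientation_steps_le B hn) fun LR =>
    steps_bind_le (steps_tabulate_le fun i => steps_any_le fun k =>
      steps_bind_le (steps_read₂_le _ _ _) fun _ => steps_bind_le (steps_read₂_le _ _ _) fun _ =>
        steps_scalar_le _) fun nonempty =>
    steps_tabulate₂_le fun i j => steps_bind_le (steps_read_le _ _) fun _ => steps_branch_le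
      (steps_bind_le (steps_read₂_le _ _ _) fun _ => steps_bind_le (steps_read₂_le _ _ _) fun _ =>
        steps_bind_le (steps_read₂_le _ _ _) fun _ => steps_bind_le (steps_read₂_le _ _ _) fun _ =>
          steps_scalar_le _) (steps_pure_le _)).trans ?_
  nlinarith [Nat.mul_le_mul hn hn, Nat.mul_le_mul (Nat.mul_le_mul hn hn) hn,
    Nat.mul_le_mul (le_refl n) hn, Nat.mul_le_mul (le_refl (n * n)) hn]

theorem reevaluateComparisons_steps_le (H : Mat n ℤ) (D A : Mat n ℝ) (σ δ₄ : ℝ)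
    (part : Fin n → Fin 3) (hn : 1 ≤ n) :
    (reevaluateComparisons H D A σ δ₄ part).steps ≤ 500 * n ^ 3 := by
  unfold reevaluateComparisons
  refine (steps_bind_le (steps_tabulate_le fun t => steps_bind_le (steps_tabulate_le fun k =>
      steps_bind_le (steps_read_le _ _) fun _ => steps_scalar_le _) fun S =>
      estimateDistance_steps_le A S hn) fun Dblock =>
    steps_bind_le (steps_scalar_le _) fun threshold =>
    steps_bind_le (steps_tabulate₂_le fun i j => steps_bind_le (steps_read₂_le _ _ _) fun _ =>
      steps_branch_le (b := 0) (steps_bind_le (steps_read_le _ _) fun _ =>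
        steps_bind_le (steps_read_le _ _) fun _ => steps_bind_le (steps_scalar_le _) fun t =>
        steps_bind_le (steps_read_le _ _) fun Dt =>
        steps_bind_le (b := 50 * n) (steps_pickBest_le fun p =>
          steps_bind_le (steps_read_le _ _) fun _ => steps_branch_le
            (steps_bind_le (steps_read₂_le _ _ _) fun _ => steps_pure_le _) (steps_pure_le _))
          fun best => ?_) (steps_pure_le _)) fun Htilde =>
    steps_tabulate₂_le fun i j => steps_bind_le (steps_read₂_le _ _ _) fun _ =>
      steps_bind_le (steps_read₂_le _ _ _) fun _ => steps_bind_le (steps_read₂_le _ _ _) fun _ =>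
        steps_scalar_le _).trans ?_
  · rcases best with _ | ⟨p, _⟩
    · exact Nat.zero_le _
    · have side : ∀ v : ℤ, (sum fun k => do
            let s ← read part k
            let hik ← read₂ H i k
            let hjk ← read₂ H j k
            let d ← read₂ Dt p k
            branch (s = t ∧ hik = v ∧ hjk = v ∧ δ₄ ≤ d)
              (do
                let x ← read₂ A i k
                let y ← read₂ A j k
                scalar (x - y))
              (pure 0)).steps ≤ _ := fun v =>
        steps_sum_le fun k => steps_bind_le (steps_read_le _ _) fun _ =>
          steps_bind_le (steps_read₂_le _ _ _) fun _ => steps_bind_le (steps_read₂_le _ _ _) fun _ =>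
          steps_bind_le (steps_read₂_le _ _ _) fun _ => steps_branch_le
            (steps_bind_le (steps_read₂_le _ _ _) fun _ =>
              steps_bind_le (steps_read₂_le _ _ _) fun _ => steps_scalar_le _) (steps_pure_le _)
      refine (steps_bind_le (side 1) fun _ => steps_bind_le (side (-1)) fun _ =>
        steps_scalar_le _).trans ?_
      omega
  · nlinarith [Nat.mul_le_mul hn hn, Nat.mul_le_mul (Nat.mul_le_mul hn hn) hn,
      Nat.mul_le_mul (le_refl n) hn, Nat.mul_le_mul (le_refl (n * n)) hn]

theorem sabre_steps_le (A : Mat n ℝ) (σ δ₁ δ₂ δ₃ δ₄ : ℝ) (part : Fin n → Fin 3) (hn : 1 ≤ n) :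
    (sabre A σ δ₁ δ₂ δ₃ δ₄ part).steps ≤ 1000 * n ^ 3 := by
  unfold sabre
  refine (steps_bind_le (estimateDistance_steps_le A _ hn) fun D =>
    steps_bind_le (aggregateBisections_steps_le D δ₁ δ₂ δ₃ hn) fun H =>
    steps_bind_le (a := n) le_rfl fun part' =>
    steps_bind_le (reevaluateComparisons_steps_le H D A σ δ₄ part' hn) fun Hhat =>
    steps_tabulate_le fun i => steps_bind_le (steps_sum_le fun j => steps_read₂_le _ _ _) fun s =>
      steps_scalar_le _).trans ?_
  nlinarith [Nat.mul_le_mul hn hn, Nat.mul_le_mul (Nat.mul_le_mul hn hn) hn,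
    Nat.mul_le_mul (le_refl n) hn, Nat.mul_le_mul (le_refl (n * n)) hn]

/-! ### Values computed by the programs -/

namespace Timed

variable {α β : Type}

theorem val_bind (x : Timed α) (f : α → Timed β) : (x >>= f).val = (f x.val).val := rfl

theorem val_pure (a : α) : (pure a : Timed α).val = a := rfl

theorem val_read (a : Fin n → α) (i : Fin n) : (read a i).val = a i := rfl

theorem val_read₂ (a : Mat n α) (i j : Fin n) : (read₂ a i j).val = a i j := rfl

theorem val_foldlM (body : Fin n → β → Timed β) (l : List (Fin n)) (start : β) :
    (l.foldlM (fun state i => do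
      let state' ← body i state
      scalar state') start : Timed β).val = l.foldl (fun s i => (body i s).val) start := by
  induction l generalizing start with
  | nil => rfl
  | cons i l ih => rw [List.foldlM_cons, List.foldl_cons, val_bind, ih]; rfl

/-- Loop invariants: `P` holds of the set of the indices already treated and the current state. -/
theorem loop_induction (P : Finset (Fin n) → β → Prop) {start : β} {body : Fin n → β → Timed β}
    (h0 : P ∅ start)
    (hstep : ∀ (s : Finset (Fin n)) (i : Fin n) (b : β), (∀ j, j ∈ s ↔ j < i) → P s b →
      P (insert i s) (body i b).val) :
    P Finset.univ (loop start body).val := by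
  have key : ∀ k (hk : k ≤ n), P (Finset.univ.filter fun i : Fin n => (i : ℕ) < k)
      (((List.finRange n).take k).foldl (fun s i => (body i s).val) start) := by
    intro k
    induction k with
    | zero => intro _; simpa using h0
    | succ k ih =>
      intro hk
      have hlen : k < (List.finRange n).length := by simpa using hk
      have h1 := hstep _ ⟨k, hk⟩ _ (by intro j; simp [Fin.lt_def]) (ih (by omega))
      rw [List.take_succ_eq_append_getElem hlen, List.foldl_append]
      convert h1 using 1
      · ext j; simp [Fin.ext_iff]; omega
      · simp
  have := key n le_rfl
  rw [List.take_of_length_le (by simp)] at this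
  rw [loop, val_foldlM]
  convert this using 1
  ext j; simp

/-- What `pickBest` returns: nothing if all keys are `none`, and otherwise the first index with a
best key. -/
theorem pickBest_spec {better : α → α → Prop} [DecidableRel better]
    (hirr : ∀ x, ¬ better x x) (htrans : ∀ x y z, better x y → better y z → better x z)
    (hneg : ∀ x y z, ¬ better y x → ¬ better z y → ¬ better z x)
    (key : Fin n → Timed (Option α)) :
    ((pickBest better key).val = none ∧ ∀ i, (key i).val = none) ∨
    ∃ i x, (pickBest better key).val = some (i, x) ∧ (key i).val = some x ∧
      (∀ j y, (key j).val = some y → ¬ better y x) ∧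
      ∀ j y, j < i → (key j).val = some y → better x y := by
  suffices h : (fun (s : Finset (Fin n)) (r : Option (Fin n × α)) =>
      (r = none ∧ ∀ i ∈ s, (key i).val = none) ∨
      ∃ i x, r = some (i, x) ∧ i ∈ s ∧ (key i).val = some x ∧
        (∀ j ∈ s, ∀ y, (key j).val = some y → ¬ better y x) ∧
        ∀ j ∈ s, ∀ y, j < i → (key j).val = some y → better x y) Finset.univ
      (pickBest better key).val by
    simpa using h
  refine loop_induction (fun (s : Finset (Fin n)) (r : Option (Fin n × α)) =>
      (r = none ∧ ∀ i ∈ s, (key i).val = none) ∨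
      ∃ i x, r = some (i, x) ∧ i ∈ s ∧ (key i).val = some x ∧
        (∀ j ∈ s, ∀ y, (key j).val = some y → ¬ better y x) ∧
        ∀ j ∈ s, ∀ y, j < i → (key j).val = some y → better x y) (Or.inl ⟨rfl, by simp⟩) ?_
  intro s i r hs hr
  have hlt : ∀ j ∈ s, j < i := fun j hj => (hs j).1 hj
  rw [val_bind]
  rcases hk : (key i).val with _ | x
  · have hm : ∀ j ∈ insert i s, ∀ y, (key j).val = some y → j ∈ s := by
      intro j hj y hy
      rcases Finset.mem_insert.1 hj with rfl | h
      · simp [hk] at hy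
      · exact h
    rcases hr with ⟨rfl, hr⟩ | ⟨k, z, rfl, hks, hkz, h1, h2⟩
    · left
      refine ⟨rfl, fun j hj => ?_⟩
      rcases Finset.mem_insert.1 hj with rfl | h
      · exact hk
      · exact hr j h
    · right
      exact ⟨k, z, rfl, Finset.mem_insert_of_mem hks, hkz, fun j hj y hy => h1 j (hm j hj y hy) y hy,
        fun j hj y hjk hy => h2 j (hm j hj y hy) y hjk hy⟩
  · rcases hr with ⟨rfl, hr⟩ | ⟨k, z, rfl, hks, hkz, h1, h2⟩
    · right
      refine ⟨i, x, rfl, Finset.mem_insert_self _ _, hk, fun j hj y hy => ?_,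
        fun j hj y hji hy => ?_⟩
      · rcases Finset.mem_insert.1 hj with rfl | h
        · rw [hk] at hy; cases hy; exact hirr x
        · simp [hr j h] at hy
      · rcases Finset.mem_insert.1 hj with rfl | h
        · exact absurd hji (lt_irrefl _)
        · simp [hr j h] at hy
    · right
      by_cases hb : better x z
      · refine ⟨i, x, by simp [branch, hb, val_pure], Finset.mem_insert_self _ _, hk,
          fun j hj y hy => ?_, fun j hj y hji hy => ?_⟩
        · rcases Finset.mem_insert.1 hj with rfl | h
          · rw [hk] at hy; cases hy; exact hirr x
          · exact fun hyx => h1 j h y hy (htrans _ _ _ hyx hb)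
        · rcases Finset.mem_insert.1 hj with rfl | h
          · exact absurd hji (lt_irrefl _)
          · by_contra hxy
            exact hneg z y x (h1 j h y hy) hxy hb
      · refine ⟨k, z, by simp [branch, hb, val_pure], Finset.mem_insert_of_mem hks, hkz,
          fun j hj y hy => ?_, fun j hj y hjk hy => ?_⟩
        · rcases Finset.mem_insert.1 hj with rfl | h
          · rw [hk] at hy; cases hy; exact hb
          · exact h1 j h y hy
        · rcases Finset.mem_insert.1 hj with rfl | h
          · exact absurd (hlt k hks) (not_lt.2 hjk.le)
          · exact h2 j h y hjk hy

theorem pickBest_lt_spec (key : Fin n → Timed (Option ℝ)) :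
    ((pickBest (fun x y : ℝ => x < y) key).val = none ∧ ∀ i, (key i).val = none) ∨
    ∃ i x, (pickBest (fun x y : ℝ => x < y) key).val = some (i, x) ∧ (key i).val = some x ∧
      (∀ j y, (key j).val = some y → x ≤ y) ∧ ∀ j y, j < i → (key j).val = some y → x < y := by
  simpa only [not_lt] using pickBest_spec (better := fun x y : ℝ => x < y) (fun x => lt_irrefl x)
    (fun x y z h1 h2 => h1.trans h2)
    (fun x y z h1 h2 => not_lt.2 ((not_lt.1 h1).trans (not_lt.1 h2))) key

theorem pickBest_gt_spec (key : Fin n → Timed (Option ℕ)) :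
    ((pickBest (fun x y : ℕ => y < x) key).val = none ∧ ∀ i, (key i).val = none) ∨
    ∃ i x, (pickBest (fun x y : ℕ => y < x) key).val = some (i, x) ∧ (key i).val = some x ∧
      ∀ j y, (key j).val = some y → y ≤ x := by
  rcases pickBest_spec (better := fun x y : ℕ => y < x) (fun x => lt_irrefl x)
    (fun x y z h1 h2 => h2.trans h1)
    (fun x y z h1 h2 => not_lt.2 ((not_lt.1 h2).trans (not_lt.1 h1))) key with h | h
  · exact Or.inl h
  · obtain ⟨i, x, h1, h2, h3, -⟩ := h
    exact Or.inr ⟨i, x, h1, h2, fun j y hy => not_lt.1 (h3 j y hy)⟩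

theorem loop_write_true (p : Fin n → Prop) [DecidablePred p] (c : Fin n → Fin n)
    (start : Fin n → Bool) (body : Fin n → (Fin n → Bool) → Timed (Fin n → Bool))
    (hbody : ∀ u T, (body u T).val = if p u then Function.update T (c u) true else T) (x : Fin n) :
    (loop start body).val x = true ↔ start x = true ∨ ∃ u, p u ∧ c u = x := by
  suffices h : (fun (s : Finset (Fin n)) (T : Fin n → Bool) =>
      T x = true ↔ start x = true ∨ ∃ u ∈ s, p u ∧ c u = x) Finset.univ (loop start body).val by
    simpa using h
  refine loop_induction (fun (s : Finset (Fin n)) (T : Fin n → Bool) =>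
      T x = true ↔ start x = true ∨ ∃ u ∈ s, p u ∧ c u = x) (by simp) ?_
  intro s i T _ hT
  simp only [Finset.exists_mem_insert, hbody]
  by_cases hp : p i
  · by_cases hx : c i = x
    · subst hx; simp [hp]
    · rw [if_pos hp, Function.update_of_ne (Ne.symm hx), hT]; simp [hx]
  · simp [hp, hT]

theorem loop_count (p : Fin n → Prop) [DecidablePred p] (c : Fin n → Fin n)
    (body : Fin n → (Fin n → ℕ) → Timed (Fin n → ℕ))
    (hbody : ∀ u T, (body u T).val = if p u then Function.update T (c u) (T (c u) + 1) else T)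
    (x : Fin n) :
    (loop (fun _ => 0) body).val x = (Finset.univ.filter fun u => p u ∧ c u = x).card := by
  refine loop_induction (fun (s : Finset (Fin n)) (T : Fin n → ℕ) =>
      T x = (s.filter fun u => p u ∧ c u = x).card) (by simp) ?_
  intro s i T hs hT
  have hi : i ∉ s := fun h => lt_irrefl _ ((hs i).1 h)
  rw [Finset.filter_insert, hbody]
  by_cases hp : p i
  · by_cases hx : c i = x
    · subst hx
      rw [if_pos hp, if_pos (And.intro hp rfl), Finset.card_insert_of_notMem (by simp [hi])]
      simp [hT]
    · rw [if_pos hp, Function.update_of_ne (Ne.symm hx), hT]; simp [hx]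
  · simp [hp, hT]

end Timed

/-- The two properties of the labels of `components`: adjacent vertices have the same label, and
a set which is not left by any edge is not separated by a label class. -/
theorem components_spec (edge : Fin n → Fin n → Timed Bool) :
    (∀ u v, (edge u v).val = true → (components edge).val u = (components edge).val v) ∧
    ∀ P : Fin n → Prop, (∀ u v, (edge u v).val = true → (P u ↔ P v)) →
      ∀ u v, (components edge).val u = (components edge).val v → (P u ↔ P v) := by
  have key := loop_induction (fun (s : Finset (Fin n)) (label : Fin n → Fin n) =>
      (∀ u w, u ∈ s → (edge u w).val = true → label u = label w) ∧
      (∀ w x, x ∉ s → label w = x → w = x) ∧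
      ∀ P : Fin n → Prop, (∀ u v, (edge u v).val = true → (P u ↔ P v)) →
        ∀ u v, label u = label v → (P u ↔ P v))
    (start := fun v => v)
    (body := fun v label => do
      let none' ← tabulate fun _ => pure false
      let lv ← read label v
      let own ← write none' lv true
      let touched ← loop own fun u T => do
        let e ← edge v u
        branch (e = true)
          (do
            let lu ← read label u
            write T lu true)
          (pure T)
      tabulate fun u => do
        let lu ← read label u
        let b ← read touched lu
        branch (b = true) (pure v) (pure lu))
    ⟨by simp, fun w x _ h => h, fun P _ u v h => by rw [show u = v from h]⟩ ?_
  · refine ⟨fun u v h => key.1 u v (Finset.mem_univ _) h, key.2.2⟩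
  · rintro s v label hs ⟨h1, h2, h3⟩
    have hv : v ∉ s := fun h => lt_irrefl _ ((hs v).1 h)
    let touched := (loop (Function.update (fun _ => false) (label v) true) fun u T => do
      let e ← edge v u
      branch (e = true)
        (do
          let lu ← read label u
          write T lu true)
        (pure T)).val
    suffices h : (∀ u w, u ∈ insert v s → (edge u w).val = true →
        (if touched (label u) = true then v else label u) =
          if touched (label w) = true then v else label w) ∧
        (∀ w x, x ∉ insert v s → (if touched (label w) = true then v else label w) = x → w = x) ∧
        ∀ P : Fin n → Prop, (∀ u v, (edge u v).val = true → (P u ↔ P v)) →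
          ∀ u w, (if touched (label u) = true then v else label u) =
            (if touched (label w) = true then v else label w) → (P u ↔ P w) from h
    have ht : ∀ x, touched x = true ↔ x = label v ∨ ∃ u, (edge v u).val = true ∧ label u = x := by
      intro x
      refine (loop_write_true (fun u => (edge v u).val = true) label _ _ (fun u T => rfl) x).trans ?_
      by_cases hx : x = label v <;> simp [hx]
    have hvv : touched (label v) = true := (ht _).2 (Or.inl rfl)
    have hnew : ∀ w x, x ∉ insert v s →
        (if touched (label w) = true then v else label w) = x → w = x := by
      intro w x hx hw
      rw [Finset.mem_insert, not_or] at hx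
      split_ifs at hw with h
      · exact absurd hw.symm hx.1
      · exact h2 w x hx.2 hw
    refine ⟨fun u w hu huw => ?_, hnew, fun P hP u w huw => ?_⟩
    · rcases Finset.mem_insert.1 hu with rfl | hu
      · rw [if_pos hvv, if_pos ((ht _).2 (Or.inr ⟨w, huw, rfl⟩))]
      · rw [h1 u w hu huw]
    · have hPt : ∀ y, touched (label y) = true → (P y ↔ P v) := by
        intro y hy
        rcases (ht _).1 hy with h | ⟨z, hz, hzy⟩
        · exact h3 P hP _ _ h
        · rw [hP v z hz]; exact h3 P hP _ _ hzy.symm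
      -- A class that is not merged cannot already carry the label `v`.
      have hfresh : ∀ y, ¬ touched (label y) = true → label y ≠ v := by
        intro y hy hyv
        have := h2 y v hv hyv
        subst this
        exact hy hvv
      split_ifs at huw with ha hb hb
      · rw [hPt u ha, hPt w hb]
      · exact absurd huw.symm (hfresh w hb)
      · exact absurd huw (hfresh u ha)
      · exact h3 P hP _ _ huw

/-! ### The first seriation -/

/-- The bisection of `i` in terms of labels of the components of its graph. The label is constant
along edges, and a property that is preserved along edges is constant on the indices with the same
label. Either no index is far from `i`, or `G` is the component of a far index `u`, and `G'` is the
component of another far index `v`, or is empty if all far indices have the label of `u`. -/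
theorem bisection_spec (D : Mat n ℝ) (δ₁ δ₂ δ₃ : ℝ) (i : Fin n) :
    ∃ label : Fin n → Fin n,
      (∀ k l, k ≠ i → l ≠ i → k ≠ l → D k l ≤ δ₁ → δ₂ ≤ max (D i k) (D i l) → label k = label l) ∧
      (∀ P : Fin n → Prop, (∀ k l, k ≠ i → l ≠ i → D k l ≤ δ₁ → δ₂ ≤ max (D i k) (D i l) →
        (P k ↔ P l)) → ∀ k l, label k = label l → (P k ↔ P l)) ∧
      ((∀ u, u ≠ i → D i u < δ₃) ∨
        ∃ u, u ≠ i ∧ δ₃ ≤ D i u ∧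
          (∀ k, (bisection D δ₁ δ₂ δ₃ i).val.G k = true ↔ label k = label u) ∧
          (bisection D δ₁ δ₂ δ₃ i).val.card = (Finset.univ.filter fun k => label k = label u).card ∧
          (((∀ v, v ≠ i → δ₃ ≤ D i v → label v = label u) ∧
              (∀ k, (bisection D δ₁ δ₂ δ₃ i).val.G' k = false) ∧
              (bisection D δ₁ δ₂ δ₃ i).val.card' = 0) ∨
            ∃ v, v ≠ i ∧ δ₃ ≤ D i v ∧ label v ≠ label u ∧
              (∀ k, (bisection D δ₁ δ₂ δ₃ i).val.G' k = true ↔ label k = label v) ∧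
              (bisection D δ₁ δ₂ δ₃ i).val.card' =
                (Finset.univ.filter fun k => label k = label v).card)) := by
  let edge : Fin n → Fin n → Timed Bool := fun k l => do
    let x ← read₂ D k l
    let y ← read₂ D i k
    let z ← read₂ D i l
    scalar (decide (k ≠ i ∧ l ≠ i ∧ k ≠ l ∧ x ≤ δ₁ ∧ δ₂ ≤ max y z))
  let label := (components edge).val
  let size := (loop (fun _ => 0) fun u (s : Fin n → ℕ) =>
    branch (u ≠ i)
      (do
        let c ← read label u
        let m ← read s c
        write s c (m + 1))
      (pure s)).val
  let far := (loop (fun _ => false) fun u (T : Fin n → Bool) => do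
    let y ← read₂ D i u
    branch (u ≠ i ∧ δ₃ ≤ y)
      (do
        let c ← read label u
        write T c true)
      (pure T)).val
  let key₁ : Fin n → Timed (Option ℕ) := fun c => do
    let f ← read far c
    branch (f = true)
      (do
        let m ← read size c
        pure (some m))
      (pure none)
  let first := (pickBest (fun x y : ℕ => y < x) key₁).val
  let key₂ : Fin n → Timed (Option ℕ) := fun c => do
    let f ← read far c
    branch (f = true ∧ first.map Prod.fst ≠ some c)
      (do
        let m ← read size c
        pure (some m))
      (pure none)
  let second := (pickBest (fun x y : ℕ => y < x) key₂).val
  have hB : (bisection D δ₁ δ₂ δ₃ i).val =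
      ⟨fun u => decide (first.map Prod.fst = some (label u)),
        fun u => decide (second.map Prod.fst = some (label u)),
        (first.map Prod.snd).getD 0, (second.map Prod.snd).getD 0⟩ := rfl
  have hedge : ∀ k l, (edge k l).val = true ↔
      k ≠ i ∧ l ≠ i ∧ k ≠ l ∧ D k l ≤ δ₁ ∧ δ₂ ≤ max (D i k) (D i l) :=
    fun k l => decide_eq_true_iff
  obtain ⟨hc1, hc2⟩ := components_spec edge
  -- `i` is isolated, so the sizes, which are counted over `u ≠ i`, are those of whole components
  have hi : ∀ u, label u = label i → u = i := fun u hu =>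
    (hc2 (fun w => w = i) (fun k l hkl => by
      have := (hedge k l).1 hkl; simp [this.1, this.2.1]) u i hu).2 rfl
  have hsize : ∀ u, u ≠ i →
      size (label u) = (Finset.univ.filter fun k => label k = label u).card := by
    intro u hu
    refine (loop_count (fun u => u ≠ i) label _ (fun u T => rfl) (label u)).trans ?_
    congr 1
    ext k
    simp only [Finset.mem_filter, Finset.mem_univ, true_and, and_iff_right_iff_imp]
    rintro hk rfl
    exact hu (hi u hk.symm)
  have hfar : ∀ c, far c = true ↔ ∃ u, (u ≠ i ∧ δ₃ ≤ D i u) ∧ label u = c := by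
    intro c
    refine (loop_write_true (fun u => u ≠ i ∧ δ₃ ≤ D i u) label _ _ (fun u T => rfl) c).trans ?_
    simp
  have hk1 : ∀ c, (key₁ c).val = if far c = true then some (size c) else none := fun c => rfl
  have hk2 : ∀ c, (key₂ c).val =
      if far c = true ∧ first.map Prod.fst ≠ some c then some (size c) else none := fun c => rfl
  rw [hB]
  refine ⟨label, fun k l h1 h2 h3 h4 h5 => hc1 k l ((hedge k l).2 ⟨h1, h2, h3, h4, h5⟩),
    fun P hP => hc2 P fun k l hkl => ?_, ?_⟩
  · have := (hedge k l).1 hkl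
    exact hP k l this.1 this.2.1 this.2.2.2.1 this.2.2.2.2
  rcases pickBest_gt_spec key₁ with ⟨-, h⟩ | ⟨c, m, hm, hc, -⟩
  · left
    intro u hu
    by_contra hlt
    have h1 := h (label u)
    rw [hk1, if_pos ((hfar _).2 ⟨u, ⟨hu, not_lt.1 hlt⟩, rfl⟩)] at h1
    cases h1
  · right
    have hfirst : first = some (c, m) := hm
    rw [hk1] at hc
    split_ifs at hc with hfc
    cases hc
    obtain ⟨u, ⟨hu, hDu⟩, rfl⟩ := (hfar c).1 hfc
    refine ⟨u, hu, hDu, fun k => ?_, ?_, ?_⟩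
    · simp [hfirst, eq_comm]
    · simp [hfirst, hsize u hu]
    · rcases pickBest_gt_spec key₂ with ⟨hnone, h⟩ | ⟨c', m', hm', hc', -⟩
      · left
        have hsecond : second = none := hnone
        refine ⟨fun v hv hDv => ?_, fun k => by simp [hsecond], by simp [hsecond]⟩
        by_contra hne
        have h1 := h (label v)
        rw [hk2, if_pos ⟨(hfar _).2 ⟨v, ⟨hv, hDv⟩, rfl⟩, by simp [hfirst, Ne.symm hne]⟩] at h1
        cases h1
      · right
        have hsecond : second = some (c', m') := hm'
        rw [hk2] at hc'
        split_ifs at hc' with hfc'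
        cases hc'
        obtain ⟨v, ⟨hv, hDv⟩, rfl⟩ := (hfar c').1 hfc'.1
        refine ⟨v, hv, hDv, ?_, fun k => ?_, ?_⟩
        · intro h
          exact hfc'.2 (by simp [hfirst, h])
        · simp [hsecond, eq_comm]
        · simp [hsecond, hsize v hv]

/-- The reversal of an order. -/
def reversed (π : Equiv.Perm (Fin n)) : Equiv.Perm (Fin n) := π.trans Fin.revPerm

theorem reversed_val (π : Equiv.Perm (Fin n)) (i : Fin n) :
    ((reversed π i : Fin n) : ℕ) = n - ((π i : ℕ) + 1) := by
  simp [reversed, Fin.val_rev]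

theorem reversed_coe (π : Equiv.Perm (Fin n)) (i : Fin n) :
    (((reversed π i : Fin n) : ℕ) : ℝ) = n - 1 - ((π i : ℕ) : ℝ) := by
  rw [reversed_val, Nat.cast_sub (by omega)]; push_cast; ring

theorem reversed_lt {π : Equiv.Perm (Fin n)} {i j : Fin n} :
    reversed π i < reversed π j ↔ π j < π i := by
  simp [reversed, Fin.rev_lt_rev]

theorem reversed_abs (π : Equiv.Perm (Fin n)) (i j : Fin n) :
    |(((reversed π i : Fin n) : ℕ) : ℝ) - (reversed π j : Fin n)| = |((π i : ℕ) : ℝ) - (π j : ℕ)| := by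
  rw [reversed_coe, reversed_coe, abs_sub_comm]; congr 1; ring

/-- How a dissimilarity `D` resolves the latent order `π`: indices at latent distance at least `ρ₂`
(at least `ρ₃`) are at dissimilarity at least `δ₂` (at least `δ₃`), latent neighbours are at
dissimilarity at most `δ₁`, and no edge of the graph of an index `i` jumps over `i`. -/
structure Resolves (π : Equiv.Perm (Fin n)) (D : Mat n ℝ) (δ₁ δ₂ δ₃ ρ₂ ρ₃ : ℝ) : Prop where
  symm : ∀ k l, D k l = D l k
  noCross : ∀ i k l, k ≠ i → l ≠ i → D k l ≤ δ₁ → δ₂ ≤ max (D i k) (D i l) → (π k < π i ↔ π l < π i)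
  adjacent : ∀ k l, (π k : ℕ) + 1 = π l → D k l ≤ δ₁
  far₂ : ∀ i k, ρ₂ ≤ |((π i : ℕ) : ℝ) - (π k : ℕ)| → δ₂ ≤ D i k
  of_far : ∀ i k, k ≠ i → δ₃ ≤ D i k → ρ₂ ≤ |((π i : ℕ) : ℝ) - (π k : ℕ)|
  far₃ : ∀ i k, ρ₃ ≤ |((π i : ℕ) : ℝ) - (π k : ℕ)| → δ₃ ≤ D i k
  one_le : 1 ≤ ρ₂
  one_le' : 1 ≤ ρ₃
  large : 8 * ρ₃ + 8 ≤ n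

theorem Resolves.reversed {π : Equiv.Perm (Fin n)} {D : Mat n ℝ} {δ₁ δ₂ δ₃ ρ₂ ρ₃ : ℝ}
    (h : Resolves π D δ₁ δ₂ δ₃ ρ₂ ρ₃) : Resolves (reversed π) D δ₁ δ₂ δ₃ ρ₂ ρ₃ where
  symm := h.symm
  noCross i k l hk hl h1 h2 := by
    have h3 := h.noCross i k l hk hl h1 h2
    have hk' : π k ≠ π i := fun h => hk (π.injective h)
    have hl' : π l ≠ π i := fun h => hl (π.injective h)
    rw [reversed_lt, reversed_lt, ← not_iff_not, not_lt, not_lt, hk'.le_iff_lt, hl'.le_iff_lt]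
    exact h3
  adjacent k l hkl := by
    rw [h.symm]
    refine h.adjacent l k ?_
    rw [reversed_val, reversed_val] at hkl
    have := (π k).2
    have := (π l).2
    omega
  far₂ i k := by rw [reversed_abs]; exact h.far₂ i k
  of_far i k := by rw [reversed_abs]; exact h.of_far i k
  far₃ i k := by rw [reversed_abs]; exact h.far₃ i k
  one_le := h.one_le
  one_le' := h.one_le'
  large := h.large

/-- `L` and `R` are sets of indices on the left and on the right of `i` in the latent order `π`,
which contain the indices at distance at least `ρ` on their side, and contain the extreme index of
their side unless they are empty. -/
structure IsSides (π : Equiv.Perm (Fin n)) (ρ : ℝ) (i : Fin n) (L R : Fin n → Bool) : Prop where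
  left : ∀ k, L k = true → π k < π i
  right : ∀ k, R k = true → π i < π k
  farLeft : ∀ k, ρ ≤ ((π i : ℕ) : ℝ) - (π k : ℕ) → L k = true
  farRight : ∀ k, ρ ≤ ((π k : ℕ) : ℝ) - (π i : ℕ) → R k = true
  first : ∀ k l, L k = true → (π l : ℕ) = 0 → L l = true
  last : ∀ k l, R k = true → (π l : ℕ) + 1 = n → R l = true

theorem IsSides.of_reversed {π : Equiv.Perm (Fin n)} {ρ : ℝ} {i : Fin n} {L R : Fin n → Bool}
    (h : IsSides (reversed π) ρ i L R) : IsSides π ρ i R L where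
  left k hk := reversed_lt.1 (h.right k hk)
  right k hk := reversed_lt.1 (h.left k hk)
  farLeft k hk := h.farRight k (by rw [reversed_coe, reversed_coe]; linarith)
  farRight k hk := h.farLeft k (by rw [reversed_coe, reversed_coe]; linarith)
  first k l hk hl := h.last k l hk (by rw [reversed_val]; have := (π l).2; omega)
  last k l hk hl := h.first k l hk (by rw [reversed_val]; omega)

theorem IsSides.reversed {π : Equiv.Perm (Fin n)} {ρ : ℝ} {i : Fin n} {L R : Fin n → Bool}
    (h : IsSides π ρ i L R) : IsSides (reversed π) ρ i R L := by
  refine IsSides.of_reversed ?_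
  have : Seriation.reversed (Seriation.reversed π) = π := by ext; simp [Seriation.reversed]
  rwa [this]

section Resolved

variable {π : Equiv.Perm (Fin n)} {D : Mat n ℝ} {δ₁ δ₂ δ₃ ρ₂ ρ₃ : ℝ}

/-- All the indices on the left of `i` at latent distance at least `ρ₂` have the same label, since
consecutive ones are adjacent. -/
theorem Resolves.label_eq (h : Resolves π D δ₁ δ₂ δ₃ ρ₂ ρ₃) {i : Fin n} {label : Fin n → Fin n}
    (hl : ∀ k l, k ≠ i → l ≠ i → k ≠ l → D k l ≤ δ₁ → δ₂ ≤ max (D i k) (D i l) →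
      label k = label l) (k l : Fin n) (hk : ρ₂ ≤ ((π i : ℕ) : ℝ) - (π k : ℕ))
    (hl' : ρ₂ ≤ ((π i : ℕ) : ℝ) - (π l : ℕ)) : label k = label l := by
  wlog hkl : (π k : ℕ) ≤ π l generalizing k l
  · exact (this l k hl' hk (by omega)).symm
  obtain ⟨m, hm⟩ := Nat.exists_eq_add_of_le hkl
  induction m generalizing l with
  | zero =>
    rw [show k = l from π.injective (Fin.ext (by omega))]
  | succ m ih =>
    have hlt : (π k : ℕ) + m < n := by have := (π l).2; omega
    set w := π.symm ⟨(π k : ℕ) + m, hlt⟩ with hw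
    have hπw : ((π w : Fin n) : ℕ) = π k + m := by simp [hw]
    have hwl : ((π w : ℕ) : ℝ) + 1 = (π l : ℕ) := by
      rw [hπw, hm]; push_cast; ring
    have hρ := h.one_le
    have hwi : ρ₂ ≤ ((π i : ℕ) : ℝ) - (π w : ℕ) := by linarith
    refine (ih w hwi (by omega) hπw).trans (hl w l ?_ ?_ ?_ (h.adjacent w l (by omega)) ?_)
    · rintro h; rw [h] at hwi; linarith
    · rintro h; rw [h] at hl'; linarith
    · rintro h; rw [h] at hwl; linarith
    · exact le_max_of_le_left (h.far₂ i w (hwi.trans (le_abs_self _)))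

theorem Resolves.exists_far (h : Resolves π D δ₁ δ₂ δ₃ ρ₂ ρ₃) (i : Fin n) :
    ∃ k, ρ₃ ≤ ((π i : ℕ) : ℝ) - (π k : ℕ) ∨ ρ₃ ≤ ((π k : ℕ) : ℝ) - (π i : ℕ) := by
  have hn := h.large
  have h1 := h.one_le'
  have hn0 : 0 < n := i.pos
  by_cases hi : ρ₃ ≤ ((π i : ℕ) : ℝ)
  · exact ⟨π.symm ⟨0, hn0⟩, Or.inl (by simpa using hi)⟩
  · refine ⟨π.symm ⟨n - 1, by omega⟩, Or.inr ?_⟩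
    simp only [Equiv.apply_symm_apply]
    rw [Nat.cast_sub (by omega)]; push_cast; linarith

/-- If `G` is the component of a far index on the left of `i`, and `G'` is the component of a far
index with another label, if there is one, then `G` and `G'` are the left and the right side of `i`. -/
theorem Resolves.isSides_of_left (h : Resolves π D δ₁ δ₂ δ₃ ρ₂ ρ₃) {i : Fin n}
    {label : Fin n → Fin n}
    (hl : ∀ k l, k ≠ i → l ≠ i → k ≠ l → D k l ≤ δ₁ → δ₂ ≤ max (D i k) (D i l) →
      label k = label l)
    (hP : ∀ P : Fin n → Prop, (∀ k l, k ≠ i → l ≠ i → D k l ≤ δ₁ → δ₂ ≤ max (D i k) (D i l) →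
        (P k ↔ P l)) → ∀ k l, label k = label l → (P k ↔ P l))
    {u : Fin n} {G G' : Fin n → Bool} (hDu : δ₃ ≤ D i u) (hui : π u < π i)
    (hG : ∀ k, G k = true ↔ label k = label u)
    (hG' : ((∀ v, v ≠ i → δ₃ ≤ D i v → label v = label u) ∧ ∀ k, G' k = false) ∨
      ∃ v, v ≠ i ∧ δ₃ ≤ D i v ∧ label v ≠ label u ∧ ∀ k, G' k = true ↔ label k = label v) :
    IsSides π ρ₃ i G G' := by
  have hcross : ∀ k l, label k = label l → (π k < π i ↔ π l < π i) :=
    hP (fun k => π k < π i) (h.noCross i)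
  have hself : ∀ k l, label k = label l → (k = i ↔ l = i) :=
    hP (fun k => k = i) fun k l hk hl _ _ => by simp [hk, hl]
  have hρ := h.one_le
  have hρ' := h.one_le'
  have hleft : ∀ v, δ₃ ≤ D i v → π v < π i → ρ₂ ≤ ((π i : ℕ) : ℝ) - (π v : ℕ) := by
    intro v hv hvi
    have h1 := h.of_far i v (by rintro rfl; exact lt_irrefl _ hvi) hv
    have h2 : ((π v : ℕ) : ℝ) < (π i : ℕ) := by exact_mod_cast hvi
    rwa [abs_of_pos (by linarith)] at h1
  have hright : ∀ v, δ₃ ≤ D i v → π i < π v → ρ₂ ≤ ((π v : ℕ) : ℝ) - (π i : ℕ) := by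
    intro v hv hvi
    have h1 := h.of_far i v (by rintro rfl; exact lt_irrefl _ hvi) hv
    have h2 : ((π i : ℕ) : ℝ) < (π v : ℕ) := by exact_mod_cast hvi
    rwa [abs_sub_comm, abs_of_pos (by linarith)] at h1
  have hlab : ∀ k l, ρ₂ ≤ ((π k : ℕ) : ℝ) - (π i : ℕ) → ρ₂ ≤ ((π l : ℕ) : ℝ) - (π i : ℕ) →
      label k = label l := fun k l hk hl' => h.reversed.label_eq hl k l
    (by rw [reversed_coe, reversed_coe]; linarith) (by rw [reversed_coe, reversed_coe]; linarith)
  -- a far index with another label can only be on the right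
  have hrv : ∀ v, v ≠ i → δ₃ ≤ D i v → label v ≠ label u → π i < π v := by
    intro v hv hDv hne
    rcases lt_trichotomy (π v) (π i) with h1 | h1 | h1
    · exact absurd (h.label_eq hl v u (hleft v hDv h1) (hleft u hDu hui)) hne
    · exact absurd (π.injective h1) hv
    · exact h1
  refine ⟨fun k hk => (hcross k u ((hG k).1 hk)).2 hui, fun k hk => ?_, fun k hk => ?_,
    fun k hk => ?_, fun k l _ hl0 => ?_, fun k l hk hln => ?_⟩
  · rcases hG' with ⟨-, h0⟩ | ⟨v, hv, hDv, hne, h0⟩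
    · simp [h0] at hk
    · have h1 := hrv v hv hDv hne
      have h2 := hcross k v ((h0 k).1 hk)
      have h3 := hself k v ((h0 k).1 hk)
      refine lt_of_le_of_ne (not_lt.1 fun h => absurd (h2.1 h) (not_lt.2 h1.le)) fun h => ?_
      exact hv (h3.1 (π.injective h.symm))
  · have h1 : δ₃ ≤ D i k := h.far₃ i k (hk.trans (le_abs_self _))
    have h2 : ((π k : ℕ) : ℝ) < (π i : ℕ) := by linarith
    have h3 : π k < π i := by exact_mod_cast h2
    exact (hG k).2 (h.label_eq hl k u (hleft k h1 h3) (hleft u hDu hui))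
  · have h1 : δ₃ ≤ D i k := h.far₃ i k (by rw [abs_sub_comm]; exact hk.trans (le_abs_self _))
    have h2 : ((π i : ℕ) : ℝ) < (π k : ℕ) := by linarith
    have h3 : π i < π k := by exact_mod_cast h2
    have hki : k ≠ i := by rintro rfl; exact lt_irrefl _ h3
    rcases hG' with ⟨h0, -⟩ | ⟨v, hv, hDv, hne, h0⟩
    · exact absurd ((hcross k u (h0 k hki h1)).2 hui) (not_lt.2 h3.le)
    · exact (h0 k).2 (hlab k v (hright k h1 h3) (hright v hDv (hrv v hv hDv hne)))
  · have h1 := hleft u hDu hui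
    refine (hG l).2 (h.label_eq hl l u ?_ h1)
    have : (0 : ℝ) ≤ (π u : ℕ) := Nat.cast_nonneg _
    rw [hl0]; push_cast; linarith
  · rcases hG' with ⟨-, h0⟩ | ⟨v, hv, hDv, hne, h0⟩
    · simp [h0] at hk
    · have h1 := hright v hDv (hrv v hv hDv hne)
      refine (h0 l).2 (hlab l v ?_ h1)
      have h2 : (π v : ℕ) ≤ (π l : ℕ) := by have := (π v).2; omega
      have h3 : ((π v : ℕ) : ℝ) ≤ (π l : ℕ) := by exact_mod_cast h2
      linarith

/-- The bisection of `i` consists of its two sides, in either order. -/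
theorem Resolves.bisection_isSides (h : Resolves π D δ₁ δ₂ δ₃ ρ₂ ρ₃) (i : Fin n) :
    (IsSides π ρ₃ i (bisection D δ₁ δ₂ δ₃ i).val.G (bisection D δ₁ δ₂ δ₃ i).val.G' ∨
      IsSides π ρ₃ i (bisection D δ₁ δ₂ δ₃ i).val.G' (bisection D δ₁ δ₂ δ₃ i).val.G) ∧
    (bisection D δ₁ δ₂ δ₃ i).val.card =
      (Finset.univ.filter fun k => (bisection D δ₁ δ₂ δ₃ i).val.G k = true).card ∧
    (bisection D δ₁ δ₂ δ₃ i).val.card' =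
      (Finset.univ.filter fun k => (bisection D δ₁ δ₂ δ₃ i).val.G' k = true).card ∧
    ∃ k, (bisection D δ₁ δ₂ δ₃ i).val.G k = true := by
  obtain ⟨label, hl, hP, hspec⟩ := bisection_spec D δ₁ δ₂ δ₃ i
  rcases hspec with hnone | ⟨u, hu, hDu, hG, hcard, hG'⟩
  · obtain ⟨k, hk⟩ := h.exists_far i
    have h1 : ρ₃ ≤ |((π i : ℕ) : ℝ) - (π k : ℕ)| := by
      rcases hk with hk | hk
      · exact hk.trans (le_abs_self _)
      · rw [abs_sub_comm]; exact hk.trans (le_abs_self _)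
    have hki : k ≠ i := by
      rintro rfl
      have := h.one_le'
      simp at h1; linarith
    exact absurd (h.far₃ i k h1) (not_le.2 (hnone k hki))
  · refine ⟨?_, ?_, ?_, u, (hG u).2 rfl⟩
    · have hG'' : ((∀ v, v ≠ i → δ₃ ≤ D i v → label v = label u) ∧
          ∀ k, (bisection D δ₁ δ₂ δ₃ i).val.G' k = false) ∨
          ∃ v, v ≠ i ∧ δ₃ ≤ D i v ∧ label v ≠ label u ∧
            ∀ k, (bisection D δ₁ δ₂ δ₃ i).val.G' k = true ↔ label k = label v := by
        rcases hG' with ⟨h1, h2, -⟩ | ⟨v, h1, h2, h3, h4, -⟩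
        · exact Or.inl ⟨h1, h2⟩
        · exact Or.inr ⟨v, h1, h2, h3, h4⟩
      rcases lt_or_gt_of_ne (fun h => hu (π.injective h) : π u ≠ π i) with h1 | h1
      · exact Or.inl (h.isSides_of_left hl hP hDu h1 hG hG'')
      · exact Or.inr (h.reversed.isSides_of_left hl hP hDu (reversed_lt.2 h1) hG
          hG'').of_reversed
    · rw [hcard]; congr 1; ext k; simp [hG]
    · rcases hG' with ⟨-, h2, h3⟩ | ⟨v, -, -, -, h4, h5⟩
      · rw [h3]; simp [h2]
      · rw [h5]; congr 1; ext k; simp [h4]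

theorem card_filter_pos_lt (π : Equiv.Perm (Fin n)) {m : ℕ} (hm : m ≤ n) :
    (Finset.univ.filter fun k => (π k : ℕ) < m).card = m := by
  have h1 : (Finset.univ.filter fun k => (π k : ℕ) < m) =
      (Finset.univ.filter fun k : Fin n => (k : ℕ) < m).map π.symm.toEmbedding := by
    ext k
    simp only [Finset.mem_filter, Finset.mem_univ, true_and, Finset.mem_map_equiv, Equiv.symm_symm]
  rw [h1, Finset.card_map, Fin.card_filter_val_lt, min_eq_right hm]

theorem IsSides.card_left_le {ρ : ℝ} {i : Fin n} {L R : Fin n → Bool} (h : IsSides π ρ i L R) :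
    (Finset.univ.filter fun k => L k = true).card ≤ (π i : ℕ) := by
  rw [← card_filter_pos_lt π (π i).2.le]
  exact Finset.card_le_card fun k hk => by
    simpa using h.left k (by simpa using hk)

theorem IsSides.le_card_left {ρ : ℝ} {i : Fin n} {L R : Fin n → Bool} (h : IsSides π ρ i L R)
    {m : ℕ} (hm : m ≤ n) (hmi : (m : ℝ) + ρ ≤ (π i : ℕ) + 1) :
    m ≤ (Finset.univ.filter fun k => L k = true).card := by
  rw [← card_filter_pos_lt π hm]
  refine Finset.card_le_card fun k hk => ?_
  simp only [Finset.mem_filter, Finset.mem_univ, true_and] at hk ⊢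
  have h1 : ((π k : ℕ) : ℝ) + 1 ≤ m := by exact_mod_cast hk
  exact h.farLeft k (by linarith)

/-- An index with two large sides is central. -/
theorem IsSides.central {ρ : ℝ} {c : Fin n} {L R : Fin n → Bool} {m : ℕ} (h : IsSides π ρ c L R)
    (hL : m ≤ (Finset.univ.filter fun k => L k = true).card)
    (hR : m ≤ (Finset.univ.filter fun k => R k = true).card) :
    m ≤ (π c : ℕ) ∧ (π c : ℕ) + m + 1 ≤ n := by
  have h1 := hL.trans h.card_left_le
  have h2 := hR.trans h.reversed.card_left_le
  rw [reversed_val] at h2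
  have := (π c).2
  omega

/-- Two nonempty left sides have the first index in common. -/
theorem IsSides.exists_common_left {ρ : ℝ} {i j : Fin n} {L R L' R' : Fin n → Bool}
    (h : IsSides π ρ i L R) (h' : IsSides π ρ j L' R') (hL : ∃ k, L k = true)
    (hL' : ∃ k, L' k = true) : ∃ k, L k = true ∧ L' k = true := by
  obtain ⟨k, hk⟩ := hL
  obtain ⟨k', hk'⟩ := hL'
  have h0 : ((π (π.symm ⟨0, i.pos⟩) : Fin n) : ℕ) = 0 := by simp
  exact ⟨π.symm ⟨0, i.pos⟩, h.first k _ hk h0, h'.first k' _ hk' h0⟩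

/-- The rule of `orientation` orients the bisection of `i` as that of a central index `c`. -/
theorem IsSides.oriented {ρ : ℝ} {i c : Fin n} {G G' L R : Fin n → Bool} (hc : IsSides π ρ c L R)
    (hG : IsSides π ρ i G G' ∨ IsSides π ρ i G' G) (hGne : ∃ k, G k = true)
    (hc1 : 2 * ρ ≤ (π c : ℕ)) (hc2 : ((π c : ℕ) : ℝ) + 2 * ρ + 1 ≤ n) (hρ : 1 ≤ ρ)
    {flip : Bool}
    (hflip₀ : (∀ k, G' k = false) → (flip = true ↔ L i = true))
    (hflip₁ : (∃ k, G' k = true) →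
      (flip = true ↔ (∀ k, ¬ (G k = true ∧ L k = true)) ∨ ∀ k, ¬ (G' k = true ∧ R k = true))) :
    IsSides π ρ i (fun k => if flip = true then G' k else G k)
      (fun k => if flip = true then G k else G' k) := by
  have hn0 := i.pos
  have hfirst : ((π (π.symm ⟨0, hn0⟩) : Fin n) : ℕ) = 0 := by simp
  have hlast : ((π (π.symm ⟨n - 1, by omega⟩) : Fin n) : ℕ) = n - 1 := by simp
  have hlast' : (((π (π.symm ⟨n - 1, by omega⟩) : Fin n) : ℕ) : ℝ) = n - 1 := by
    rw [hlast, Nat.cast_sub hn0]; simp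
  have hLne : ∃ k, L k = true := ⟨_, hc.farLeft (π.symm ⟨0, hn0⟩) (by rw [hfirst]; push_cast; linarith)⟩
  have hRne : ∃ k, R k = true :=
    ⟨_, hc.farRight (π.symm ⟨n - 1, by omega⟩) (by rw [hlast']; linarith)⟩
  by_cases hG' : ∃ k, G' k = true
  · rcases hG with hG | hG
    -- if both sides of `i` are nonempty, then equally oriented ones meet, and if the orientations
    -- differ, then one of the two pairs of sides is separated by `i` and `c`
    · obtain ⟨k, hk⟩ := hG.exists_common_left hc hGne hLne
      obtain ⟨k', hk'⟩ := hG.reversed.exists_common_left hc.reversed hG' hRne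
      have hf : flip = false := by
        by_contra hf
        rcases (hflip₁ hG').1 (by simpa using hf) with h | h
        · exact h k hk
        · exact h k' hk'
      simpa [hf] using hG
    · have hf : flip = true := by
        refine (hflip₁ hG').2 ?_
        rcases le_or_gt (π c) (π i) with h | h
        · exact Or.inl fun k hk => absurd ((hG.right k hk.1).trans (hc.left k hk.2)) (not_lt.2 h)
        · exact Or.inr fun k hk =>
            absurd ((hc.right k hk.2).trans (hG.left k hk.1)) (not_lt.2 h.le)
      simpa [hf] using hG
  -- if a side of `i` is empty, then `i` is near an end, hence on the side of `c` with that end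
  · have h0 : ∀ k, G' k = false := fun k => by
      by_contra h; exact hG' ⟨k, by simpa using h⟩
    rcases hG with hG | hG
    · have hf : flip = false := by
        by_contra hf
        have h1 := hc.left i ((hflip₀ h0).1 (by simpa using hf))
        have h2 : ((π i : ℕ) : ℝ) < (π c : ℕ) := by exact_mod_cast h1
        exact hG' ⟨_, hG.farRight (π.symm ⟨n - 1, by omega⟩) (by rw [hlast']; linarith)⟩
      simpa [hf] using hG
    · have hf : flip = true := by
        refine (hflip₀ h0).2 (hc.farLeft i ?_)
        by_contra h
        exact hG' ⟨_, hG.farLeft (π.symm ⟨0, hn0⟩) (by rw [hfirst]; push_cast; linarith)⟩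
      simpa [hf] using hG

/-- The sets computed by `orientation`: they follow the latent order or its reversal, whichever
agrees with the bisection of the central index. -/
theorem orientation_isSides {ρ : ℝ} {B : Fin n → Bisection n} (hn : 8 * ρ + 8 ≤ n) (hρ : 1 ≤ ρ)
    (hB : ∀ i, (IsSides π ρ i (B i).G (B i).G' ∨ IsSides π ρ i (B i).G' (B i).G) ∧
      (B i).card = (Finset.univ.filter fun k => (B i).G k = true).card ∧
      (B i).card' = (Finset.univ.filter fun k => (B i).G' k = true).card ∧
      ∃ k, (B i).G k = true) :
    (∀ i, IsSides π ρ i ((orientation B).val.1 i) ((orientation B).val.2 i)) ∨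
      ∀ i, IsSides (reversed π) ρ i ((orientation B).val.1 i) ((orientation B).val.2 i) := by
  have hn1 : (1 : ℝ) ≤ n := by linarith
  have hn0 : 0 < n := by exact_mod_cast hn1
  -- the index in the middle has at least `m` elements on both sides, so the best index `c` has, too
  set m := ⌈2 * ρ⌉₊ with hm
  have hm1 : 2 * ρ ≤ m := Nat.le_ceil _
  have hm2 : (m : ℝ) < 2 * ρ + 1 := Nat.ceil_lt_add_one (by linarith)
  have hmn : m ≤ n := by
    have : (m : ℝ) ≤ n := by linarith
    exact_mod_cast this
  have hmid : ∀ i, (π i : ℕ) = n / 2 → m ≤ min (B i).card (B i).card' := by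
    intro i hi
    have h1 : (n : ℝ) ≤ 2 * (π i : ℕ) + 1 := by
      have : n ≤ 2 * (π i : ℕ) + 1 := by omega
      exact_mod_cast this
    have h2 : 2 * ((π i : ℕ) : ℝ) ≤ n := by
      have : 2 * (π i : ℕ) ≤ n := by omega
      exact_mod_cast this
    obtain ⟨h3, h4, h5, -⟩ := hB i
    rw [h4, h5, le_min_iff]
    have hr : (((reversed π i : Fin n) : ℕ) : ℝ) = n - 1 - (π i : ℕ) := reversed_coe π i
    rcases h3 with h3 | h3
    · exact ⟨h3.le_card_left hmn (by linarith), h3.reversed.le_card_left hmn (by linarith)⟩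
    · exact ⟨h3.reversed.le_card_left hmn (by linarith), h3.le_card_left hmn (by linarith)⟩
  let key : Fin n → Timed (Option ℕ) := fun i => do
    let b ← read B i
    scalar (some (min b.card b.card'))
  have hkey : ∀ i, (key i).val = some (min (B i).card (B i).card') := fun i => rfl
  let flip : Fin n → Fin n → Bool := fun c i => if i = c then false else
    if (B i).card' = 0 then (B c).G i else
      (!(decide (∃ k, ((B i).G k && (B c).G k) = true)) ||
        !(decide (∃ k, ((B i).G' k && (B c).G' k) = true)))
  rcases pickBest_gt_spec key with ⟨-, h⟩ | ⟨c, x, hbest, hcx, hmax⟩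
  · have := h ⟨0, hn0⟩
    rw [hkey] at this; cases this
  have hval : (orientation B).val = (fun i k => if flip c i = true then (B i).G' k else (B i).G k,
      fun i k => if flip c i = true then (B i).G k else (B i).G' k) := by
    have : (pickBest (fun x y : ℕ => y < x) key).val = some (c, x) := hbest
    unfold orientation
    rw [val_bind]
    change (match (pickBest (fun x y : ℕ => y < x) key).val with
      | none => _
      | some (c, _) => _ : Timed _).val = _
    rw [this]
    rfl
  have hx : m ≤ min (B c).card (B c).card' := by
    rw [hkey] at hcx
    cases hcx
    have hlt : n / 2 < n := Nat.div_lt_self hn0 one_lt_two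
    exact (hmid (π.symm ⟨n / 2, hlt⟩) (by simp)).trans (hmax _ _ (hkey _))
  have key2 : ∀ π' : Equiv.Perm (Fin n),
      (∀ i, IsSides π' ρ i (B i).G (B i).G' ∨ IsSides π' ρ i (B i).G' (B i).G) →
      IsSides π' ρ c (B c).G (B c).G' →
      ∀ i, IsSides π' ρ i ((orientation B).val.1 i) ((orientation B).val.2 i) := by
    intro π' hB' hc i
    rw [hval]
    obtain ⟨hc1, hc2⟩ := hc.central (hx.trans (min_le_left _ _) |>.trans_eq (hB c).2.1)
      (hx.trans (min_le_right _ _) |>.trans_eq (hB c).2.2.1)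
    have hc1' : (m : ℝ) ≤ (π' c : ℕ) := by exact_mod_cast hc1
    have hc2' : ((π' c : ℕ) : ℝ) + m + 1 ≤ n := by exact_mod_cast hc2
    by_cases hic : i = c
    · subst hic
      simpa [flip] using hc
    · have hcard0 : (B i).card' = 0 ↔ ∀ k, (B i).G' k = false := by
        rw [(hB i).2.2.1, Finset.card_eq_zero, Finset.filter_eq_empty_iff]
        simp
      refine hc.oriented (hB' i) (hB i).2.2.2 (by linarith) (by linarith) hρ (fun h => ?_)
        fun h => ?_
      · simp [flip, hic, hcard0.2 h]
      · have h0 : (B i).card' ≠ 0 := by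
          rw [Ne, hcard0]
          rintro h'
          obtain ⟨k, hk⟩ := h
          simp [h'] at hk
        simp [flip, hic, h0]
  rcases (hB c).1 with hc | hc
  · exact Or.inl (key2 π (fun i => (hB i).1) hc)
  · exact Or.inr (key2 (reversed π) (fun i => (hB i).1.symm.imp (·.reversed) (·.reversed))
      hc.reversed)

end Resolved

/-- `H` is a partial comparison matrix for the latent order `π`, complete at distance at least
`ρ`: an entry is `0` or the correct comparison, and the latter at distance at least `ρ`. -/
structure IsPartialComparison (π : Equiv.Perm (Fin n)) (ρ : ℝ) (H : Mat n ℤ) : Prop where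
  diag : ∀ i, H i i = 0
  correct : ∀ i j, i ≠ j → H i j ≠ 0 → H i j = if π i < π j then -1 else 1
  complete : ∀ i j, ρ ≤ |((π i : ℕ) : ℝ) - (π j : ℕ)| → H i j ≠ 0
  symm : ∀ i j, H i j = 0 → H j i = 0

theorem Resolves.aggregateBisections {π : Equiv.Perm (Fin n)} {D : Mat n ℝ}
    {δ₁ δ₂ δ₃ ρ₂ ρ₃ : ℝ} (h : Resolves π D δ₁ δ₂ δ₃ ρ₂ ρ₃) :
    ∃ π', (π' = π ∨ π' = Seriation.reversed π) ∧
      IsPartialComparison π' ρ₃ (aggregateBisections D δ₁ δ₂ δ₃).val := by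
  let B : Fin n → Bisection n := fun i => (bisection D δ₁ δ₂ δ₃ i).val
  let LR := (orientation B).val
  have hval : ∀ i j, (Seriation.aggregateBisections D δ₁ δ₂ δ₃).val i j =
      if i ≠ j ∧ decide (∃ k, (LR.1 i k || LR.2 i k) = true) = true then
        if LR.1 j i = true ∨ LR.2 i j = true then -1
          else if LR.2 j i = true ∨ LR.1 i j = true then 1 else 0
      else 0 := fun i j => rfl
  have key : ∀ π', Resolves π' D δ₁ δ₂ δ₃ ρ₂ ρ₃ →
      (∀ i, IsSides π' ρ₃ i (LR.1 i) (LR.2 i)) →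
      IsPartialComparison π' ρ₃ (Seriation.aggregateBisections D δ₁ δ₂ δ₃).val := by
    intro π' hπ' hs
    have hρ := h.one_le'
    have hne : ∀ i, ∃ k, (LR.1 i k || LR.2 i k) = true := fun i => by
      obtain ⟨k, hk | hk⟩ := hπ'.exists_far i
      · exact ⟨k, by simp [(hs i).farLeft k hk]⟩
      · exact ⟨k, by simp [(hs i).farRight k hk]⟩
    refine ⟨fun i => by rw [hval]; simp, fun i j hij h0 => ?_, fun i j hij => ?_,
      fun i j h0 => ?_⟩
    · rw [hval, if_pos ⟨hij, by simpa using hne i⟩] at h0 ⊢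
      split_ifs at h0 ⊢ with h1 h2 h3 h4 h5
      · rfl
      · rcases h1 with h1 | h1
        · exact absurd ((hs j).left i h1) h2
        · exact absurd ((hs i).right j h1) h2
      · rcases h3 with h3 | h3
        · exact absurd ((hs j).right i h3) (not_lt.2 h4.le)
        · exact absurd ((hs i).left j h3) (not_lt.2 h4.le)
      · rfl
      · exact absurd rfl h0
      · exact absurd rfl h0
    · have hij' : i ≠ j := by
        rintro rfl
        simp at hij; linarith
      rw [hval, if_pos ⟨hij', by simpa using hne i⟩]
      have h1 : LR.1 i j = true ∨ LR.2 i j = true := by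
        rcases le_abs.1 hij with h1 | h1
        · exact Or.inl ((hs i).farLeft j h1)
        · exact Or.inr ((hs i).farRight j (by linarith))
      split_ifs with h2 h3 <;> simp_all
    · by_cases hij : i = j
      · subst hij; exact h0
      · rw [hval, if_pos ⟨hij, by simpa using hne i⟩] at h0
        rw [hval, if_pos ⟨Ne.symm hij, by simpa using hne j⟩]
        split_ifs at h0 with h1 h2
        · exact absurd h0 one_ne_zero
        · rw [not_or] at h1 h2
          simp [h1.1, h1.2, h2.1, h2.2]
  rcases orientation_isSides h.large h.one_le' (fun i => h.bisection_isSides i) with h1 | h1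
  · exact ⟨π, Or.inl rfl, key π h h1⟩
  · exact ⟨_, Or.inr rfl, key _ h.reversed h1⟩

/-! ### The distance estimate -/

/-- The matrix `A` with all entries outside `S × S` replaced by `0`. -/
def masked (A : Mat n ℝ) (S : Fin n → Bool) : Mat n ℝ :=
  fun i j => if S i = true ∧ S j = true then A i j else 0

/-- The inner products of the rows of `masked A S`. -/
def gram (A : Mat n ℝ) (S : Fin n → Bool) : Mat n ℝ :=
  fun i j => ∑ k, masked A S i k * masked A S j k

/-- The quantity minimized over `j` in the choice of the approximate nearest neighbour of `i`. -/
noncomputable def neighborScore (A : Mat n ℝ) (S : Fin n → Bool) (i j : Fin n) : ℝ :=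
  Finset.univ.fold max 0 fun k =>
    if S k = true ∧ k ≠ i ∧ k ≠ j then |gram A S k i - gram A S k j| else 0

theorem neighborScore_le {A : Mat n ℝ} {S : Fin n → Bool} {i j : Fin n} {b : ℝ} (hb : 0 ≤ b)
    (h : ∀ k, S k = true → k ≠ i → k ≠ j → |gram A S k i - gram A S k j| ≤ b) :
    neighborScore A S i j ≤ b := by
  refine (Finset.fold_max_le _).2 ⟨hb, fun k _ => ?_⟩
  split_ifs with hk
  · exact h k hk.1 hk.2.1 hk.2.2
  · exact hb

theorem le_neighborScore {A : Mat n ℝ} {S : Fin n → Bool} {i j k : Fin n} (hk : S k = true)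
    (hki : k ≠ i) (hkj : k ≠ j) : |gram A S k i - gram A S k j| ≤ neighborScore A S i j :=
  (Finset.le_fold_max _).2 (Or.inr ⟨k, Finset.mem_univ _, by rw [if_pos ⟨hk, hki, hkj⟩]⟩)

/-- The distance estimate in terms of the approximate nearest neighbours `m i`, which are the first
minimizers of `neighborScore`. -/
theorem estimateDistance_spec (A : Mat n ℝ) (S : Fin n → Bool) :
    ∃ m : Fin n → Fin n,
      (∀ i j, S i = true → S j = true → i ≠ j → (estimateDistance A S).val i j =
        Real.sqrt (n * (gram A S i (m i) + gram A S j (m j) - 2 * gram A S i j))) ∧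
      (∀ i j, ¬ (S i = true ∧ S j = true ∧ i ≠ j) → (estimateDistance A S).val i j = 0) ∧
      ∀ i, S i = true → (∃ j, S j = true ∧ j ≠ i) → S (m i) = true ∧ m i ≠ i ∧
        (∀ j, S j = true → j ≠ i → neighborScore A S i (m i) ≤ neighborScore A S i j) ∧
        ∀ j, S j = true → j ≠ i → j < m i → neighborScore A S i (m i) < neighborScore A S i j := by
  let key : Fin n → Fin n → Timed (Option ℝ) := fun i j => do
    let sj ← read S j
    branch (sj = true ∧ j ≠ i)
      (do
        let score ← maximum fun k => do
          let sk ← read S k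
          branch (sk = true ∧ k ≠ i ∧ k ≠ j)
            (do
              let x ← read₂ (gram A S) k i
              let y ← read₂ (gram A S) k j
              scalar |x - y|)
            (pure 0)
        pure (some score))
      (pure none)
  have hkey : ∀ i j, (key i j).val =
      if S j = true ∧ j ≠ i then some (neighborScore A S i j) else none := fun i j => rfl
  let m : Fin n → Fin n := fun i => if S i = true then
    (match (pickBest (fun x y : ℝ => x < y) (key i)).val with
      | some (j, _) => (pure j : Timed (Fin n))
      | none => pure i).val
    else i
  have hval : ∀ i j, (estimateDistance A S).val i j =
      if S i = true ∧ S j = true ∧ i ≠ j then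
        Real.sqrt (n * (gram A S i (m i) + gram A S j (m j) - 2 * gram A S i j)) else 0 :=
    fun i j => rfl
  refine ⟨m, fun i j hi hj hij => by rw [hval, if_pos ⟨hi, hj, hij⟩],
    fun i j h => by rw [hval, if_neg h], fun i hi hex => ?_⟩
  rcases pickBest_lt_spec (key i) with ⟨-, h⟩ | ⟨j, x, hbest, hjx, hmin, hfirst⟩
  · obtain ⟨j, hj⟩ := hex
    have := h j
    rw [hkey, if_pos hj] at this
    cases this
  · rw [hkey] at hjx
    split_ifs at hjx with hj
    cases hjx
    have hm : m i = j := by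
      simp only [m, hi, if_true, hbest]
      rfl
    rw [hm]
    exact ⟨hj.1, hj.2, fun k hk hki => hmin k _ (by rw [hkey, if_pos ⟨hk, hki⟩]),
      fun k hk hki hlt => hfirst k _ hlt (by rw [hkey, if_pos ⟨hk, hki⟩])⟩

theorem masked_congr {A A' : Mat n ℝ} {S : Fin n → Bool}
    (h : ∀ i j, S i = true → S j = true → A i j = A' i j) : masked A S = masked A' S := by
  funext i j
  unfold masked
  split_ifs with hij
  · exact h i j hij.1 hij.2
  · rfl

/-- The distance estimate on `S` depends only on the entries of the matrix in `S × S`. -/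
theorem estimateDistance_congr {A A' : Mat n ℝ} {S : Fin n → Bool}
    (h : ∀ i j, S i = true → S j = true → A i j = A' i j) :
    (estimateDistance A S).val = (estimateDistance A' S).val := by
  have h1 := masked_congr h
  have h2 : gram A S = gram A' S := by unfold gram; rw [h1]
  have h3 : neighborScore A S = neighborScore A' S := by unfold neighborScore; rw [h2]
  obtain ⟨m, hm1, hm2, hm3⟩ := estimateDistance_spec A S
  obtain ⟨m', hm1', hm2', hm3'⟩ := estimateDistance_spec A' S
  rw [h2] at hm1
  rw [h3] at hm3
  have hmm : ∀ i, S i = true → (∃ j, S j = true ∧ j ≠ i) → m i = m' i := by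
    intro i hi hex
    obtain ⟨a1, a2, a3, a4⟩ := hm3 i hi hex
    obtain ⟨b1, b2, b3, b4⟩ := hm3' i hi hex
    rcases lt_trichotomy (m i) (m' i) with h | h | h
    · exact absurd (a3 _ b1 b2) (not_le.2 (b4 _ a1 a2 h))
    · exact h
    · exact absurd (b3 _ a1 a2) (not_le.2 (a4 _ b1 b2 h))
  funext i j
  by_cases hij : S i = true ∧ S j = true ∧ i ≠ j
  · rw [hm1 i j hij.1 hij.2.1 hij.2.2, hm1' i j hij.1 hij.2.1 hij.2.2,
      hmm i hij.1 ⟨j, hij.2.1, hij.2.2.symm⟩, hmm j hij.2.1 ⟨i, hij.1, hij.2.2⟩]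
  · rw [hm2 i j hij, hm2' i j hij]

theorem measurable_gram (S : Fin n → Bool) (i j : Fin n) :
    Measurable fun A : Mat n ℝ => gram A S i j := by
  unfold gram masked
  refine Finset.measurable_sum _ fun k _ => ?_
  refine Measurable.mul ?_ ?_ <;> split_ifs <;> fun_prop

theorem measurable_neighborScore (S : Fin n → Bool) (i j : Fin n) :
    Measurable fun A : Mat n ℝ => neighborScore A S i j := by
  have key : ∀ s : Finset (Fin n), Measurable fun A : Mat n ℝ => s.fold max 0 fun k =>
      if S k = true ∧ k ≠ i ∧ k ≠ j then |gram A S k i - gram A S k j| else 0 := by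
    intro s
    induction s using Finset.induction_on with
    | empty => simp
    | insert k s hk ih =>
      simp only [Finset.fold_insert hk]
      refine Measurable.max ?_ ih
      split_ifs
      · exact ((measurable_gram S k i).sub (measurable_gram S k j)).abs
      · exact measurable_const
  exact key _

theorem measurable_estimateDistance (S : Fin n → Bool) (i j : Fin n) :
    Measurable fun A : Mat n ℝ => (estimateDistance A S).val i j := by
  classical
  by_cases hij : S i = true ∧ S j = true ∧ i ≠ j
  swap
  · have h0 : (fun A : Mat n ℝ => (estimateDistance A S).val i j) = fun _ => 0 := by
      funext A
      obtain ⟨m, -, hm, -⟩ := estimateDistance_spec A S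
      exact hm i j hij
    rw [h0]; exact measurable_const
  · -- `N i j` is the event that `j` is the approximate nearest neighbour of `i`; summing over all
    -- possible neighbours expresses the estimate by measurable functions
    let N : Fin n → Fin n → Mat n ℝ → Prop := fun i j A => S j = true ∧ j ≠ i ∧
      (∀ k, S k = true → k ≠ i → neighborScore A S i j ≤ neighborScore A S i k) ∧
      ∀ k, S k = true → k ≠ i → k < j → neighborScore A S i j < neighborScore A S i k
    have hN : ∀ i j, MeasurableSet {A | N i j A} := by
      intro i j
      refine (MeasurableSet.const (S j = true)).inter ((MeasurableSet.const (j ≠ i)).inter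
        (MeasurableSet.inter (s₁ := {A | ∀ k, S k = true → k ≠ i →
          neighborScore A S i j ≤ neighborScore A S i k}) (s₂ := {A | ∀ k, S k = true → k ≠ i →
          k < j → neighborScore A S i j < neighborScore A S i k}) ?_ ?_)) <;>
        simp only [Set.ofPred_forall]
      · exact MeasurableSet.iInter fun k => MeasurableSet.iInter fun _ => MeasurableSet.iInter
          fun _ => measurableSet_le (measurable_neighborScore S i j) (measurable_neighborScore S i k)
      · exact MeasurableSet.iInter fun k => MeasurableSet.iInter fun _ => MeasurableSet.iInter
          fun _ => MeasurableSet.iInter fun _ =>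
            measurableSet_lt (measurable_neighborScore S i j) (measurable_neighborScore S i k)
    have huniq : ∀ i a b A, N i a A → N i b A → a = b := by
      rintro i a b A ⟨a1, a2, a3, a4⟩ ⟨b1, b2, b3, b4⟩
      rcases lt_trichotomy a b with h | h | h
      · exact absurd (a3 _ b1 b2) (not_le.2 (b4 _ a1 a2 h))
      · exact h
      · exact absurd (b3 _ a1 a2) (not_le.2 (a4 _ b1 b2 h))
    have heq : (fun A : Mat n ℝ => (estimateDistance A S).val i j) = fun A =>
        Real.sqrt (n * ((∑ a, if N i a A then gram A S i a else 0) +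
          (∑ b, if N j b A then gram A S j b else 0) - 2 * gram A S i j)) := by
      funext A
      obtain ⟨m, hm, -, hm'⟩ := estimateDistance_spec A S
      have hi : N i (m i) A := hm' i hij.1 ⟨j, hij.2.1, hij.2.2.symm⟩
      have hj : N j (m j) A := hm' j hij.2.1 ⟨i, hij.1, hij.2.2⟩
      rw [hm i j hij.1 hij.2.1 hij.2.2,
        Finset.sum_eq_single (m i) (fun a _ ha => if_neg fun h => ha (huniq i a _ A h hi))
          (fun h => absurd (Finset.mem_univ _) h),
        Finset.sum_eq_single (m j) (fun a _ ha => if_neg fun h => ha (huniq j a _ A h hj))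
          (fun h => absurd (Finset.mem_univ _) h), if_pos hi, if_pos hj]
    rw [heq]
    refine (measurable_const.mul (((Finset.measurable_sum _ fun a _ => ?_).add
      (Finset.measurable_sum _ fun a _ => ?_)).sub
        (measurable_const.mul (measurable_gram S i j)))).sqrt
    · exact Measurable.ite (hN i a) (measurable_gram S i a) measurable_const
    · exact Measurable.ite (hN j a) (measurable_gram S j a) measurable_const

/-- This holds for all real numbers, the square root of a negative number being `0`. -/
theorem abs_sqrt_sub_sqrt_le {x y c : ℝ} (h : |x - y| ≤ c) :
    |Real.sqrt x - Real.sqrt y| ≤ Real.sqrt c := by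
  have hc : 0 ≤ c := (abs_nonneg _).trans h
  obtain ⟨h1, h2⟩ := abs_le.1 h
  have hsub : ∀ a b : ℝ, 0 ≤ b → Real.sqrt (a + b) ≤ Real.sqrt a + Real.sqrt b := by
    intro a b hb
    rcases le_total 0 a with ha | ha
    · refine Real.sqrt_le_iff.2 ⟨by positivity, ?_⟩
      nlinarith [Real.sq_sqrt ha, Real.sq_sqrt hb,
        mul_nonneg (Real.sqrt_nonneg a) (Real.sqrt_nonneg b)]
    · rw [Real.sqrt_eq_zero_of_nonpos ha, zero_add]
      exact Real.sqrt_le_sqrt (by linarith)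
  rw [abs_le]
  constructor
  · have := (Real.sqrt_le_sqrt (by linarith : y ≤ x + c)).trans (hsub x c hc)
    linarith
  · have := (Real.sqrt_le_sqrt (by linarith : x ≤ y + c)).trans (hsub y c hc)
    linarith

/-- The latent dissimilarity of `i` and `j`: `√n` times the distance of the rows of `masked M S`. -/
noncomputable def latentDistance (M : Mat n ℝ) (S : Fin n → Bool) (i j : Fin n) : ℝ :=
  Real.sqrt (n * ∑ l, (masked M S i l - masked M S j l) ^ 2)

theorem sum_masked_sub_sq (M : Mat n ℝ) (S : Fin n → Bool) (i j : Fin n) :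
    ∑ l, (masked M S i l - masked M S j l) ^ 2 = gram M S i i + gram M S j j - 2 * gram M S i j := by
  simp only [gram, Finset.mul_sum, ← Finset.sum_add_distrib, ← Finset.sum_sub_distrib]
  exact Finset.sum_congr rfl fun l _ => by ring

theorem gram_comm (M : Mat n ℝ) (S : Fin n → Bool) (i j : Fin n) : gram M S i j = gram M S j i :=
  Finset.sum_congr rfl fun _ _ => mul_comm _ _

/-- If the inner products of distinct rows are known up to `η`, and every row has two neighbours
that are close to it as tested against vectors with entries in `[-1, 1]`, then the distance estimate
is accurate. Of the two neighbours, one differs from the estimated neighbour `m i`; testing with it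
shows that `⟨M i, M (m i)⟩` is close to `‖M i‖²`, an inner product that is not observed. -/
theorem estimateDistance_accurate {A M : Mat n ℝ} {S : Fin n → Bool} {η η₀ : ℝ}
    (hη : 0 ≤ η) (hη₀ : 0 ≤ η₀)
    (hM : ∀ i j, M i j ∈ Set.Icc (0 : ℝ) 1)
    (hG : ∀ i j, S i = true → S j = true → i ≠ j → |gram A S i j - gram M S i j| ≤ η)
    (hnbr : ∀ i, S i = true → ∃ k₁ k₂, k₁ ≠ k₂ ∧ ∀ k, k = k₁ ∨ k = k₂ → S k = true ∧ k ≠ i ∧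
      ∀ v : Fin n → ℝ, (∀ l, |v l| ≤ 1) → |∑ l, v l * (masked M S i l - masked M S k l)| ≤ η₀)
    {i j : Fin n} (hi : S i = true) (hj : S j = true) (hij : i ≠ j) :
    |(estimateDistance A S).val i j - latentDistance M S i j| ≤
      Real.sqrt (n * (12 * η + 4 * η₀)) := by
  obtain ⟨m, hm1, -, hm3⟩ := estimateDistance_spec A S
  have hmask : ∀ a b, 0 ≤ masked M S a b ∧ masked M S a b ≤ 1 := by
    intro a b
    unfold masked
    split_ifs
    · exact hM a b
    · simp
  have hdot : ∀ a b c, gram M S a b - gram M S a c =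
      ∑ l, masked M S a l * (masked M S b l - masked M S c l) := by
    intro a b c
    simp only [gram, ← Finset.sum_sub_distrib]
    exact Finset.sum_congr rfl fun l _ => by ring
  have key : ∀ i, S i = true → |gram A S i (m i) - gram M S i i| ≤ 5 * η + 2 * η₀ := by
    intro i hi
    obtain ⟨k₁, k₂, hk, hnb⟩ := hnbr i hi
    obtain ⟨h1, h2, h3, -⟩ := hm3 i hi ⟨k₁, (hnb k₁ (Or.inl rfl)).1, (hnb k₁ (Or.inl rfl)).2.1⟩
    have hscore : neighborScore A S i (m i) ≤ 2 * η + η₀ := by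
      obtain ⟨a1, a2, a3⟩ := hnb k₁ (Or.inl rfl)
      refine (h3 k₁ a1 a2).trans (neighborScore_le (by positivity) fun k hk hki hkk => ?_)
      have b1 := abs_le.1 (hG k i hk hi hki)
      have b2 := abs_le.1 (hG k k₁ hk a1 hkk)
      have b3 := a3 (masked M S k) fun l => by
        rw [abs_of_nonneg (hmask k l).1]; exact (hmask k l).2
      rw [← hdot] at b3
      have b3 := abs_le.1 b3
      rw [abs_le]; constructor <;> linarith
    -- a neighbour `k ≠ m i` of `i`, so that the score of `m i` controls its inner product with the
    -- difference of the rows `i` and `m i`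
    obtain ⟨k, hkm, hkS, hki, hkv⟩ : ∃ k, k ≠ m i ∧ S k = true ∧ k ≠ i ∧
        ∀ v : Fin n → ℝ, (∀ l, |v l| ≤ 1) →
          |∑ l, v l * (masked M S i l - masked M S k l)| ≤ η₀ := by
      by_cases h : k₁ = m i
      · exact ⟨k₂, fun h' => hk (h.trans h'.symm), hnb k₂ (Or.inr rfl)⟩
      · exact ⟨k₁, h, hnb k₁ (Or.inl rfl)⟩
    have c1 := abs_le.1 ((le_neighborScore hkS hki hkm).trans hscore)
    have c2 := abs_le.1 (hG k i hkS hi hki)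
    have c3 := abs_le.1 (hG k (m i) hkS h1 hkm)
    have c4 := abs_le.1 (hG i (m i) hi h1 h2.symm)
    have c5 := hkv (fun l => masked M S i l - masked M S (m i) l) fun l => by
      have := hmask i l; have := hmask (m i) l
      rw [abs_le]; constructor <;> linarith
    have c6 : ∑ l, (masked M S i l - masked M S (m i) l) * (masked M S i l - masked M S k l) =
        gram M S i i - gram M S i (m i) - (gram M S k i - gram M S k (m i)) := by
      simp only [gram, ← Finset.sum_sub_distrib]
      exact Finset.sum_congr rfl fun l _ => by ring
    rw [c6] at c5
    have c5 := abs_le.1 c5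
    rw [abs_le]; constructor <;> linarith
  have hi' := abs_le.1 (key i hi)
  have hj' := abs_le.1 (key j hj)
  have hij' := abs_le.1 (hG i j hi hj hij)
  rw [hm1 i j hi hj hij, latentDistance]
  refine abs_sqrt_sub_sqrt_le ?_
  rw [sum_masked_sub_sq, ← mul_sub, abs_mul, Nat.abs_cast]
  refine mul_le_mul_of_nonneg_left ?_ (Nat.cast_nonneg _)
  rw [abs_le]; constructor <;> linarith

/-! ### Geometry of average-Lipschitz Robinson matrices -/

/-- The signal `F_π`. -/
def signal (F : Mat n ℝ) (π : Equiv.Perm (Fin n)) : Mat n ℝ := fun i j => F (π i) (π j)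

theorem rowDist_comm (F : Mat n ℝ) (i j : Fin n) : rowDist F i j = rowDist F j i := by
  unfold rowDist
  congr 1
  exact Finset.sum_congr rfl fun k _ => by ring

theorem sum_abs_sub_le (F : Mat n ℝ) (i j : Fin n) :
    ∑ k, |F i k - F j k| ≤ Real.sqrt n * rowDist F i j := by
  rw [rowDist, ← Real.sqrt_mul (Nat.cast_nonneg n)]
  refine Real.le_sqrt_of_sq_le ?_
  have := sq_sum_le_card_mul_sum_sq (s := (Finset.univ : Finset (Fin n)))
    (f := fun k => |F i k - F j k|)
  simpa using this

/-- Up to constants, `√n` times the distance of two rows is the distance of their indices. For indices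
at distance at most `r n` this is the average-Lipschitz condition; for the others it holds because the
rows do not collapse, and have entries in `[0, 1]`. -/
theorem IsAverageLipschitz.distance_bounds {α β r r' : ℝ} {F : Mat n ℝ}
    (hF : IsAverageLipschitz α β r r' F) (hr : 0 < r) (hr' : 0 < r') (i j : Fin n) :
    min α r' * |((i : ℕ) : ℝ) - (j : ℕ)| ≤ Real.sqrt n * rowDist F i j ∧
      Real.sqrt n * rowDist F i j ≤ max β (1 / r) * |((i : ℕ) : ℝ) - (j : ℕ)| := by
  wlog hij : i < j generalizing i j
  · rcases lt_or_eq_of_le (not_lt.1 hij) with h | h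
    · rw [rowDist_comm, abs_sub_comm]; exact this j i h
    · subst h; simp [rowDist]
  have hn : (0 : ℝ) < n := by exact_mod_cast i.pos
  have hs : Real.sqrt n * Real.sqrt n = n := Real.mul_self_sqrt hn.le
  have hs0 : 0 < Real.sqrt n := Real.sqrt_pos.2 hn
  have hlt : ((i : ℕ) : ℝ) < (j : ℕ) := by exact_mod_cast hij
  have hjn : ((j : ℕ) : ℝ) ≤ n := by exact_mod_cast j.2.le
  have hi0 : (0 : ℝ) ≤ (i : ℕ) := Nat.cast_nonneg _
  have habs : |((i : ℕ) : ℝ) - (j : ℕ)| = (j : ℕ) - (i : ℕ) := by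
    rw [abs_sub_comm, abs_of_pos (by linarith)]
  rw [habs]
  have hd : (0 : ℝ) ≤ (j : ℕ) - (i : ℕ) := by linarith
  by_cases hc : ((j : ℕ) : ℝ) - (i : ℕ) ≤ r * n
  · constructor
    · refine (mul_le_mul_of_nonneg_right (min_le_left _ _) hd).trans
        ((hF.lower i j hij hc).trans ((max_le ?_ ?_).trans (sum_abs_sub_le F i j)))
      · exact (Finset.sum_le_sum fun k _ => le_abs_self _).trans
          (Finset.sum_le_sum_of_subset_of_nonneg (Finset.subset_univ _) fun _ _ _ => abs_nonneg _)
      · exact (Finset.sum_le_sum fun k _ => by rw [abs_sub_comm]; exact le_abs_self _).trans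
          (Finset.sum_le_sum_of_subset_of_nonneg (Finset.subset_univ _) fun _ _ _ => abs_nonneg _)
    · have h1 := mul_le_mul_of_nonneg_left (hF.upper i j hij hc) hs0.le
      rw [mul_div_cancel₀ _ hs0.ne'] at h1
      exact h1.trans (mul_le_mul_of_nonneg_right (le_max_left _ _) hd)
  · push Not at hc
    constructor
    · have h1 := hF.noncollapse i j (by rw [habs]; exact hc)
      have h2 := mul_le_mul_of_nonneg_left h1.le hs0.le
      have h3 : min α r' * ((j : ℕ) - (i : ℕ) : ℝ) ≤ r' * n :=
        (mul_le_mul_of_nonneg_right (min_le_right _ _) hd).trans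
          (mul_le_mul_of_nonneg_left (by linarith) hr'.le)
      nlinarith
    · have h1 : rowDist F i j ≤ Real.sqrt n := by
        refine Real.sqrt_le_sqrt ?_
        have : ∀ k ∈ (Finset.univ : Finset (Fin n)), (F i k - F j k) ^ 2 ≤ 1 := by
          intro k _
          obtain ⟨a1, a2⟩ := hF.mem_Icc i k
          obtain ⟨b1, b2⟩ := hF.mem_Icc j k
          rw [sq_le_one_iff_abs_le_one, abs_le]; constructor <;> linarith
        simpa using Finset.sum_le_sum this
      have h2 := mul_le_mul_of_nonneg_left h1 hs0.le
      rw [hs] at h2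
      refine h2.trans (le_trans ?_ (mul_le_mul_of_nonneg_right (le_max_right _ _) hd))
      rw [div_mul_eq_mul_div, one_mul, le_div_iff₀ hr]
      linarith

/-- The reversal of a matrix. -/
def reversedMatrix (F : Mat n ℝ) : Mat n ℝ := fun i j => F (Fin.rev i) (Fin.rev j)

theorem signal_reversed (F : Mat n ℝ) (π : Equiv.Perm (Fin n)) :
    signal (reversedMatrix F) (reversed π) = signal F π := by
  funext i j
  simp [signal, reversedMatrix, reversed]

theorem IsRobinson.reversed {F : Mat n ℝ} (hF : IsRobinson F) : IsRobinson (reversedMatrix F) where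
  symm _ _ := hF.symm _ _
  left _ _ _ hki hij := hF.right _ _ _ (Fin.rev_lt_rev.2 hij) (Fin.rev_le_rev.2 hki)
  right _ _ _ hij hjk := hF.left _ _ _ (Fin.rev_le_rev.2 hjk) (Fin.rev_lt_rev.2 hij)

theorem coe_rev (i : Fin n) : ((Fin.rev i : ℕ) : ℝ) = n - 1 - (i : ℕ) := by
  rw [Fin.val_rev, Nat.cast_sub (by omega)]; push_cast; ring

theorem rowDist_reversedMatrix (F : Mat n ℝ) (i j : Fin n) :
    rowDist (reversedMatrix F) i j = rowDist F (Fin.rev i) (Fin.rev j) := by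
  unfold rowDist reversedMatrix
  congr 1
  exact Fintype.sum_equiv Fin.revPerm _ _ fun k => by simp

theorem IsAverageLipschitz.reversed {α β r r' : ℝ} {F : Mat n ℝ}
    (hF : IsAverageLipschitz α β r r' F) : IsAverageLipschitz α β r r' (reversedMatrix F) where
  mem_Icc _ _ := hF.mem_Icc _ _
  upper i j hij h := by
    have := hF.upper (Fin.rev j) (Fin.rev i) (Fin.rev_lt_rev.2 hij)
      (by rw [coe_rev, coe_rev]; linarith)
    rw [rowDist_reversedMatrix, rowDist_comm]
    rw [coe_rev, coe_rev] at this
    convert this using 3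
    ring
  lower i j hij h := by
    have := hF.lower (Fin.rev j) (Fin.rev i) (Fin.rev_lt_rev.2 hij)
      (by rw [coe_rev, coe_rev]; linarith)
    rw [max_comm, coe_rev, coe_rev] at this
    refine (le_of_eq (by ring)).trans (this.trans (le_of_eq ?_))
    congr 1
    · rw [Finset.sum_filter, Finset.sum_filter]
      refine Fintype.sum_equiv Fin.revPerm _ _ fun k => ?_
      simp only [Fin.revPerm_apply, coe_rev, reversedMatrix, Fin.rev_rev]
      congr 1
      exact propext ⟨fun h => by linarith, fun h => by linarith⟩
    · rw [Finset.sum_filter, Finset.sum_filter]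
      refine Fintype.sum_equiv Fin.revPerm _ _ fun k => ?_
      simp only [Fin.revPerm_apply, coe_rev, reversedMatrix, Fin.rev_rev]
      congr 1
      exact propext ⟨fun h => by linarith, fun h => by linarith⟩
  noncollapse i j h := by
    rw [rowDist_reversedMatrix]
    refine hF.noncollapse _ _ ?_
    rw [coe_rev, coe_rev, abs_sub_comm]
    convert h using 2
    ring

theorem latentDistance_univ (F : Mat n ℝ) (π : Equiv.Perm (Fin n)) (i j : Fin n) :
    latentDistance (signal F π) (fun _ => true) i j = Real.sqrt n * rowDist F (π i) (π j) := by
  rw [latentDistance, rowDist, ← Real.sqrt_mul (Nat.cast_nonneg n)]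
  congr 2
  exact Fintype.sum_equiv π _ _ fun k => by simp [masked, signal]

theorem sum_masked_sub_sq_eq (M : Mat n ℝ) {S : Fin n → Bool} {i j : Fin n} (hi : S i = true)
    (hj : S j = true) : ∑ l, (masked M S i l - masked M S j l) ^ 2 =
      ∑ l, if S l = true then (M i l - M j l) ^ 2 else 0 := by
  refine Finset.sum_congr rfl fun l _ => ?_
  by_cases hl : S l = true <;> simp [masked, hi, hj, hl]

theorem latentDistance_le_univ (M : Mat n ℝ) {S : Fin n → Bool} {i j : Fin n} (hi : S i = true)
    (hj : S j = true) : latentDistance M S i j ≤ latentDistance M (fun _ => true) i j := by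
  unfold latentDistance
  refine Real.sqrt_le_sqrt (mul_le_mul_of_nonneg_left ?_ (Nat.cast_nonneg n))
  rw [sum_masked_sub_sq_eq M hi hj, sum_masked_sub_sq_eq M (S := fun _ => true) rfl rfl]
  refine Finset.sum_le_sum fun l _ => ?_
  by_cases hl : S l = true <;> simp [hl, sq_nonneg]

/-- Testing the difference of two rows against a vector with entries in `[-1, 1]`. -/
theorem abs_sum_mul_masked_sub_le (F : Mat n ℝ) (π : Equiv.Perm (Fin n)) {S : Fin n → Bool}
    {i k : Fin n} (hi : S i = true) (hk : S k = true) (v : Fin n → ℝ) (hv : ∀ l, |v l| ≤ 1) :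
    |∑ l, v l * (masked (signal F π) S i l - masked (signal F π) S k l)| ≤
      Real.sqrt n * rowDist F (π i) (π k) := by
  refine (Finset.abs_sum_le_sum_abs _ _).trans (le_trans ?_ (sum_abs_sub_le F (π i) (π k)))
  refine le_trans (Finset.sum_le_sum fun l _ => ?_) (le_of_eq (Fintype.sum_equiv π
    (fun l => |signal F π i l - signal F π k l|) _ fun l => rfl))
  rw [abs_mul]
  refine (mul_le_of_le_one_left (abs_nonneg _) (hv l)).trans ?_
  by_cases hl : S l = true <;> simp [masked, hi, hk, hl]

/-! ### Accuracy of the distance estimate, on all indices and on a block -/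

/-- The indicator of a block of a partition. -/
def block (part : Fin n → Fin 3) (t : Fin 3) : Fin n → Bool := fun k => decide (part k = t)

/-- The indicator of the latent window of radius `√n` around `i`. -/
noncomputable def window (π : Equiv.Perm (Fin n)) (i k : Fin n) : ℝ :=
  if |((π k : ℕ) : ℝ) - (π i : ℕ)| ≤ Real.sqrt n then 1 else 0

/-- Near the ends of the latent order a window extends to one side only. -/
theorem sqrt_le_sum_window (π : Equiv.Perm (Fin n)) (i : Fin n) (hn : 12 ≤ Real.sqrt n) :
    Real.sqrt n ≤ ∑ k, window π i k := by
  have hsq : Real.sqrt n * Real.sqrt n = n := Real.mul_self_sqrt (Nat.cast_nonneg n)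
  set m := ⌈Real.sqrt n⌉₊ with hm
  have hm1 : Real.sqrt n ≤ m := Nat.le_ceil _
  have hm2 : (m : ℝ) < Real.sqrt n + 1 := Nat.ceil_lt_add_one (by linarith)
  have hmn : 2 * m ≤ n := by
    have : (2 : ℝ) * m ≤ n := by nlinarith
    exact_mod_cast this
  refine hm1.trans ?_
  unfold window
  rw [Finset.sum_boole, Nat.cast_le]
  have key : ∀ f : Fin m → Fin n, Function.Injective f →
      (∀ x, |((f x : ℕ) : ℝ) - (π i : ℕ)| ≤ Real.sqrt n) →
      m ≤ (Finset.univ.filter fun k => |((π k : ℕ) : ℝ) - (π i : ℕ)| ≤ Real.sqrt n).card := by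
    intro f hf hfx
    have h1 := Finset.card_le_card_of_injOn (s := (Finset.univ : Finset (Fin m)))
      (t := Finset.univ.filter fun k => |((π k : ℕ) : ℝ) - (π i : ℕ)| ≤ Real.sqrt n)
      (fun x => π.symm (f x)) (fun x _ => by simpa using hfx x)
      (fun x _ y _ h => hf (π.symm.injective h))
    simpa using h1
  have hpi := (π i).2
  by_cases hc : m ≤ (π i : ℕ) + 1
  · refine key (fun x => ⟨(π i : ℕ) - x, by omega⟩) (fun x y h => ?_) fun x => ?_
    · have := x.2; have := y.2
      simp only [Fin.mk.injEq] at h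
      exact Fin.ext (by omega)
    · have h1 : ((x : ℕ) : ℝ) + 1 ≤ m := by exact_mod_cast x.2
      have h0 : (0 : ℝ) ≤ (x : ℕ) := Nat.cast_nonneg _
      simp only
      rw [Nat.cast_sub (by have := x.2; omega), abs_le]
      constructor <;> linarith
  · refine key (fun x => ⟨(π i : ℕ) + x, by have := x.2; omega⟩) (fun x y h => ?_) fun x => ?_
    · simp only [Fin.mk.injEq] at h
      exact Fin.ext (by omega)
    · have h1 : ((x : ℕ) : ℝ) + 1 ≤ m := by exact_mod_cast x.2
      have h0 : (0 : ℝ) ≤ (x : ℕ) := Nat.cast_nonneg _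
      simp only
      push_cast
      rw [abs_le]
      constructor <;> linarith

/-- A set of three indices contains two that are different from the centre of the window. -/
theorem exists_two_of_window {π : Equiv.Perm (Fin n)} {S : Fin n → Bool} {i : Fin n}
    (hS : 3 ≤ ∑ k, if S k = true then window π i k else 0) :
    ∃ k₁ k₂, k₁ ≠ k₂ ∧ ∀ k, k = k₁ ∨ k = k₂ → S k = true ∧ k ≠ i ∧
      |((π k : ℕ) : ℝ) - (π i : ℕ)| ≤ Real.sqrt n := by
  have h1 : ∑ k, (if S k = true then window π i k else 0) =
      ((Finset.univ.filter fun k => S k = true ∧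
        |((π k : ℕ) : ℝ) - (π i : ℕ)| ≤ Real.sqrt n).card : ℝ) := by
    rw [← Finset.sum_boole]
    refine Finset.sum_congr rfl fun k _ => ?_
    unfold window
    by_cases h : S k = true <;> simp [h]
  rw [h1] at hS
  have h2 : 3 ≤ (Finset.univ.filter fun k => S k = true ∧
        |((π k : ℕ) : ℝ) - (π i : ℕ)| ≤ Real.sqrt n).card := by exact_mod_cast hS
  have h3 : 1 < ((Finset.univ.filter fun k => S k = true ∧
        |((π k : ℕ) : ℝ) - (π i : ℕ)| ≤ Real.sqrt n).erase i).card := by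
    have := Finset.pred_card_le_card_erase (s := Finset.univ.filter fun k => S k = true ∧
        |((π k : ℕ) : ℝ) - (π i : ℕ)| ≤ Real.sqrt n) (a := i)
    omega
  obtain ⟨k₁, hk₁, k₂, hk₂, hne⟩ := Finset.one_lt_card.1 h3
  simp only [Finset.mem_erase, Finset.mem_filter, Finset.mem_univ, true_and] at hk₁ hk₂
  refine ⟨k₁, k₂, hne, ?_⟩
  rintro k (rfl | rfl)
  · exact ⟨hk₁.2.1, hk₁.1, hk₁.2.2⟩
  · exact ⟨hk₂.2.1, hk₂.1, hk₂.2.2⟩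

/-- Accuracy of the distance estimate on a set `S` which meets all latent windows in at least three
indices and on which the inner products of distinct rows are accurate up to `η`. -/
theorem IsAverageLipschitz.estimateDistance_accurate {α β r r' η : ℝ} {F A : Mat n ℝ}
    {π : Equiv.Perm (Fin n)} {S : Fin n → Bool} (hF : IsAverageLipschitz α β r r' F)
    (hβ : 0 < β) (hr : 0 < r) (hr' : 0 < r') (hη : 0 ≤ η)
    (hG : ∀ i j, S i = true → S j = true → i ≠ j →
      |gram A S i j - gram (signal F π) S i j| ≤ η)
    (hw : ∀ i, 3 ≤ ∑ k, if S k = true then window π i k else 0)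
    {i j : Fin n} (hi : S i = true) (hj : S j = true) (hij : i ≠ j) :
    |(estimateDistance A S).val i j - latentDistance (signal F π) S i j| ≤
      Real.sqrt (n * (12 * η + 4 * (max β (1 / r) * Real.sqrt n))) := by
  refine Seriation.estimateDistance_accurate hη (by positivity) (fun i j => hF.mem_Icc _ _) hG
    (fun i hi => ?_) hi hj hij
  obtain ⟨k₁, k₂, hne, hk⟩ := exists_two_of_window (hw i)
  refine ⟨k₁, k₂, hne, fun k hk' => ⟨(hk k hk').1, (hk k hk').2.1, fun v hv => ?_⟩⟩
  obtain ⟨h1, h2, h3⟩ := hk k hk'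
  refine (abs_sum_mul_masked_sub_le F π hi h1 v hv).trans
    ((hF.distance_bounds hr hr' (π i) (π k)).2.trans ?_)
  rw [abs_sub_comm] at h3
  exact mul_le_mul_of_nonneg_left h3 (by positivity)

/-! ### The refined seriation -/

/-- Whether `k` is on the right (on the left) of `p` in the latent order. -/
def onSide (π : Equiv.Perm (Fin n)) (right : Bool) (p k : Fin n) : Bool :=
  if right = true then decide (π p < π k) else decide (π k < π p)

/-- The squared differences of the rows `p` and `k` of the signal. -/
def squaredDifference (F : Mat n ℝ) (π : Equiv.Perm (Fin n)) (p k l : Fin n) : ℝ :=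
  (signal F π p l - signal F π k l) ^ 2

/-- The differences of the rows `i` and `j` of the signal on the far left. -/
noncomputable def trimmedLeft (F : Mat n ℝ) (π : Equiv.Perm (Fin n)) (i j k : Fin n) : ℝ :=
  if π i < π j ∧ ((π k : ℕ) : ℝ) < (π i : ℕ) - (1 / 32) * n
    then signal F π i k - signal F π j k else 0

/-- The differences of the rows `j` and `i` of the signal on the far right. -/
noncomputable def trimmedRight (F : Mat n ℝ) (π : Equiv.Perm (Fin n)) (i j k : Fin n) : ℝ :=
  if π i < π j ∧ ((π j : ℕ) : ℝ) + (1 / 32) * n < (π k : ℕ)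
    then signal F π j k - signal F π i k else 0

/-- The weight vectors whose sums over a block of the random partition have to be comparable with
their total sums: one for every latent window, and three for every pair of indices. -/
noncomputable def weights (F : Mat n ℝ) (π : Equiv.Perm (Fin n)) :
    Fin n ⊕ Fin 3 × Fin n × Fin n → Fin n → ℝ
  | .inl i => window π i
  | .inr (0, i, j) => squaredDifference F π i j
  | .inr (1, i, j) => trimmedLeft F π i j
  | .inr (2, i, j) => trimmedRight F π i j

/-- The sum of the differences of two rows of `X` over the indices of a block that are far from `p`,
according to the distance estimated on the block, and on a given side of `p`. -/
noncomputable def sideSum (π : Equiv.Perm (Fin n)) (A : Mat n ℝ) (δ₄ : ℝ) (S : Fin n → Bool)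
    (X : Mat n ℝ) (right : Bool) (p i j : Fin n) : ℝ :=
  ∑ k, if S k = true ∧ δ₄ ≤ (estimateDistance A S).val p k ∧ onSide π right p k = true
    then X i k - X j k else 0

/-- The event on which SABRE succeeds (together with the same event for the reversed order): inner
products of distinct rows are accurate up to `η`, on all indices and on every block; the noise in the
sums evaluated on a block is small, for indices outside the block; and every block receives at least a
quarter of each total weight that is not too small. -/
structure IsGood (F : Mat n ℝ) (π : Equiv.Perm (Fin n)) (σ δ₄ η : ℝ) (E : Mat n ℝ)
    (part : Fin n → Fin 3) : Prop where
  gram : ∀ S : Fin n → Bool, (S = (fun _ => true) ∨ ∃ t, S = block part t) →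
    ∀ i j, S i = true → S j = true → i ≠ j →
      |gram (observation F π σ E) S i j - gram (signal F π) S i j| ≤ η
  comparison : ∀ t i j p right, i ≠ j → part i ≠ t → part j ≠ t →
    |sideSum π (observation F π σ E) δ₄ (block part t) E right p i j| ≤
      3 * Real.sqrt (n * Real.log n)
  sample : ∀ t w, Real.sqrt n ≤ ∑ k, weights F π w k →
    (∑ k, weights F π w k) / 4 ≤ ∑ k, if block part t k = true then weights F π w k else 0

/-- Relations between the parameters that hold when the dimension is large. Here `a` and `b` are the
constants that compare the distances of rows with latent distances, `η` is the error of the inner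
products, and `τ` stands for `σ √(n log n)`. -/
structure IsScale (n : ℕ) (a b r η τ δ₁ δ₂ δ₃ δ₄ : ℝ) : Prop where
  a_pos : 0 < a
  b_pos : 0 < b
  δ₁_pos : 0 < δ₁
  sqrt_ge : 12 ≤ Real.sqrt n
  error : Real.sqrt (n * (12 * η + 4 * (b * Real.sqrt n))) ≤ δ₁ / 4
  window : b * Real.sqrt n ≤ δ₁ / 4
  le₁ : δ₁ ≤ δ₂
  le₂ : δ₂ ≤ δ₃
  le₃ : δ₃ ≤ δ₄
  gap₁ : 16 * b * δ₁ ≤ a * δ₂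
  gap₂ : 16 * b * δ₂ ≤ a * δ₃
  gap₃ : 16 * b * δ₃ ≤ a * δ₄
  one_le : 1 ≤ 2 * δ₂ / a
  small : 200 * (2 * δ₃ / a) ≤ n
  small' : 2 * δ₃ / a ≤ r * n
  far : δ₄ + δ₁ ≤ a * n / 128
  sample : Real.sqrt n ≤ a ^ 2 * n / 4096
  τ_pos : 0 < τ
  threshold : Real.sqrt n ≤ 32 * τ

section Good

variable {α β r r' σ η τ δ₁ δ₂ δ₃ δ₄ : ℝ} {F E : Mat n ℝ} {π : Equiv.Perm (Fin n)}
  {part : Fin n → Fin 3}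

theorem IsGood.accurate (hg : IsGood F π σ δ₄ η E part) (hF : IsAverageLipschitz α β r r' F)
    (hβ : 0 < β) (hr : 0 < r) (hr' : 0 < r') (hη : 0 ≤ η)
    (hs : IsScale n (min α r') (max β (1 / r)) r η τ δ₁ δ₂ δ₃ δ₄) {S : Fin n → Bool}
    (hS : S = (fun _ => true) ∨ ∃ t, S = block part t) {i j : Fin n} (hi : S i = true)
    (hj : S j = true) (hij : i ≠ j) :
    |(estimateDistance (observation F π σ E) S).val i j - latentDistance (signal F π) S i j| ≤
      δ₁ / 4 := by
  refine (hF.estimateDistance_accurate hβ hr hr' hη (hg.gram S hS) (fun i => ?_) hi hj hij).trans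
    hs.error
  have h1 := sqrt_le_sum_window π i hs.sqrt_ge
  have h2 := hs.sqrt_ge
  rcases hS with rfl | ⟨t, rfl⟩
  · simp only [if_true]
    linarith
  · have := hg.sample t (.inl i) h1
    simp only [weights] at this
    linarith

theorem estimateDistance_comm (A : Mat n ℝ) (S : Fin n → Bool) (i j : Fin n) :
    (estimateDistance A S).val i j = (estimateDistance A S).val j i := by
  obtain ⟨m, h1, h2, -⟩ := estimateDistance_spec A S
  by_cases h : S i = true ∧ S j = true ∧ i ≠ j
  · rw [h1 i j h.1 h.2.1 h.2.2, h1 j i h.2.1 h.1 h.2.2.symm, gram_comm A S i j]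
    congr 2; ring
  · rw [h2 i j h, h2 j i fun h' => h ⟨h'.2.1, h'.1, h'.2.2.symm⟩]

theorem estimateDistance_self (A : Mat n ℝ) (S : Fin n → Bool) (i : Fin n) :
    (estimateDistance A S).val i i = 0 := by
  obtain ⟨m, -, h2, -⟩ := estimateDistance_spec A S
  exact h2 i i (by simp)

/-- The estimated distances resolve the latent order, at the scales `2 δ₂ / min α r'` and
`2 δ₃ / min α r'`. -/
theorem IsGood.resolves (hg : IsGood F π σ δ₄ η E part) (hF : IsAverageLipschitz α β r r' F)
    (hβ : 0 < β) (hr : 0 < r) (hr' : 0 < r') (hη : 0 ≤ η)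
    (hs : IsScale n (min α r') (max β (1 / r)) r η τ δ₁ δ₂ δ₃ δ₄) :
    Resolves π (estimateDistance (observation F π σ E) fun _ => true).val δ₁ δ₂ δ₃
      (2 * δ₂ / min α r') (2 * δ₃ / min α r') := by
  set a := min α r' with ha
  set b := max β (1 / r) with hb
  set D := (estimateDistance (observation F π σ E) fun _ => true).val with hD
  have ha0 := hs.a_pos
  have hb0 := hs.b_pos
  have hd1 := hs.δ₁_pos
  have hd2 := hs.le₁
  have hd3 := hs.le₂
  have hlo : ∀ i j, i ≠ j → a * |((π i : ℕ) : ℝ) - (π j : ℕ)| ≤ D i j + δ₁ / 4 := by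
    intro i j hij
    have h1 := abs_le.1 (hg.accurate hF hβ hr hr' hη hs (S := fun _ => true) (Or.inl rfl)
      (i := i) (j := j) rfl rfl hij)
    have h2 := (hF.distance_bounds hr hr' (π i) (π j)).1
    rw [← latentDistance_univ] at h2
    linarith
  have hup : ∀ i j, i ≠ j → D i j ≤ b * |((π i : ℕ) : ℝ) - (π j : ℕ)| + δ₁ / 4 := by
    intro i j hij
    have h1 := abs_le.1 (hg.accurate hF hβ hr hr' hη hs (S := fun _ => true) (Or.inl rfl)
      (i := i) (j := j) rfl rfl hij)
    have h2 := (hF.distance_bounds hr hr' (π i) (π j)).2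
    rw [← latentDistance_univ] at h2
    linarith
  have hne : ∀ i k ρ, 0 < ρ → ρ ≤ |((π i : ℕ) : ℝ) - (π k : ℕ)| → i ≠ k := by
    rintro i k ρ hρ h rfl
    simp at h; linarith
  refine ⟨estimateDistance_comm _ _, fun i k l hk hl hkl hmax => ?_, fun k l hkl => ?_,
    fun i k hik => ?_, fun i k hik h => ?_, fun i k hik => ?_, hs.one_le, ?_, ?_⟩
  · -- `k` and `l` are closer to each other than to `i`
    by_cases hkl' : k = l
    · rw [hkl']
    have h1 := hlo k l hkl'
    have key : ∀ k l, k ≠ i → a * |((π k : ℕ) : ℝ) - (π l : ℕ)| ≤ 5 / 4 * δ₁ → δ₂ ≤ D i k →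
        (π k < π i ↔ π l < π i) := by
      intro k l hk h1 h2
      have h3 := hup i k hk.symm
      have h4 : 3 / 4 * δ₂ ≤ b * |((π i : ℕ) : ℝ) - (π k : ℕ)| := by linarith
      have h5 : |((π k : ℕ) : ℝ) - (π l : ℕ)| < |((π i : ℕ) : ℝ) - (π k : ℕ)| := by
        have := hs.gap₁
        by_contra hcon
        push Not at hcon
        have h6 := mul_le_mul_of_nonneg_left hcon hb0.le
        have h7 : a * (3 / 4 * δ₂) ≤ b * (5 / 4 * δ₁) := by
          calc a * (3 / 4 * δ₂) ≤ a * (b * |((π k : ℕ) : ℝ) - (π l : ℕ)|) :=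
                mul_le_mul_of_nonneg_left (h4.trans h6) ha0.le
            _ = b * (a * |((π k : ℕ) : ℝ) - (π l : ℕ)|) := by ring
            _ ≤ _ := mul_le_mul_of_nonneg_left h1 hb0.le
        nlinarith [mul_pos hb0 hd1]
      have hki : π k ≠ π i := fun h => hk (π.injective h)
      rw [Fin.lt_def, Fin.lt_def, ← Nat.cast_lt (α := ℝ), ← Nat.cast_lt (α := ℝ)]
      obtain ⟨a1, a2⟩ := abs_lt.1 h5
      have a3 : ((π k : ℕ) : ℝ) ≠ (π i : ℕ) := fun h => hki (Fin.ext (by exact_mod_cast h))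
      rcases lt_or_gt_of_ne a3 with h | h
      · rw [abs_of_pos (by linarith)] at a1 a2
        exact ⟨fun _ => by linarith, fun _ => h⟩
      · rw [abs_of_neg (by linarith)] at a1 a2
        exact ⟨fun h' => by linarith, fun h' => by linarith⟩
    rcases le_max_iff.1 hmax with h | h
    · exact key k l hk (by linarith) h
    · rw [abs_sub_comm] at h1
      exact (key l k hl (by linarith) h).symm
  · have hne' : k ≠ l := by rintro rfl; omega
    have h1 := hup k l hne'
    have h2 : |((π k : ℕ) : ℝ) - (π l : ℕ)| = 1 := by
      rw [← hkl]; push_cast; rw [sub_add_cancel_left, abs_neg, abs_one]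
    rw [h2, mul_one] at h1
    have h3 := hs.window
    have h4 := hs.sqrt_ge
    nlinarith
  · have h1 := hlo i k (hne i k _ (by linarith [hs.one_le]) hik)
    rw [div_le_iff₀ ha0] at hik
    linarith
  · have h1 := hup i k hik.symm
    have h2 := hs.gap₂
    rw [div_le_iff₀ ha0]
    have h3 : a * (3 / 4 * δ₃) ≤ a * (b * |((π i : ℕ) : ℝ) - (π k : ℕ)|) :=
      mul_le_mul_of_nonneg_left (by linarith) ha0.le
    have h4 : b * (2 * δ₂) ≤ b * (|((π i : ℕ) : ℝ) - (π k : ℕ)| * a) := by nlinarith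
    exact le_of_mul_le_mul_left h4 hb0
  · have h0 : 2 * δ₂ / a ≤ 2 * δ₃ / a := by gcongr
    have h1 := hlo i k (hne i k _ (by linarith [hs.one_le]) hik)
    rw [div_le_iff₀ ha0] at hik
    linarith
  · have h0 : 2 * δ₂ / a ≤ 2 * δ₃ / a := by gcongr
    linarith [hs.one_le]
  · have h0 : 2 * δ₂ / a ≤ 2 * δ₃ / a := by gcongr
    linarith [hs.one_le, hs.small]

/-- An index of the block which is estimated to be far from `p` is far from `p`. -/
theorem IsGood.far_of_le (hg : IsGood F π σ δ₄ η E part) (hF : IsAverageLipschitz α β r r' F)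
    (hβ : 0 < β) (hr : 0 < r) (hr' : 0 < r') (hη : 0 ≤ η)
    (hs : IsScale n (min α r') (max β (1 / r)) r η τ δ₁ δ₂ δ₃ δ₄) {t : Fin 3} {p k : Fin n}
    (hp : part p = t) (hk : part k = t)
    (h : δ₄ ≤ (estimateDistance (observation F π σ E) (block part t)).val p k) :
    4 * (2 * δ₃ / min α r') ≤ |((π p : ℕ) : ℝ) - (π k : ℕ)| := by
  have ha0 := hs.a_pos
  have hb0 := hs.b_pos
  have hd1 := hs.δ₁_pos
  have hd2 := hs.le₁
  have hd3 := hs.le₂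
  have hd4 := hs.le₃
  have hpk : p ≠ k := by
    rintro rfl
    rw [estimateDistance_self] at h; linarith
  have hp' : block part t p = true := by simp [block, hp]
  have hk' : block part t k = true := by simp [block, hk]
  have h1 := abs_le.1 (hg.accurate hF hβ hr hr' hη hs (Or.inr ⟨t, rfl⟩) hp' hk' hpk)
  have h2 := latentDistance_le_univ (signal F π) hp' hk'
  have h3 := (hF.distance_bounds hr hr' (π p) (π k)).2
  rw [← latentDistance_univ] at h3
  have h5 := hs.gap₃
  generalize |((π p : ℕ) : ℝ) - (π k : ℕ)| = d at h3 ⊢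
  generalize min α r' = a at *
  generalize max β (1 / r) = b at *
  rw [← mul_div_assoc, div_le_iff₀ ha0]
  have h4 : a * (3 / 4 * δ₄) ≤ a * (b * d) := mul_le_mul_of_nonneg_left (by linarith) ha0.le
  have h6 : b * (4 * (2 * δ₃)) ≤ b * (d * a) := by nlinarith
  exact le_of_mul_le_mul_left h6 hb0

/-- An index of the block which is very far from `p` is estimated to be far from `p`: the distance of
the two rows restricted to the block is at least half their distance. -/
theorem IsGood.le_of_far (hg : IsGood F π σ δ₄ η E part) (hF : IsAverageLipschitz α β r r' F)
    (hβ : 0 < β) (hr : 0 < r) (hr' : 0 < r') (hη : 0 ≤ η)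
    (hs : IsScale n (min α r') (max β (1 / r)) r η τ δ₁ δ₂ δ₃ δ₄) {t : Fin 3} {p k : Fin n}
    (hp : part p = t) (hk : part k = t)
    (h : (n : ℝ) / 64 ≤ |((π p : ℕ) : ℝ) - (π k : ℕ)|) :
    δ₄ ≤ (estimateDistance (observation F π σ E) (block part t)).val p k := by
  have ha0 := hs.a_pos
  have hn : (0 : ℝ) < n := by
    have := p.pos
    exact_mod_cast this
  have hpk : p ≠ k := by
    rintro rfl
    simp at h; linarith
  have hp' : block part t p = true := by simp [block, hp]
  have hk' : block part t k = true := by simp [block, hk]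
  have h1 := abs_le.1 (hg.accurate hF hβ hr hr' hη hs (Or.inr ⟨t, rfl⟩) hp' hk' hpk)
  have h3 := (hF.distance_bounds hr hr' (π p) (π k)).1
  rw [← latentDistance_univ] at h3
  have h5 := hs.sample
  have h6 := hs.far
  have hd1 := hs.δ₁_pos
  have hw : ∑ l, weights F π (.inr (0, p, k)) l =
      ∑ l, (masked (signal F π) (fun _ => true) p l - masked (signal F π) (fun _ => true) k l) ^ 2 := by
    rw [sum_masked_sub_sq_eq _ (S := fun _ => true) rfl rfl]; rfl
  have hsamp := hg.sample t (.inr (0, p, k))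
  have hw' : (∑ l, if block part t l = true then weights F π (.inr (0, p, k)) l else 0) =
      ∑ l, (masked (signal F π) (block part t) p l - masked (signal F π) (block part t) k l) ^ 2 := by
    rw [sum_masked_sub_sq_eq _ hp' hk']; rfl
  rw [hw, hw'] at hsamp
  unfold latentDistance at h1 h3
  generalize (∑ l, (masked (signal F π) (fun _ => true) p l -
    masked (signal F π) (fun _ => true) k l) ^ 2) = X at *
  generalize (∑ l, (masked (signal F π) (block part t) p l -
    masked (signal F π) (block part t) k l) ^ 2) = Y at *
  generalize min α r' = a at *
  have h7 : a * n / 64 ≤ Real.sqrt (n * X) :=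
    le_trans (by rw [mul_div_assoc]; exact mul_le_mul_of_nonneg_left h ha0.le) h3
  have h8 : (a * n / 64) ^ 2 ≤ n * X := (Real.le_sqrt' (by positivity)).1 h7
  have h9 : a ^ 2 * n / 4096 ≤ X := by
    refine le_of_mul_le_mul_left (le_trans (le_of_eq ?_) h8) hn
    ring
  have h10 := hsamp (h5.trans h9)
  have h11 : a * n / 128 ≤ Real.sqrt (n * Y) := by
    refine Real.le_sqrt_of_sq_le ?_
    have : n * (X / 4) ≤ n * Y := mul_le_mul_of_nonneg_left h10 hn.le
    nlinarith
  linarith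

/-- The signal part of the sums of a comparison of `i` and `j`, where `i` is on the left of `j` and
both are close to `p`. All terms have the correct sign by the Robinson property, since an index that is
estimated to be far from `p` is beyond both `i` and `j`; and the sums contain the part of the trimmed
sums of the average-Lipschitz condition that belongs to the block. -/
theorem IsGood.sideSum_signal (hg : IsGood F π σ δ₄ η E part) (hF : IsAverageLipschitz α β r r' F)
    (hR : IsRobinson F)
    (hβ : 0 < β) (hr : 0 < r) (hr' : 0 < r') (hη : 0 ≤ η)
    (hs : IsScale n (min α r') (max β (1 / r)) r η τ δ₁ δ₂ δ₃ δ₄) {t : Fin 3} {p i j : Fin n}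
    (hp : part p = t) (hij : π i < π j)
    (hpi : |((π p : ℕ) : ℝ) - (π i : ℕ)| ≤ 2 * (2 * δ₃ / min α r'))
    (hpj : |((π p : ℕ) : ℝ) - (π j : ℕ)| ≤ 2 * (2 * δ₃ / min α r'))
    (hd : ((π j : ℕ) : ℝ) - (π i : ℕ) ≤ 2 * δ₃ / min α r') :
    0 ≤ sideSum π (observation F π σ E) δ₄ (block part t) (signal F π) false p i j ∧
    sideSum π (observation F π σ E) δ₄ (block part t) (signal F π) true p i j ≤ 0 ∧
    (Real.sqrt n ≤ α * (((π j : ℕ) : ℝ) - (π i : ℕ)) →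
      α * (((π j : ℕ) : ℝ) - (π i : ℕ)) / 4 ≤
          sideSum π (observation F π σ E) δ₄ (block part t) (signal F π) false p i j ∨
        α * (((π j : ℕ) : ℝ) - (π i : ℕ)) / 4 ≤
          - sideSum π (observation F π σ E) δ₄ (block part t) (signal F π) true p i j) := by
  set D := (estimateDistance (observation F π σ E) (block part t)).val with hD
  have hfar := fun {k} hk => hg.far_of_le hF hβ hr hr' hη hs hp (k := k) hk
  have hle := fun {k} hk => hg.le_of_far hF hβ hr hr' hη hs hp (k := k) hk
  have hsmall := hs.small
  have hsmall' := hs.small'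
  have hone : 1 ≤ 2 * δ₃ / min α r' := hs.one_le.trans (by
    have := hs.a_pos; have := hs.le₂; gcongr)
  have hlow := hF.lower (π i) (π j) hij (hd.trans hsmall')
  generalize 2 * δ₃ / min α r' = ρ at *
  have hij' : ((π i : ℕ) : ℝ) < (π j : ℕ) := by exact_mod_cast hij
  have hl : ∀ k, block part t k = true ∧ δ₄ ≤ D p k ∧ onSide π false p k = true →
      0 ≤ signal F π i k - signal F π j k := by
    rintro k ⟨h1, h2, h3⟩
    have h4 := hfar (by simpa [block] using h1) h2
    have h5 : π k < π p := by simpa [onSide] using h3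
    have h6 : ((π k : ℕ) : ℝ) < (π p : ℕ) := by exact_mod_cast h5
    rw [abs_of_pos (by linarith)] at h4
    have h7 := abs_le.1 hpi
    have h8 : ((π k : ℕ) : ℝ) ≤ (π i : ℕ) := by linarith
    have := hR.left (π k) (π i) (π j) (by exact_mod_cast h8) hij
    simp only [signal]; linarith
  have hr2 : ∀ k, block part t k = true ∧ δ₄ ≤ D p k ∧ onSide π true p k = true →
      0 ≤ signal F π j k - signal F π i k := by
    rintro k ⟨h1, h2, h3⟩
    have h4 := hfar (by simpa [block] using h1) h2
    have h5 : π p < π k := by simpa [onSide] using h3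
    have h6 : ((π p : ℕ) : ℝ) < (π k : ℕ) := by exact_mod_cast h5
    rw [abs_of_neg (by linarith)] at h4
    have h7 := abs_le.1 hpj
    have h8 : ((π j : ℕ) : ℝ) ≤ (π k : ℕ) := by linarith
    have := hR.right (π i) (π j) (π k) hij (by exact_mod_cast h8)
    simp only [signal]; linarith
  have hneg : - sideSum π (observation F π σ E) δ₄ (block part t) (signal F π) true p i j =
      ∑ k, if block part t k = true ∧ δ₄ ≤ D p k ∧ onSide π true p k = true
        then signal F π j k - signal F π i k else 0 := by
    rw [sideSum, ← Finset.sum_neg_distrib]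
    refine Finset.sum_congr rfl fun k _ => ?_
    split_ifs
    · ring
    · simp
  have hn0 : (0 : ℝ) ≤ n := Nat.cast_nonneg n
  refine ⟨Finset.sum_nonneg fun k _ => ?_, ?_, fun hQ => ?_⟩
  · split_ifs with h
    · exact hl k h
    · exact le_rfl
  · rw [← neg_nonneg, hneg]
    refine Finset.sum_nonneg fun k _ => ?_
    split_ifs with h
    · exact hr2 k h
    · exact le_rfl
  · have h7 := abs_le.1 hpi
    have h8 := abs_le.1 hpj
    rcases le_max_iff.1 hlow with hlow | hlow
    · left
      have h1 : α * (((π j : ℕ) : ℝ) - (π i : ℕ)) ≤ ∑ k, weights F π (.inr (1, i, j)) k := by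
        refine hlow.trans (le_of_eq ?_)
        rw [Finset.sum_filter]
        refine (Fintype.sum_equiv π _ _ fun k => ?_).symm
        simp only [weights, trimmedLeft, hij, true_and, signal]
      refine le_trans (by linarith) ((hg.sample t _ (hQ.trans h1)).trans
        (Finset.sum_le_sum fun k _ => ?_))
      simp only [weights, trimmedLeft, hij, true_and]
      by_cases hk : block part t k = true
      · by_cases hc : ((π k : ℕ) : ℝ) < (π i : ℕ) - (1 / 32) * n
        · have hc' : π k < π p := by
            rw [Fin.lt_def, ← Nat.cast_lt (α := ℝ)]; linarith
          have hfk := hle (k := k) (by simpa [block] using hk)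
            (le_trans (by linarith) (le_abs_self _))
          rw [if_pos hk, if_pos hc, if_pos ⟨hk, hfk, by simpa [onSide] using hc'⟩]
        · rw [if_pos hk, if_neg hc]
          split_ifs with h
          · exact hl k h
          · exact le_rfl
      · simp [hk]
    · right
      have h1 : α * (((π j : ℕ) : ℝ) - (π i : ℕ)) ≤ ∑ k, weights F π (.inr (2, i, j)) k := by
        refine hlow.trans (le_of_eq ?_)
        rw [Finset.sum_filter]
        refine (Fintype.sum_equiv π _ _ fun k => ?_).symm
        simp only [weights, trimmedRight, hij, true_and, signal]
      rw [hneg]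
      refine le_trans (by linarith) ((hg.sample t _ (hQ.trans h1)).trans
        (Finset.sum_le_sum fun k _ => ?_))
      simp only [weights, trimmedRight, hij, true_and]
      by_cases hk : block part t k = true
      · by_cases hc : ((π j : ℕ) : ℝ) + (1 / 32) * n < (π k : ℕ)
        · have hc' : π p < π k := by
            rw [Fin.lt_def, ← Nat.cast_lt (α := ℝ)]; linarith
          have hfk := hle (k := k) (by simpa [block] using hk)
            (by rw [abs_sub_comm]; exact le_trans (by linarith) (le_abs_self _))
          rw [if_pos hk, if_pos hc, if_pos ⟨hk, hfk, by simpa [onSide] using hc'⟩]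
        · rw [if_pos hk, if_neg hc]
          split_ifs with h
          · exact hr2 k h
          · exact le_rfl
      · simp [hk]

/-- The decision rule, when the sums are within `3 τ` of a nonnegative and a nonpositive number. -/
theorem decideComparison_eq {τ l r x y : ℝ} (hτ : 0 < τ) (hl : |l - x| ≤ 3 * τ)
    (hr : |r - y| ≤ 3 * τ) (hx : 0 ≤ x) (hy : y ≤ 0) :
    decideComparison (5 * τ) l r = -1 ∨
      (decideComparison (5 * τ) l r = 0 ∧ x ≤ 8 * τ ∧ -y ≤ 8 * τ) := by
  have hl' := abs_le.1 hl
  have hr' := abs_le.1 hr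
  unfold decideComparison
  split_ifs with h1 h2
  · left
    have : 0 < l := by
      rcases le_abs.1 h1 with h | h <;> linarith
    simp [sign_pos this]
  · left
    have : r < 0 := by
      rcases le_abs.1 h2 with h | h <;> linarith
    simp [sign_neg this]
  · right
    push Not at h1 h2
    have h1 := abs_lt.1 h1
    have h2 := abs_lt.1 h2
    exact ⟨rfl, by linarith, by linarith⟩

theorem decideComparison_neg (τ l r : ℝ) :
    decideComparison τ (-l) (-r) = - decideComparison τ l r := by
  unfold decideComparison
  simp only [abs_neg, Left.sign_neg]
  split_ifs <;> simp

theorem sideSum_swap (A : Mat n ℝ) (S : Fin n → Bool) (X : Mat n ℝ) (right : Bool)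
    (p i j : Fin n) :
    sideSum π A δ₄ S X right p j i = - sideSum π A δ₄ S X right p i j := by
  unfold sideSum
  rw [← Finset.sum_neg_distrib]
  refine Finset.sum_congr rfl fun k _ => ?_
  split_ifs
  · ring
  · simp

theorem sideSum_observation (A : Mat n ℝ) (S : Fin n → Bool) (right : Bool)
    (p i j : Fin n) :
    sideSum π A δ₄ S (observation F π σ E) right p i j =
      sideSum π A δ₄ S (signal F π) right p i j + σ * sideSum π A δ₄ S E right p i j := by
  unfold sideSum
  rw [Finset.mul_sum, ← Finset.sum_add_distrib]
  refine Finset.sum_congr rfl fun k _ => ?_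
  split_ifs
  · simp only [observation, signal]; ring
  · simp

/-- Re-evaluated comparisons are correct unless they are `0`, and they are `0` only for indices that
are close to each other. -/
theorem IsGood.decide_correct (hg : IsGood F π σ δ₄ η E part) (hF : IsAverageLipschitz α β r r' F)
    (hR : IsRobinson F) (hα : 0 < α)
    (hβ : 0 < β) (hr : 0 < r) (hr' : 0 < r') (hη : 0 ≤ η) (hσ : 0 < σ)
    (hτ : τ = σ * Real.sqrt (n * Real.log n))
    (hs : IsScale n (min α r') (max β (1 / r)) r η τ δ₁ δ₂ δ₃ δ₄) {t : Fin 3} {p i j : Fin n}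
    (hp : part p = t) (hi : part i ≠ t) (hj : part j ≠ t) (hij : i ≠ j)
    (hpi : |((π p : ℕ) : ℝ) - (π i : ℕ)| ≤ 2 * δ₃ / min α r')
    (hd : |((π i : ℕ) : ℝ) - (π j : ℕ)| ≤ 2 * δ₃ / min α r') {d : ℤ}
    (hdec : d = decideComparison (5 * τ)
      (sideSum π (observation F π σ E) δ₄ (block part t) (observation F π σ E) false p i j)
      (sideSum π (observation F π σ E) δ₄ (block part t) (observation F π σ E) true p i j)) :
    (d = if π i < π j then -1 else 1) ∨
      (d = 0 ∧ |((π i : ℕ) : ℝ) - (π j : ℕ)| ≤ 32 * τ / α) := by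
  have hpj : |((π p : ℕ) : ℝ) - (π j : ℕ)| ≤ 2 * (2 * δ₃ / min α r') := by
    have := abs_sub_le ((π p : ℕ) : ℝ) (π i : ℕ) (π j : ℕ)
    linarith
  have hpi' : |((π p : ℕ) : ℝ) - (π i : ℕ)| ≤ 2 * (2 * δ₃ / min α r') := by
    have := abs_nonneg (((π p : ℕ) : ℝ) - (π i : ℕ))
    linarith
  -- by `hpi'` and `hpj` the situation is symmetric in `i` and `j`
  clear hpi
  wlog hlt : π i < π j generalizing i j d
  · have hlt' : π j < π i := lt_of_le_of_ne (not_lt.1 hlt) fun h => hij (π.injective h.symm)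
    have h1 := this hj hi hij.symm (by rwa [abs_sub_comm]) (d := -d)
      (by rw [hdec, ← decideComparison_neg, ← sideSum_swap, ← sideSum_swap]) hpi' hpj hlt'
    rw [if_pos hlt', abs_sub_comm] at h1
    rw [if_neg hlt]
    rcases h1 with h1 | ⟨h1, h2⟩
    · left; linarith
    · right; exact ⟨by linarith, h2⟩
  have hlt' : ((π i : ℕ) : ℝ) < (π j : ℕ) := by exact_mod_cast hlt
  have habs : |((π i : ℕ) : ℝ) - (π j : ℕ)| = (π j : ℕ) - (π i : ℕ) := by
    rw [abs_sub_comm, abs_of_pos (by linarith)]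
  rw [habs] at hd ⊢
  obtain ⟨h1, h2, h3⟩ := hg.sideSum_signal hF hR hβ hr hr' hη hs hp hlt hpi' hpj hd
  have hnoise : ∀ right, |sideSum π (observation F π σ E) δ₄ (block part t) (observation F π σ E)
      right p i j - sideSum π (observation F π σ E) δ₄ (block part t) (signal F π) right p i j| ≤
      3 * τ := by
    intro right
    rw [sideSum_observation, add_sub_cancel_left, abs_mul, abs_of_pos hσ, hτ]
    have := mul_le_mul_of_nonneg_left (hg.comparison t i j p right hij hi hj) hσ.le
    linarith
  rw [if_pos hlt, hdec]
  rcases decideComparison_eq hs.τ_pos (hnoise false) (hnoise true) h1 h2 with h | ⟨h, h4, h5⟩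
  · exact Or.inl h
  · refine Or.inr ⟨h, ?_⟩
    rw [le_div_iff₀ hα, mul_comm]
    by_cases hQ : Real.sqrt n ≤ α * (((π j : ℕ) : ℝ) - (π i : ℕ))
    · rcases h3 hQ with h6 | h6 <;> linarith
    · have := hs.threshold
      linarith

/-! ### The output -/

/-- The re-evaluated comparisons, before the antisymmetric extension. -/
theorem reevaluateComparisons_spec (H : Mat n ℤ) (D A : Mat n ℝ) (σ δ₄ : ℝ)
    (part : Fin n → Fin 3) (hpart : ∀ t, ∃ p, part p = t) :
    ∃ u : Mat n ℤ,
      (∀ i j, (reevaluateComparisons H D A σ δ₄ part).val i j =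
        if i < j then H i j + u i j else if j < i then H i j - u j i else H i j) ∧
      (∀ i j, H i j ≠ 0 → u i j = 0) ∧
      ∀ i j, i < j → H i j = 0 → ∃ t p, part i ≠ t ∧ part j ≠ t ∧ part p = t ∧
        (∀ q, part q = t → D i p ≤ D i q) ∧
        u i j = decideComparison (5 * σ * Real.sqrt (n * Real.log n))
          (∑ k, if part k = t ∧ H i k = 1 ∧ H j k = 1 ∧
            δ₄ ≤ (estimateDistance A (block part t)).val p k then A i k - A j k else 0)
          (∑ k, if part k = t ∧ H i k = -1 ∧ H j k = -1 ∧
            δ₄ ≤ (estimateDistance A (block part t)).val p k then A i k - A j k else 0) := by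
  let Dblock := (tabulate fun t : Fin 3 => do
    let S ← tabulate fun k => do
      let s ← read part k
      scalar (decide (s = t))
    estimateDistance A S).val
  have hDb : ∀ t, Dblock t = (estimateDistance A (block part t)).val := fun t => rfl
  let threshold := (scalar (5 * σ * Real.sqrt (n * Real.log n))).val
  let best : Fin 3 → Fin n → Timed (Option (Fin n × ℝ)) := fun t i =>
    pickBest (fun x y : ℝ => x < y) fun p => do
      let s ← read part p
      branch (s = t)
        (do
          let x ← read₂ D i p
          pure (some x))
        (pure none)
  let prog : Fin 3 → Mat n ℝ → Fin n → Fin n → Option (Fin n × ℝ) → Timed ℤ := fun t Dt i j b =>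
    match b with
    | none => pure 0
    | some (p, _) => do
      let side (v : ℤ) : Timed ℝ := sum fun k => do
        let s ← read part k
        let hik ← read₂ H i k
        let hjk ← read₂ H j k
        let d ← read₂ Dt p k
        branch (s = t ∧ hik = v ∧ hjk = v ∧ δ₄ ≤ d)
          (do
            let x ← read₂ A i k
            let y ← read₂ A j k
            scalar (x - y))
          (pure 0)
      let l ← side 1
      let r ← side (-1)
      scalar (decideComparison threshold l r)
  let Htilde : Timed (Mat n ℤ) := tabulate₂ fun i j => do
    let h ← read₂ H i j
    branch (i < j ∧ h = 0)
      (do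
        let a ← read part i
        let b ← read part j
        let t ← scalar (otherBlock a b)
        let Dt ← read Dblock t
        let best ← pickBest (fun x y : ℝ => x < y) fun p => do
          let s ← read part p
          branch (s = t)
            (do
              let x ← read₂ D i p
              pure (some x))
            (pure none)
        match best with
        | none => pure 0
        | some (p, _) => do
          let side (v : ℤ) : Timed ℝ := sum fun k => do
            let s ← read part k
            let hik ← read₂ H i k
            let hjk ← read₂ H j k
            let d ← read₂ Dt p k
            branch (s = t ∧ hik = v ∧ hjk = v ∧ δ₄ ≤ d)
              (do
                let x ← read₂ A i k
                let y ← read₂ A j k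
                scalar (x - y))
              (pure 0)
          let l ← side 1
          let r ← side (-1)
          scalar (decideComparison threshold l r))
      (pure 0)
  have hval : (reevaluateComparisons H D A σ δ₄ part).val = fun i j =>
      if i < j then H i j + Htilde.val i j else if j < i then H i j - Htilde.val j i else H i j := rfl
  have hu : ∀ i j, Htilde.val i j = if i < j ∧ H i j = 0 then
      (prog (otherBlock (part i) (part j)) (Dblock (otherBlock (part i) (part j))) i j
        (best (otherBlock (part i) (part j)) i).val).val else 0 := by
    intro i j
    let t : Timed (Fin 3) := scalar (otherBlock (read part i).val (read part j).val)
    have h : Htilde.val i j = if i < j ∧ (read₂ H i j).val = 0 then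
      (prog t.val (read Dblock t.val).val i j (best t.val i).val).val else (pure 0 : Timed ℤ).val :=
      rfl
    have ht : t.val = otherBlock (part i) (part j) := rfl
    rw [val_read Dblock, val_read₂ H, ht] at h
    rw [h, val_pure]
  have hprog : ∀ t Dt i j p x, (prog t Dt i j (some (p, x))).val =
      decideComparison (5 * σ * Real.sqrt (n * Real.log n))
          (∑ k, if part k = t ∧ H i k = 1 ∧ H j k = 1 ∧ δ₄ ≤ Dt p k then A i k - A j k else 0)
          (∑ k, if part k = t ∧ H i k = -1 ∧ H j k = -1 ∧ δ₄ ≤ Dt p k then A i k - A j k else 0) :=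
    fun t Dt i j p x => rfl
  have hother : ∀ a b : Fin 3, a ≠ otherBlock a b ∧ b ≠ otherBlock a b := by decide
  clear_value Htilde prog
  refine ⟨Htilde.val, fun i j => by rw [hval], fun i j h => by rw [hu, if_neg fun h' => h h'.2],
    fun i j hij h0 => ?_⟩
  · rw [hu, if_pos ⟨hij, h0⟩]
    refine ⟨otherBlock (part i) (part j), ?_⟩
    have hspec := pickBest_lt_spec (fun p => (do
      let s ← read part p
      branch (s = otherBlock (part i) (part j))
        (do
          let x ← read₂ D i p
          pure (some x))
        (pure none) : Timed (Option ℝ)))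
    have hkey : ∀ p, (do
      let s ← read part p
      branch (s = otherBlock (part i) (part j))
        (do
          let x ← read₂ D i p
          pure (some x))
        (pure none) : Timed (Option ℝ)).val =
        if part p = otherBlock (part i) (part j) then some (D i p) else none := fun p => rfl
    rcases hspec with ⟨-, h⟩ | ⟨p, x, hbest, hpx, hmin, -⟩
    · obtain ⟨p, hp⟩ := hpart (otherBlock (part i) (part j))
      have := h p
      rw [hkey, if_pos hp] at this
      cases this
    · have hb : (best (otherBlock (part i) (part j)) i).val = some (p, x) := hbest
      rw [hkey] at hpx
      split_ifs at hpx with hp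
      cases hpx
      refine ⟨p, (hother _ _).1, (hother _ _).2, hp,
        fun q hq => hmin q _ (by rw [hkey, if_pos hq]), ?_⟩
      rw [hb, hprog _ _ _ _ _ (D i p), hDb]

/-- In the latent order, the comparisons of an index with all others add up to its rank. -/
theorem sum_comparison (π : Equiv.Perm (Fin n)) (i : Fin n) :
    ∑ j, (if j = i then (0 : ℤ) else if π i < π j then -1 else 1) = 2 * (π i : ℕ) + 1 - n := by
  have h1 : ∑ j, (if j = i then (0 : ℤ) else if π i < π j then -1 else 1) =
      ∑ x : Fin n, (if x = π i then (0 : ℤ) else if π i < x then -1 else 1) :=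
    Fintype.sum_equiv π _ _ fun j => by simp [π.injective.eq_iff]
  have h2 : ∀ x : Fin n, (if x = π i then (0 : ℤ) else if π i < x then -1 else 1) =
      (if x < π i then 1 else 0) + ((if x ≤ π i then 1 else 0) - 1) := by
    intro x
    rcases lt_trichotomy x (π i) with h | h | h
    · simp [h.ne, h, h.le, not_lt.2 h.le]
    · simp [h]
    · simp [h.ne', h, not_lt.2 h.le, not_le.2 h]
  rw [h1, Finset.sum_congr rfl fun x _ => h2 x, Finset.sum_add_distrib, Finset.sum_sub_distrib,
    Finset.sum_boole, Finset.sum_boole]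
  have h3 : (Finset.univ.filter fun x : Fin n => x < π i) = Finset.Iio (π i) := by ext; simp
  have h4 : (Finset.univ.filter fun x : Fin n => x ≤ π i) = Finset.Iic (π i) := by ext; simp
  rw [h3, h4, Fin.card_Iio, Fin.card_Iic]
  simp
  ring

/-- If all comparisons are correct, or `0` for indices at latent distance at most `d`, then the
ranks are accurate up to `d`. -/
theorem rank_accurate {Hhat : Mat n ℤ} {d : ℝ} (hd : 0 ≤ d) (hdiag : ∀ i, Hhat i i = 0)
    (hH : ∀ i j, i ≠ j → (Hhat i j = if π i < π j then -1 else 1) ∨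
      (Hhat i j = 0 ∧ |((π i : ℕ) : ℝ) - (π j : ℕ)| ≤ d)) (i : Fin n) :
    |(((∑ j, Hhat i j : ℤ) : ℝ) + n + 1) / 2 - (((π i : ℕ) : ℝ) + 1)| ≤ d := by
  have h1 := sum_comparison π i
  have h2 : ∀ j, |Hhat i j - (if j = i then (0 : ℤ) else if π i < π j then -1 else 1)| ≤
      if j ≠ i ∧ |((π i : ℕ) : ℝ) - (π j : ℕ)| ≤ d then 1 else 0 := by
    intro j
    by_cases hji : j = i
    · subst hji; simp [hdiag]
    · rcases hH i j (Ne.symm hji) with h | ⟨h, h'⟩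
      · rw [if_neg hji, h, sub_self, abs_zero]; split_ifs <;> simp
      · have h1 : j ≠ i ∧ |((π i : ℕ) : ℝ) - (π j : ℕ)| ≤ d := ⟨hji, h'⟩
        rw [if_neg hji, h, if_pos h1]
        by_cases hlt : π i < π j <;> simp [hlt]
  have h3 : |(∑ j, Hhat i j) - (2 * (π i : ℕ) + 1 - n)| ≤
      ((Finset.univ.filter fun j => j ≠ i ∧ |((π i : ℕ) : ℝ) - (π j : ℕ)| ≤ d).card : ℤ) := by
    rw [← h1, ← Finset.sum_sub_distrib, ← Finset.sum_boole]
    exact (Finset.abs_sum_le_sum_abs _ _).trans (Finset.sum_le_sum fun j _ => h2 j)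
  have h4 : (Finset.univ.filter fun j => j ≠ i ∧ |((π i : ℕ) : ℝ) - (π j : ℕ)| ≤ d).card ≤
      2 * ⌊d⌋₊ := by
    have h5 : (Finset.univ.filter fun j => j ≠ i ∧ |((π i : ℕ) : ℝ) - (π j : ℕ)| ≤ d).card ≤
        ((Finset.Icc ((π i : ℕ) - ⌊d⌋₊ : ℤ) ((π i : ℕ) + ⌊d⌋₊)).erase (π i : ℕ)).card := by
      refine Finset.card_le_card_of_injOn (fun j => ((π j : ℕ) : ℤ)) (fun j hj => ?_)
        fun j _ k _ h => π.injective (Fin.ext (by simpa using h))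
      simp only [Finset.coe_filter, Finset.mem_univ, true_and, Set.mem_ofPred_eq] at hj
      simp only [Finset.coe_erase, Finset.coe_Icc, Set.mem_sdiff, Set.mem_Icc, Set.mem_singleton_iff]
      have h6 : (((π i : ℕ) : ℤ) - (π j : ℕ)).natAbs ≤ ⌊d⌋₊ := by
        refine Nat.le_floor ?_
        rw [Nat.cast_natAbs]
        push_cast
        exact hj.2
      refine ⟨⟨by omega, by omega⟩, fun h => hj.1 (π.injective (Fin.ext (by exact_mod_cast h)))⟩
    refine h5.trans ?_
    rw [Finset.card_erase_of_mem (by simp), Int.card_Icc]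
    omega
  have h5 : (⌊d⌋₊ : ℝ) ≤ d := Nat.floor_le hd
  have h6 : |((∑ j, Hhat i j : ℤ) : ℝ) - (2 * (π i : ℕ) + 1 - n)| ≤ 2 * d := by
    have h7 : |((∑ j, Hhat i j : ℤ) : ℝ) - (2 * (π i : ℕ) + 1 - n)| ≤
      ((Finset.univ.filter fun j => j ≠ i ∧ |((π i : ℕ) : ℝ) - (π j : ℕ)| ≤ d).card : ℝ) := by
      exact_mod_cast h3
    have h8 : ((Finset.univ.filter fun j =>
      j ≠ i ∧ |((π i : ℕ) : ℝ) - (π j : ℕ)| ≤ d).card : ℝ) ≤ 2 * (⌊d⌋₊ : ℝ) := by exact_mod_cast h4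
    linarith
  have h7 := abs_le.1 h6
  rw [abs_le]; constructor <;> linarith

/-- Success of SABRE on the good event, up to the choice of the direction of the latent order. -/
theorem IsGood.rank_accurate (hg : IsGood F π σ δ₄ η E part)
    (hF : IsAverageLipschitz α β r r' F) (hR : IsRobinson F) (hα : 0 < α)
    (hβ : 0 < β) (hr : 0 < r) (hr' : 0 < r') (hη : 0 ≤ η) (hσ : 0 < σ)
    (hτ : τ = σ * Real.sqrt (n * Real.log n))
    (hs : IsScale n (min α r') (max β (1 / r)) r η τ δ₁ δ₂ δ₃ δ₄)
    (hH : IsPartialComparison π (2 * δ₃ / min α r') (aggregateBisections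
      (estimateDistance (observation F π σ E) fun _ => true).val δ₁ δ₂ δ₃).val) (i : Fin n) :
    |(sabre (observation F π σ E) σ δ₁ δ₂ δ₃ δ₄ part).val i - (((π i : ℕ) : ℝ) + 1)| ≤
      32 * τ / α := by
  set A := observation F π σ E with hA
  set D := (estimateDistance A fun _ => true).val with hD
  set H := (aggregateBisections D δ₁ δ₂ δ₃).val with hH'
  have hval : (sabre A σ δ₁ δ₂ δ₃ δ₄ part).val i =
      (((∑ j, (reevaluateComparisons H D A σ δ₄ part).val i j : ℤ) : ℝ) + n + 1) / 2 := rfl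
  have hwin : ∀ i t, ∃ p, part p = t ∧ p ≠ i ∧ |((π p : ℕ) : ℝ) - (π i : ℕ)| ≤ Real.sqrt n := by
    intro i t
    have h1 := sqrt_le_sum_window π i hs.sqrt_ge
    have h2 := hg.sample t (.inl i) h1
    simp only [weights] at h2
    have h3 := hs.sqrt_ge
    obtain ⟨k, k', _, hk⟩ := exists_two_of_window (π := π) (S := block part t) (i := i)
      (by linarith)
    obtain ⟨a1, a2, a3⟩ := hk k (Or.inl rfl)
    exact ⟨k, by simpa [block] using a1, a2, a3⟩
  obtain ⟨u, hu1, hu2, hu3⟩ := reevaluateComparisons_spec H D A σ δ₄ part fun t =>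
    (hwin i t).imp fun p hp => hp.1
  have ha0 := hs.a_pos
  have hb0 := hs.b_pos
  have hone : 1 ≤ 2 * δ₃ / min α r' := hs.one_le.trans (by have := hs.le₂; gcongr)
  have hd0 : 0 ≤ 32 * τ / α := by have := hs.τ_pos; positivity
  -- `H` compares `i` and `j` correctly with all indices that are far from `p`, so the sets of
  -- summation used by the algorithm are those of `sideSum`, which do not depend on `H`
  have hside : ∀ t i j p, part i ≠ t → part j ≠ t → part p = t → i ≠ j →
      |((π p : ℕ) : ℝ) - (π i : ℕ)| ≤ 2 * δ₃ / min α r' →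
      |((π i : ℕ) : ℝ) - (π j : ℕ)| ≤ 2 * δ₃ / min α r' → ∀ (v : ℤ) (right : Bool),
      v = (if right = true then -1 else 1) →
      (∑ k, if part k = t ∧ H i k = v ∧ H j k = v ∧ δ₄ ≤ (estimateDistance A (block part t)).val p k
        then A i k - A j k else 0) = sideSum π A δ₄ (block part t) A right p i j := by
    intro t i j p hi hj hp hij hpi hd v right hv
    unfold sideSum
    refine Finset.sum_congr rfl fun k _ => ?_
    by_cases hk : part k = t ∧ δ₄ ≤ (estimateDistance A (block part t)).val p k
    · obtain ⟨hk1, hk2⟩ := hk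
      have hfar := hg.far_of_le hF hβ hr hr' hη hs hp hk1 hk2
      generalize 2 * δ₃ / min α r' = ρ at *
      have hpi' := abs_le.1 hpi
      have hd' := abs_le.1 hd
      have hcmp : ∀ x, x ≠ k → |((π p : ℕ) : ℝ) - (π x : ℕ)| ≤ 2 * ρ →
          (H x k = v ↔ onSide π right p k = true) := by
        intro x hxk hx
        have hx' := abs_le.1 hx
        have h0 : H x k ≠ 0 := by
          refine hH.complete x k ?_
          have := abs_sub_le ((π p : ℕ) : ℝ) (π x : ℕ) (π k : ℕ)
          linarith
        rw [hH.correct x k hxk h0, hv]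
        have hiff : π x < π k ↔ π p < π k := by
          rw [Fin.lt_def, Fin.lt_def, ← Nat.cast_lt (α := ℝ), ← Nat.cast_lt (α := ℝ)]
          rcases le_abs.1 hfar with h | h
          · exact ⟨fun _ => by linarith, fun _ => by linarith⟩
          · exact ⟨fun _ => by linarith, fun _ => by linarith⟩
        have hne : π p ≠ π k := by
          intro h
          rw [h, sub_self, abs_zero] at hfar
          linarith
        unfold onSide
        rcases lt_or_gt_of_ne hne with h | h
        · rw [if_pos (hiff.2 h)]
          cases right <;> simp [h, h.le]
        · rw [if_neg fun h' => absurd (hiff.1 h') (not_lt.2 h.le)]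
          cases right <;> simp [h, h.le]
      have h1 := hcmp i (by rintro rfl; exact hi hk1) (by linarith [abs_nonneg (((π p : ℕ) : ℝ) - (π i : ℕ))])
      have h2 := hcmp j (by rintro rfl; exact hj hk1) (by
        have := abs_sub_le ((π p : ℕ) : ℝ) (π i : ℕ) (π j : ℕ)
        linarith)
      by_cases hs : onSide π right p k = true
      · simp [block, hk1, hk2, h1.2 hs, h2.2 hs, hs]
      · have h3 : ¬ H i k = v := fun h => hs (h1.1 h)
        simp [block, hk1, hk2, h3, hs]
    · rw [if_neg fun h => hk ⟨h.1, h.2.2.2⟩, if_neg fun h => hk ⟨by simpa [block] using h.1, h.2.1⟩]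
  have hucorrect : ∀ i j, i < j → H i j = 0 → (u i j = if π i < π j then -1 else 1) ∨
      (u i j = 0 ∧ |((π i : ℕ) : ℝ) - (π j : ℕ)| ≤ 32 * τ / α) := by
    intro i j hij h0
    obtain ⟨t, p, hi, hj, hp, hmin, hu⟩ := hu3 i j hij h0
    have hd : |((π i : ℕ) : ℝ) - (π j : ℕ)| ≤ 2 * δ₃ / min α r' := by
      by_contra h
      exact hH.complete i j (not_le.1 h).le h0
    have hpi : |((π p : ℕ) : ℝ) - (π i : ℕ)| ≤ 2 * δ₃ / min α r' := by
      obtain ⟨q, hq, hqi, hqd⟩ := hwin i t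
      have hpi : i ≠ p := by rintro rfl; exact hi hp
      have h1 := abs_le.1 (hg.accurate hF hβ hr hr' hη hs (S := fun _ => true) (Or.inl rfl)
        (i := i) (j := p) rfl rfl hpi)
      have h2 := abs_le.1 (hg.accurate hF hβ hr hr' hη hs (S := fun _ => true) (Or.inl rfl)
        (i := i) (j := q) rfl rfl hqi.symm)
      have h3 := (hF.distance_bounds hr hr' (π i) (π p)).1
      have h4 := (hF.distance_bounds hr hr' (π i) (π q)).2
      rw [← latentDistance_univ] at h3 h4
      have h5 := hmin q hq
      rw [abs_sub_comm] at hqd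
      have h6 := mul_le_mul_of_nonneg_left hqd hb0.le
      have h7 := hs.window
      have h8 := hs.le₁
      have h9 := hs.le₂
      have h10 := hs.δ₁_pos
      rw [abs_sub_comm, le_div_iff₀ ha0, mul_comm]
      linarith
    refine hg.decide_correct hF hR hα hβ hr hr' hη hσ hτ hs hp hi hj hij.ne hpi hd ?_
    rw [hu, hside t i j p hi hj hp hij.ne hpi hd 1 false (by simp),
      hside t i j p hi hj hp hij.ne hpi hd (-1) true (by simp), hτ, mul_assoc]
  rw [hval]
  refine Seriation.rank_accurate hd0 (fun i => ?_) (fun i j hij => ?_) i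
  · rw [hu1]; simp [hH.diag]
  · rw [hu1]
    by_cases h0 : H i j = 0
    · rcases lt_or_gt_of_ne hij with h | h
      · rw [if_pos h, h0, zero_add]
        exact hucorrect i j h h0
      · rw [if_neg (not_lt.2 h.le), if_pos h, h0, zero_sub]
        have h0' : H j i = 0 := hH.symm i j h0
        have hne : π j ≠ π i := fun h => hij (π.injective h.symm)
        rcases hucorrect j i h h0' with h1 | ⟨h1, h2⟩
        · left
          rw [h1]
          rcases lt_or_gt_of_ne hne with h | h
          · simp [h, not_lt.2 h.le]
          · simp [h, not_lt.2 h.le]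
        · right
          rw [abs_sub_comm]
          exact ⟨by rw [h1, neg_zero], h2⟩
    · left
      have h1 : u i j = 0 := hu2 i j h0
      have h2 : u j i = 0 := hu2 j i fun h => h0 (hH.symm j i h)
      rw [h1, h2, add_zero, sub_zero, ite_self, ite_self]
      exact hH.correct i j hij h0

end Good

/-! ### The loss on the good event -/

theorem observation_reversed (F : Mat n ℝ) (π : Equiv.Perm (Fin n)) (σ : ℝ) (E : Mat n ℝ) :
    observation (reversedMatrix F) (reversed π) σ E = observation F π σ E := by
  have h : ∀ F (π : Equiv.Perm (Fin n)),
      observation F π σ E = fun i j => signal F π i j + σ * E i j := fun _ _ => rfl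
  rw [h, h, signal_reversed]

/-- On the good event for the latent order and for its reversal, the loss is small. -/
theorem IsGood.maxLoss_le {α β r r' σ η τ δ₁ δ₂ δ₃ δ₄ : ℝ} {F E : Mat n ℝ}
    {π : Equiv.Perm (Fin n)} {part : Fin n → Fin 3} (hg : IsGood F π σ δ₄ η E part)
    (hg' : IsGood (reversedMatrix F) (reversed π) σ δ₄ η E part)
    (hF : IsAverageLipschitz α β r r' F) (hR : IsRobinson F) (hα : 0 < α)
    (hβ : 0 < β) (hr : 0 < r) (hr' : 0 < r') (hη : 0 ≤ η) (hσ : 0 < σ)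
    (hτ : τ = σ * Real.sqrt (n * Real.log n))
    (hs : IsScale n (min α r') (max β (1 / r)) r η τ δ₁ δ₂ δ₃ δ₄) :
    maxLoss (sabre (observation F π σ E) σ δ₁ δ₂ δ₃ δ₄ part).val π ≤
      40 * (σ / α) * Real.sqrt (Real.log n / n) := by
  have hn : (0 : ℝ) < n := by
    have := hs.sqrt_ge
    by_contra h
    rw [Real.sqrt_eq_zero_of_nonpos (not_lt.1 h)] at this
    linarith
  have hn' : 0 < n := by exact_mod_cast hn
  have : Nonempty (Fin n) := ⟨⟨0, hn'⟩⟩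
  have hsqrt : Real.sqrt (Real.log n / n) = Real.sqrt (n * Real.log n) / n := by
    rw [show Real.log n / n = n * Real.log n / (n : ℝ) ^ 2 by field_simp,
      Real.sqrt_div' _ (by positivity), Real.sqrt_sq hn.le]
  have hfin : (1 / (n : ℝ)) * (32 * τ / α) ≤ 40 * (σ / α) * Real.sqrt (Real.log n / n) := by
    rw [hsqrt, hτ]
    have h1 : 0 ≤ σ / α * (Real.sqrt (n * Real.log n) / n) := by positivity
    calc (1 / (n : ℝ)) * (32 * (σ * Real.sqrt (n * Real.log n)) / α)
        = 32 * (σ / α * (Real.sqrt (n * Real.log n) / n)) := by field_simp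
      _ ≤ 40 * (σ / α * (Real.sqrt (n * Real.log n) / n)) := by linarith
      _ = _ := by ring
  refine le_trans ?_ hfin
  unfold maxLoss
  refine mul_le_mul_of_nonneg_left ?_ (by positivity)
  obtain ⟨π', hπ', hH⟩ := (hg.resolves hF hβ hr hr' hη hs).aggregateBisections
  rcases hπ' with rfl | rfl
  · exact (min_le_left _ _).trans (ciSup_le fun i =>
      hg.rank_accurate hF hR hα hβ hr hr' hη hσ hτ hs hH i)
  · refine (min_le_right _ _).trans (ciSup_le fun i => ?_)
    rw [← observation_reversed] at hH ⊢
    have h1 := hg'.rank_accurate hF.reversed hR.reversed hα hβ hr hr' hη hσ hτ hs hH i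
    rw [reversed_coe] at h1
    rwa [show ((n : ℝ) - (π i : ℕ)) = n - 1 - (π i : ℕ) + 1 by ring]

/-! ### Large dimensions -/

set_option maxHeartbeats 600000 in
/-- The relations between the parameters, with `N = n^{1/4}` and `L = log n`, so that
`δ_k = N³ L^k`, and with a constant `K` that is large compared with all other constants. -/
theorem isScale_of_le {a b r C σ K N L : ℝ} (ha : 0 < a) (hb : 0 < b) (hr : 0 < r) (hC : 0 ≤ C)
    (hσ : 0 < σ) (hN : N = (n : ℝ) ^ (1 / 4 : ℝ)) (hL : L = Real.log n)
    (hK1 : 1 ≤ K) (hK2 : 192 * C + 64 * b ≤ K) (hK3 : 16 * b ≤ a * K) (hK4 : a ≤ K)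
    (hK5 : 400 ≤ a * K) (hK6 : 2 ≤ a * r * K) (hK7 : 4096 ≤ a ^ 2 * K)
    (hK8 : 1 ≤ (32 * σ) ^ 2 * K) (hLK : K ≤ L) (hNL : K * L ^ 4 ≤ N) (hN12 : 12 ≤ N) :
    IsScale n a b r (C * (Real.sqrt n * Real.log n)) (σ * Real.sqrt (n * Real.log n))
      (tuning n 1) (tuning n 2) (tuning n 3) (tuning n 4) := by
  have hn0 : (0 : ℝ) ≤ n := Nat.cast_nonneg n
  have hN0 : 0 < N := by linarith
  have hn4 : (n : ℝ) = N ^ 4 := by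
    rw [hN, ← Real.rpow_natCast, ← Real.rpow_mul hn0]; norm_num
  have hn3 : (n : ℝ) ^ (3 / 4 : ℝ) = N ^ 3 := by
    rw [hN, ← Real.rpow_natCast, ← Real.rpow_mul hn0]; norm_num
  have hsq : Real.sqrt n = N ^ 2 := by
    rw [hn4, show N ^ 4 = (N ^ 2) ^ 2 by ring, Real.sqrt_sq (by positivity)]
  have ht1 : tuning n 1 = N ^ 3 * L := by simp only [tuning]; rw [hn3, hL]
  have ht2 : tuning n 2 = N ^ 3 * L ^ 2 := by
    rw [tuning, ht1, hL]; ring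
  have ht3 : tuning n 3 = N ^ 3 * L ^ 3 := by
    rw [tuning, ht2, hL]; ring
  have ht4 : tuning n 4 = N ^ 3 * L ^ 4 := by
    rw [tuning, ht3, hL]; ring
  have hL1 : 1 ≤ L := hK1.trans hLK
  have hL0 : 0 < L := by linarith
  have hN1 : 1 ≤ N := by linarith
  have hN3 : 1 ≤ N ^ 3 := one_le_pow₀ hN1
  have hL12 : L ≤ L ^ 2 := le_self_pow₀ hL1 two_ne_zero
  have hL23 : L ^ 2 ≤ L ^ 3 := pow_le_pow_right₀ hL1 (by norm_num)
  have hL34 : L ^ 3 ≤ L ^ 4 := pow_le_pow_right₀ hL1 (by norm_num)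
  -- everything follows from `K L ^ 4 ≤ N`
  have hbig : ∀ c x, 0 ≤ c → x ≤ c * K → x * (N ^ 3 * L ^ 4) ≤ c * n := by
    intro c x hc hx
    rw [hn4]
    calc x * (N ^ 3 * L ^ 4) ≤ c * K * (N ^ 3 * L ^ 4) :=
          mul_le_mul_of_nonneg_right hx (by positivity)
      _ = c * N ^ 3 * (K * L ^ 4) := by ring
      _ ≤ c * N ^ 3 * N := mul_le_mul_of_nonneg_left hNL (by positivity)
      _ = c * N ^ 4 := by ring
  have hgap : ∀ m : ℕ, 16 * b * (N ^ 3 * L ^ m) ≤ a * (N ^ 3 * L ^ (m + 1)) := by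
    intro m
    have h1 : 16 * b ≤ a * L := hK3.trans (mul_le_mul_of_nonneg_left hLK ha.le)
    calc 16 * b * (N ^ 3 * L ^ m) ≤ a * L * (N ^ 3 * L ^ m) :=
          mul_le_mul_of_nonneg_right h1 (by positivity)
      _ = _ := by ring
  have h3 : 0 ≤ N ^ 3 := by positivity
  rw [ht1, ht2, ht3, ht4, hsq, ← hL]
  constructor
  · exact ha
  · exact hb
  · positivity
  · rw [hsq]; exact hN12.trans (le_self_pow₀ hN1 two_ne_zero)
  · rw [hsq, hn4, Real.sqrt_le_left (by positivity)]
    have h1 : (192 * C + 64 * b) * L ≤ L * L :=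
      mul_le_mul_of_nonneg_right (hK2.trans hLK) hL0.le
    have h2 : b * 1 ≤ b * L := mul_le_mul_of_nonneg_left hL1 hb.le
    have h4 : 192 * C * L + 64 * b ≤ L ^ 2 := by linarith
    have h5 := mul_le_mul_of_nonneg_left h4 (by positivity : 0 ≤ N ^ 6)
    linarith
  · rw [hsq]
    have h1 : 4 * b ≤ L := by linarith
    have h2 : N ^ 2 ≤ N ^ 3 := pow_le_pow_right₀ hN1 (by norm_num)
    calc b * N ^ 2 ≤ b * N ^ 3 := mul_le_mul_of_nonneg_left h2 hb.le
      _ ≤ L / 4 * N ^ 3 := mul_le_mul_of_nonneg_right (by linarith) h3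
      _ = _ := by ring
  · gcongr
  · gcongr
  · gcongr
  · simpa using hgap 1
  · exact hgap 2
  · exact hgap 3
  · rw [le_div_iff₀ ha]
    have h1 : 1 * L ^ 2 ≤ N ^ 3 * L ^ 2 := mul_le_mul_of_nonneg_right hN3 (by positivity)
    linarith
  · rw [← mul_div_assoc, div_le_iff₀ ha]
    have := hbig a 400 ha.le hK5
    have h4 := mul_le_mul_of_nonneg_left hL34 h3
    linarith
  · rw [div_le_iff₀ ha]
    have := hbig (a * r) 2 (by positivity) hK6
    have h4 := mul_le_mul_of_nonneg_left hL34 h3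
    linarith
  · have := hbig a 256 ha.le (by linarith)
    rw [le_div_iff₀ (by norm_num)]
    have h4 : N ^ 3 * L ≤ N ^ 3 * L ^ 4 := mul_le_mul_of_nonneg_left (by linarith) h3
    linarith
  · rw [hsq, hn4, le_div_iff₀ (by norm_num)]
    have h1 : K ≤ N := (le_mul_of_one_le_right (by linarith) (one_le_pow₀ hL1)).trans hNL
    have h2 : K ≤ N ^ 2 := h1.trans (le_self_pow₀ hN1 two_ne_zero)
    have h3 : 4096 ≤ a ^ 2 * N ^ 2 := hK7.trans (mul_le_mul_of_nonneg_left h2 (by positivity))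
    have h4 := mul_le_mul_of_nonneg_right h3 (by positivity : 0 ≤ N ^ 2)
    linarith
  · have : 0 < (n : ℝ) := by rw [hn4]; positivity
    positivity
  · rw [hsq, Real.sqrt_mul hn0, hsq]
    have h1 : 1 ≤ 32 * σ * Real.sqrt L := by
      have h2 : 1 ≤ (32 * σ) ^ 2 * L := hK8.trans (mul_le_mul_of_nonneg_left hLK (by positivity))
      have h3 : (32 * σ * Real.sqrt L) ^ 2 = (32 * σ) ^ 2 * L := by
        rw [mul_pow, Real.sq_sqrt hL0.le]
      rw [← h3] at h2
      exact (one_le_sq_iff₀ (by positivity)).1 h2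
    have h2 := mul_le_mul_of_nonneg_left h1 (by positivity : 0 ≤ N ^ 2)
    linarith

theorem eventually_isScale {a b r C σ : ℝ} (ha : 0 < a) (hb : 0 < b) (hr : 0 < r) (hC : 0 ≤ C)
    (hσ : 0 < σ) : ∀ᶠ n : ℕ in Filter.atTop,
      IsScale n a b r (C * (Real.sqrt n * Real.log n)) (σ * Real.sqrt (n * Real.log n))
        (tuning n 1) (tuning n 2) (tuning n 3) (tuning n 4) := by
  obtain ⟨K, hK⟩ : ∃ K : ℝ, 1 ≤ K ∧ 192 * C + 64 * b ≤ K ∧ 16 * b ≤ a * K ∧ a ≤ K ∧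
      400 ≤ a * K ∧ 2 ≤ a * r * K ∧ 4096 ≤ a ^ 2 * K ∧ 1 ≤ (32 * σ) ^ 2 * K := by
    have hlin : ∀ c x : ℝ, 0 < c → ∀ᶠ K : ℝ in Filter.atTop, x ≤ c * K := by
      intro c x hc
      filter_upwards [Filter.eventually_ge_atTop (x / c)] with K hK
      rwa [div_le_iff₀' hc] at hK
    have h := (Filter.eventually_ge_atTop (1 : ℝ)).and
      ((Filter.eventually_ge_atTop (192 * C + 64 * b)).and ((hlin a (16 * b) ha).and
      ((Filter.eventually_ge_atTop a).and ((hlin a 400 ha).and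
      ((hlin (a * r) 2 (by positivity)).and
      ((hlin (a ^ 2) 4096 (by positivity)).and (hlin ((32 * σ) ^ 2) 1 (by positivity))))))))
    exact h.exists
  obtain ⟨h1, h2, h3, h4, h5, h6, h7, h8⟩ := hK
  have hlog : Filter.Tendsto (fun n : ℕ => Real.log n) Filter.atTop Filter.atTop :=
    Real.tendsto_log_atTop.comp tendsto_natCast_atTop_atTop
  have hrpow : Filter.Tendsto (fun n : ℕ => (n : ℝ) ^ (1 / 4 : ℝ)) Filter.atTop Filter.atTop :=
    (tendsto_rpow_atTop (by norm_num)).comp tendsto_natCast_atTop_atTop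
  have hlittle : ∀ᶠ n : ℕ in Filter.atTop, K * Real.log n ^ 4 ≤ (n : ℝ) ^ (1 / 4 : ℝ) := by
    have h := (isLittleO_log_rpow_rpow_atTop (s := 1 / 4) 4 (by norm_num)).bound
      (show 0 < 1 / K by positivity)
    filter_upwards [tendsto_natCast_atTop_atTop.eventually h, hlog.eventually_ge_atTop 0]
      with n hn hl
    rw [Real.norm_of_nonneg (by positivity), Real.norm_of_nonneg (by positivity),
      div_mul_eq_mul_div, one_mul, le_div_iff₀' (by positivity)] at hn
    exact_mod_cast hn
  filter_upwards [hlog.eventually_ge_atTop K, hlittle, hrpow.eventually_ge_atTop 12]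
    with n a1 a2 a3
  exact isScale_of_le ha hb hr hC hσ rfl rfl h1 h2 h3 h4 h5 h6 h7 h8 a1 a2 a3

/-! ### Tails of linear forms in the noise -/

/-- A bound for the probability of an event that is determined by two independent random variables,
conditionally on one of them. -/
theorem measure_prod_mem_le {Ω α β : Type*} [MeasurableSpace Ω] [MeasurableSpace α]
    [MeasurableSpace β] {μ : Measure Ω} [IsProbabilityMeasure μ] {U : Ω → α} {V : Ω → β}
    (h : IndepFun U V μ) (hU : Measurable U) (hV : Measurable V) {B : Set (α × β)}
    (hB : MeasurableSet B) {q : ENNReal} (hq : ∀ u, μ {ω | (u, V ω) ∈ B} ≤ q) :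
    μ {ω | (U ω, V ω) ∈ B} ≤ q := by
  have h1 : μ {ω | (U ω, V ω) ∈ B} = (μ.map fun ω => (U ω, V ω)) B :=
    (Measure.map_apply (hU.prodMk hV) hB).symm
  have := Measure.isProbabilityMeasure_map (μ := μ) hU.aemeasurable
  have := Measure.isProbabilityMeasure_map (μ := μ) hV.aemeasurable
  rw [h1, h.map_prod_eq_prod_map_map hU.aemeasurable hV.aemeasurable, Measure.prod_apply hB]
  calc ∫⁻ u, (μ.map V) (Prod.mk u ⁻¹' B) ∂(μ.map U)
      ≤ ∫⁻ _, q ∂(μ.map U) := by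
        refine lintegral_mono fun u => ?_
        rw [Measure.map_apply hV (measurable_prodMk_left hB)]
        exact hq u
    _ = q := by simp

/-- Two-sided tail bound for a linear form in independent sub-Gaussian variables, picked out of a family
by an injection `e`. If `V = 0`, the right side is `2`. -/
theorem measure_weighted_sum_le {Ω ι κ : Type*} [MeasurableSpace Ω] {μ : Measure Ω}
    {X : ι → Ω → ℝ} (hX : iIndepFun X μ) (hs : ∀ i, HasSubgaussianMGF (X i) 1 μ)
    {s : Finset κ} {e : κ → ι} (he : Set.InjOn e s) {c : κ → ℝ} {V t : ℝ}
    (hc : ∑ k ∈ s, c k ^ 2 ≤ V) (ht : 0 ≤ t) :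
    μ {ω | t < |∑ k ∈ s, c k * X (e k) ω|} ≤ ENNReal.ofReal (2 * Real.exp (-t ^ 2 / (2 * V))) := by
  have := hX.isProbabilityMeasure
  have key : ∀ d : κ → ℝ, ∑ k ∈ s, d k ^ 2 ≤ V →
      μ.real {ω | t ≤ ∑ k ∈ s, d k * X (e k) ω} ≤ Real.exp (-t ^ 2 / (2 * V)) := by
    intro d hd
    have hi : iIndepFun (fun (k : s) ω => d k * X (e k) ω) μ := by
      have h1 : iIndepFun (fun (k : s) => X (e k)) μ := hX.precomp (g := fun k : s => e k)
        fun a b hab => Subtype.ext (he a.2 b.2 hab)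
      exact h1.comp (fun k x => d k * x) fun k => by fun_prop
    have hsub : ∀ k ∈ (Finset.univ : Finset s), HasSubgaussianMGF (fun ω => d k * X (e k) ω)
        ((fun k : s => NNReal.mk (d k ^ 2) (sq_nonneg _)) k) μ := fun k _ => by
      have h := (hs (e k)).const_mul (d k)
      convert h using 1
      exact NNReal.eq (mul_one (d k ^ 2)).symm
    have h2 := HasSubgaussianMGF.measure_sum_ge_le_of_iIndepFun hi hsub ht
    have h3 : ∀ ω, ∑ k ∈ (Finset.univ : Finset s), d k * X (e k) ω = ∑ k ∈ s, d k * X (e k) ω :=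
      fun ω => Finset.sum_coe_sort s fun k => d k * X (e k) ω
    simp only [h3] at h2
    have h4 : ((∑ k ∈ (Finset.univ : Finset s), NNReal.mk (d k ^ 2) (sq_nonneg _) : NNReal) : ℝ)
        = ∑ k ∈ s, d k ^ 2 := by
      rw [NNReal.coe_sum]
      exact Finset.sum_coe_sort s fun k => d k ^ 2
    by_cases h5 : ∑ k ∈ s, d k ^ 2 = 0
    · have h6 : ∀ ω, ∑ k ∈ s, d k * X (e k) ω = 0 := by
        intro ω
        refine Finset.sum_eq_zero fun k hk => ?_
        have := (Finset.sum_eq_zero_iff_of_nonneg fun k _ => sq_nonneg (d k)).1 h5 k hk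
        simp [pow_eq_zero_iff] at this
        simp [this]
      rcases ht.eq_or_lt with rfl | ht'
      · simp
      · simp [h6, ht'.not_ge, Real.exp_nonneg]
    · have h6 : 0 < ∑ k ∈ s, d k ^ 2 :=
        lt_of_le_of_ne (Finset.sum_nonneg fun k _ => sq_nonneg _) (Ne.symm h5)
      refine h2.trans ?_
      rw [h4]
      refine Real.exp_le_exp.2 ?_
      rw [neg_div, neg_div]
      gcongr
  have hneg := key (fun k => -c k) (by simpa using hc)
  have hpos := key c hc
  have hsub : {ω | t < |∑ k ∈ s, c k * X (e k) ω|} ⊆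
      {ω | t ≤ ∑ k ∈ s, c k * X (e k) ω} ∪ {ω | t ≤ ∑ k ∈ s, -c k * X (e k) ω} := by
    intro ω hω
    simp only [Set.mem_ofPred_eq, Set.mem_union, neg_mul, Finset.sum_neg_distrib] at hω ⊢
    rcases lt_abs.1 hω with h | h
    · exact Or.inl h.le
    · exact Or.inr h.le
  have h7 : μ.real {ω | t < |∑ k ∈ s, c k * X (e k) ω|} ≤ 2 * Real.exp (-t ^ 2 / (2 * V)) := by
    refine (measureReal_mono hsub).trans ((measureReal_union_le _ _).trans ?_)
    linarith
  rw [← ENNReal.ofReal_toReal (measure_ne_top μ _)]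
  exact ENNReal.ofReal_le_ofReal h7

/-- The pair `{i, j}`, as an index of an entry on or above the diagonal. -/
def sortedPair (i j : Fin n) : {p : Fin n × Fin n // p.1 ≤ p.2} :=
  ⟨(min i j, max i j), min_le_max⟩

theorem IsNoise.eq_sortedPair {Ω : Type*} [MeasurableSpace Ω] {μ : Measure Ω} {E : Ω → Mat n ℝ}
    (hE : IsNoise E μ) (ω : Ω) (i j : Fin n) :
    E ω i j = E ω (sortedPair i j).1.1 (sortedPair i j).1.2 := by
  rcases le_total i j with h | h
  · simp [sortedPair, h]
  · simp [sortedPair, h, hE.symm ω i j]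

theorem sortedPair_eq_iff {i j k l : Fin n} :
    sortedPair i j = sortedPair k l ↔ (i = k ∧ j = l) ∨ (i = l ∧ j = k) := by
  simp only [sortedPair, Subtype.mk.injEq, Prod.mk.injEq, min_def, max_def]
  split_ifs <;> grind

/-- A linear form in noise entries whose coefficients depend only on other noise entries has, on
the event that the sum of the squared coefficients is at most `V`, Gaussian tails of variance
`V`: condition on the entries that determine the coefficients. -/
theorem IsNoise.measure_weighted_sum_le {Ω κ : Type*} [MeasurableSpace Ω] {μ : Measure Ω}
    [IsProbabilityMeasure μ] {E : Ω → Mat n ℝ} (hE : IsNoise E μ) (P : Fin n → Fin n → Prop)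
    {s : Finset κ} {e : κ → Fin n × Fin n}
    (he : Set.InjOn (fun k => sortedPair (e k).1 (e k).2) s)
    (heP : ∀ k ∈ s, ¬ P (e k).1 (e k).2 ∧ ¬ P (e k).2 (e k).1)
    {c : Mat n ℝ → κ → ℝ} (hcm : ∀ k, Measurable fun x => c x k)
    (hcP : ∀ x y : Mat n ℝ, (∀ i j, P i j → x i j = y i j) → c x = c y)
    {V t : ℝ} (ht : 0 ≤ t) :
    μ {ω | ∑ k ∈ s, c (E ω) k ^ 2 ≤ V ∧ t < |∑ k ∈ s, c (E ω) k * E ω (e k).1 (e k).2|} ≤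
      ENNReal.ofReal (2 * Real.exp (-t ^ 2 / (2 * V))) := by
  classical
  set X : {p : Fin n × Fin n // p.1 ≤ p.2} → Ω → ℝ := fun p ω => E ω p.1.1 p.1.2 with hXdef
  have hm : ∀ i j, Measurable fun ω => E ω i j := fun i j =>
    (measurable_pi_apply j).comp ((measurable_pi_apply i).comp hE.measurable)
  have hXm : ∀ p, Measurable (X p) := fun p => hm _ _
  set T : Finset {p : Fin n × Fin n // p.1 ≤ p.2} :=
    Finset.univ.filter fun p => P p.1.1 p.1.2 ∨ P p.1.2 p.1.1 with hT
  set T' : Finset {p : Fin n × Fin n // p.1 ≤ p.2} :=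
    s.image fun k => sortedPair (e k).1 (e k).2 with hT'
  have hPT : ∀ i j, sortedPair i j ∈ T ↔ P i j ∨ P j i := by
    intro i j
    rcases le_total i j with h | h <;> simp [hT, sortedPair, h, or_comm]
  have hdisj : Disjoint T T' := by
    rw [Finset.disjoint_right]
    intro p hp
    obtain ⟨k, hk, rfl⟩ := Finset.mem_image.1 hp
    rw [hPT]
    have := heP k hk
    tauto
  have hind := iIndepFun.indepFun_finset T T' hdisj hE.indep hXm
  set mat : (T → ℝ) → Mat n ℝ := fun u i j =>
    if h : sortedPair i j ∈ T then u ⟨sortedPair i j, h⟩ else 0 with hmat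
  have hmatm : Measurable mat := by
    refine measurable_pi_lambda _ fun i => measurable_pi_lambda _ fun j => ?_
    by_cases h : sortedPair i j ∈ T
    · simp only [hmat, h, dif_pos]; exact measurable_pi_apply _
    · simp only [hmat, h, dif_neg, not_false_eq_true]; exact measurable_const
  have hcmat : ∀ ω, c (E ω) = c (mat fun p => X p ω) := by
    intro ω
    refine hcP _ _ fun i j hij => ?_
    have : sortedPair i j ∈ T := (hPT i j).2 (Or.inl hij)
    simp only [hmat, this, dif_pos, hXdef]
    exact hE.eq_sortedPair ω i j
  set lin : (T → ℝ) × (T' → ℝ) → ℝ := fun z => ∑ k ∈ s.attach, c (mat z.1) k *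
    z.2 ⟨sortedPair (e k).1 (e k).2, Finset.mem_image_of_mem _ k.2⟩ with hlin
  set B : Set ((T → ℝ) × (T' → ℝ)) :=
    {z | ∑ k ∈ s, c (mat z.1) k ^ 2 ≤ V ∧ t < |lin z|} with hBdef
  have hlinm : Measurable lin := by
    refine Finset.measurable_sum _ fun k _ => ?_
    exact ((hcm k).comp (hmatm.comp measurable_fst)).mul
      ((measurable_pi_apply _).comp measurable_snd)
  have hB : MeasurableSet B := by
    have h1 : Measurable fun z : (T → ℝ) × (T' → ℝ) => ∑ k ∈ s, c (mat z.1) k ^ 2 :=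
      Finset.measurable_sum _ fun k _ => ((hcm k).comp (hmatm.comp measurable_fst)).pow_const 2
    have h2 := (measurableSet_le h1 (measurable_const (a := V))).inter
      (measurableSet_lt (measurable_const (a := t)) hlinm.abs)
    simpa only [hBdef, Set.ofPred_and] using h2
  have hval : ∀ (u : T → ℝ) ω, lin (u, fun p => X p ω) =
      ∑ k ∈ s, c (mat u) k * X (sortedPair (e k).1 (e k).2) ω := by
    intro u ω
    exact Finset.sum_attach s fun k => c (mat u) k * X (sortedPair (e k).1 (e k).2) ω
  have hset : {ω | ∑ k ∈ s, c (E ω) k ^ 2 ≤ V ∧ t < |∑ k ∈ s, c (E ω) k * E ω (e k).1 (e k).2|} =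
      {ω | ((fun p : T => X p ω), fun p : T' => X p ω) ∈ B} := by
    ext ω
    simp only [hBdef, Set.mem_ofPred_eq, hval, ← hcmat]
    simp only [hXdef, ← hE.eq_sortedPair]
  rw [hset]
  refine measure_prod_mem_le hind (measurable_pi_lambda _ fun p => hXm p)
    (measurable_pi_lambda _ fun p => hXm p) hB fun u => ?_
  by_cases hu : ∑ k ∈ s, c (mat u) k ^ 2 ≤ V
  · have := Seriation.measure_weighted_sum_le hE.indep (fun p => hE.subgaussian _ _) he hu ht
    refine (measure_mono fun ω hω => ?_).trans this
    have h1 : t < |lin (u, fun p => X p ω)| := hω.2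
    rw [hval] at h1
    exact h1
  · have : {ω | (u, fun p : T' => X p ω) ∈ B} = ∅ := by
      ext ω
      simp [hBdef, hu]
    exact (measure_mono this.subset).trans (by simp)

/-! ### Typical noise -/

/-- The error of an inner product consists of two forms that are linear in the noise, of the inner
product of two noise rows without the entries `i` and `j`, and of the two remaining products. Leaving
out these entries makes the two noise rows independent, since `x i j = x j i`. -/
theorem abs_gram_observation_sub_le {F x : Mat n ℝ} {π : Equiv.Perm (Fin n)} {σ b₀ b₁ b₂ : ℝ}
    (hσ : 0 ≤ σ) {S : Fin n → Bool} {i j : Fin n} (hi : S i = true) (hj : S j = true) (hij : i ≠ j)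
    (h0 : ∀ k l, |x k l| ≤ b₀)
    (h1 : ∀ k l, |∑ m, masked (signal F π) S k m * x l m| ≤ b₁)
    (h2 : |∑ m, (if S m = true ∧ m ≠ i ∧ m ≠ j then x i m else 0) * x j m| ≤ b₂) :
    |gram (observation F π σ x) S i j - gram (signal F π) S i j| ≤
      2 * σ * b₁ + σ ^ 2 * (b₂ + 2 * b₀ ^ 2) := by
  have hb : 0 ≤ b₀ := (abs_nonneg _).trans (h0 i j)
  have hsplit : ∑ m, (if S m = true then x i m * x j m else 0) =
      ∑ m, (if S m = true ∧ m ≠ i ∧ m ≠ j then x i m else 0) * x j m +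
        (x i i * x j i + x i j * x j j) := by
    have e1 : x i i * x j i = ∑ m, if m = i then x i m * x j m else 0 := by simp
    have e2 : x i j * x j j = ∑ m, if m = j then x i m * x j m else 0 := by simp
    rw [e1, e2, ← Finset.sum_add_distrib, ← Finset.sum_add_distrib]
    refine Finset.sum_congr rfl fun m _ => ?_
    by_cases hmi : m = i
    · subst hmi; simp [hi, hij]
    · by_cases hmj : m = j
      · subst hmj; simp [hj, hmi]
      · by_cases hm : S m = true <;> simp [hm, hmi, hmj]
  have hdec : gram (observation F π σ x) S i j - gram (signal F π) S i j =
      σ * ∑ m, masked (signal F π) S i m * x j m + σ * ∑ m, masked (signal F π) S j m * x i m +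
        σ ^ 2 * ∑ m, (if S m = true then x i m * x j m else 0) := by
    simp only [gram, Finset.mul_sum, ← Finset.sum_sub_distrib, ← Finset.sum_add_distrib]
    refine Finset.sum_congr rfl fun m _ => ?_
    by_cases hm : S m = true
    · simp only [masked, hi, hj, hm, and_self, if_true, observation, signal]; ring
    · simp [masked, hm]
  rw [hdec, hsplit]
  have h3 : |x i i * x j i| ≤ b₀ ^ 2 := by
    rw [abs_mul, sq]; exact mul_le_mul (h0 _ _) (h0 _ _) (abs_nonneg _) hb
  have h4 : |x i j * x j j| ≤ b₀ ^ 2 := by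
    rw [abs_mul, sq]; exact mul_le_mul (h0 _ _) (h0 _ _) (abs_nonneg _) hb
  have h5 := h1 i j
  have h6 := h1 j i
  generalize ∑ m, masked (signal F π) S i m * x j m = u at *
  generalize ∑ m, masked (signal F π) S j m * x i m = v at *
  generalize ∑ m, (if S m = true ∧ m ≠ i ∧ m ≠ j then x i m else 0) * x j m = w at *
  have h7 : |w + (x i i * x j i + x i j * x j j)| ≤ b₂ + 2 * b₀ ^ 2 := by
    rw [abs_le] at *; constructor <;> linarith
  calc |σ * u + σ * v + σ ^ 2 * (w + (x i i * x j i + x i j * x j j))|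
      ≤ |σ * u| + |σ * v| + |σ ^ 2 * (w + (x i i * x j i + x i j * x j j))| := abs_add_three _ _ _
    _ ≤ σ * b₁ + σ * b₁ + σ ^ 2 * (b₂ + 2 * b₀ ^ 2) := by
        rw [abs_mul, abs_mul, abs_mul, abs_of_nonneg hσ, abs_of_nonneg (sq_nonneg σ)]
        gcongr
    _ = _ := by ring

/-- All indices, or one block of the partition. -/
def region (s : Fin n → Fin 3) : Option (Fin 3) → Fin n → Bool
  | none => fun _ => true
  | some t => block s t

/-- For noise matrices outside these sets, the event on which SABRE succeeds occurs as far as the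
noise is concerned. They concern, in this order, single entries, the inner products of a row of the
signal with a row of the noise, those of two rows of the noise when the entries of the first one are
of the typical size, and the sums used to compare `i` with `j`. -/
def exceptional (F : Mat n ℝ) (π : Equiv.Perm (Fin n)) (σ δ₄ : ℝ) (s : Fin n → Fin 3) :
    (Fin n × Fin n) ⊕ (Option (Fin 3) × Fin n × Fin n) ⊕ (Option (Fin 3) × Fin n × Fin n) ⊕
      (Fin 3 × Fin n × Fin n × Fin n × Bool) → Set (Mat n ℝ)
  | .inl (i, j) => {x | 5 * √(Real.log n) < |x i j|}
  | .inr (.inl (t, i, j)) =>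
    {x | 5 * √(n * Real.log n) < |∑ m, masked (signal F π) (region s t) i m * x j m|}
  | .inr (.inr (.inl (t, i, j))) =>
    {x | i ≠ j ∧ (∀ m, |x i m| ≤ 5 * √(Real.log n)) ∧
      25 * (√n * Real.log n) <
        |∑ m, (if region s t m = true ∧ m ≠ i ∧ m ≠ j then x i m else 0) * x j m|}
  | .inr (.inr (.inr (t, i, j, p, right))) =>
    {x | i ≠ j ∧ s i ≠ t ∧ s j ≠ t ∧ 3 * √(n * Real.log n) <
      |sideSum π (observation F π σ x) δ₄ (block s t) x right p i j|}

theorem measurable_entry (i j : Fin n) : Measurable fun x : Mat n ℝ => x i j :=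
  (measurable_pi_apply j).comp (measurable_pi_apply i)

theorem measurable_observation (F : Mat n ℝ) (π : Equiv.Perm (Fin n)) (σ : ℝ) :
    Measurable (observation F π σ) :=
  measurable_pi_lambda _ fun i => measurable_pi_lambda _ fun j =>
    ((measurable_entry i j).const_mul σ).const_add _

theorem measurable_sideSum_coefficient (F : Mat n ℝ) (π : Equiv.Perm (Fin n)) (σ δ₄ : ℝ)
    (S : Fin n → Bool) (right : Bool) (p k : Fin n) :
    MeasurableSet {x | S k = true ∧
      δ₄ ≤ (estimateDistance (observation F π σ x) S).val p k ∧ onSide π right p k = true} := by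
  refine (MeasurableSet.const _).inter (MeasurableSet.inter ?_ (MeasurableSet.const _))
  exact measurableSet_le measurable_const
    ((measurable_estimateDistance S p k).comp (measurable_observation F π σ))

theorem measurableSet_exceptional (F : Mat n ℝ) (π : Equiv.Perm (Fin n)) (σ δ₄ : ℝ)
    (s : Fin n → Fin 3) (w) : MeasurableSet (exceptional F π σ δ₄ s w) := by
  have hx := fun i j : Fin n => measurable_entry i j
  rcases w with ⟨i, j⟩ | ⟨t, i, j⟩ | ⟨t, i, j⟩ | ⟨t, i, j, p, right⟩
  · exact measurableSet_lt measurable_const (hx i j).abs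
  · refine measurableSet_lt measurable_const (Measurable.abs ?_)
    exact Finset.measurable_sum _ fun m _ => (hx j m).const_mul _
  · have h1 : MeasurableSet {x : Mat n ℝ | ∀ m, |x i m| ≤ 5 * √(Real.log n)} := by
      rw [Set.ofPred_forall]
      exact MeasurableSet.iInter fun m => measurableSet_le (hx i m).abs measurable_const
    have h2 : Measurable fun x : Mat n ℝ =>
        ∑ m, (if region s t m = true ∧ m ≠ i ∧ m ≠ j then x i m else 0) * x j m := by
      refine Finset.measurable_sum _ fun m _ => Measurable.mul ?_ (hx j m)
      split_ifs
      · exact hx i m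
      · exact measurable_const
    have h3 := (MeasurableSet.const (i ≠ j)).inter
      (h1.inter (measurableSet_lt (measurable_const (a := 25 * (√n * Real.log n))) h2.abs))
    simpa only [exceptional, Set.ofPred_and] using h3
  · have h1 : Measurable fun x : Mat n ℝ =>
        sideSum π (observation F π σ x) δ₄ (block s t) x right p i j :=
      Finset.measurable_sum _ fun k _ => Measurable.ite
        (measurable_sideSum_coefficient F π σ δ₄ _ right p k) ((hx i k).sub (hx j k))
        measurable_const
    have h2 := (MeasurableSet.const (i ≠ j)).inter ((MeasurableSet.const (s i ≠ t)).inter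
      ((MeasurableSet.const (s j ≠ t)).inter
        (measurableSet_lt (measurable_const (a := 3 * √(n * Real.log n))) h1.abs)))
    simpa only [exceptional, Set.ofPred_and] using h2

theorem exp_neg_mul_log_le {n : ℕ} (hn : 1 ≤ n) {m : ℕ} {y : ℝ} (hy : y ≤ -(m * Real.log n)) :
    Real.exp y ≤ 1 / (n : ℝ) ^ m := by
  have h0 : (0 : ℝ) < n := by exact_mod_cast hn
  refine (Real.exp_le_exp.2 hy).trans_eq ?_
  rw [Real.exp_neg, Real.exp_nat_mul, Real.exp_log h0, one_div]

/-- The deviations in the definition of `exceptional` are chosen such that the exponent in each tail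
bound is at least `6 log n`; the smallest one, for the comparisons, is `27 n log n / (4 (n + 2))`. -/
theorem IsNoise.measure_exceptional_le {Ω : Type*} [MeasurableSpace Ω] {μ : Measure Ω}
    [IsProbabilityMeasure μ] {E : Ω → Mat n ℝ} (hE : IsNoise E μ) {F : Mat n ℝ}
    (hF : ∀ i j, F i j ∈ Set.Icc (0 : ℝ) 1) (π : Equiv.Perm (Fin n)) (σ δ₄ : ℝ)
    {s : Fin n → Fin 3} (hs : s ∈ balancedPartitions n) (hn : 16 ≤ n) (w) :
    μ (E ⁻¹' exceptional F π σ δ₄ s w) ≤ ENNReal.ofReal (2 / (n : ℝ) ^ 6) := by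
  have hn1 : (16 : ℝ) ≤ n := by exact_mod_cast hn
  have hn0 : (0 : ℝ) < n := by linarith
  have hL : 0 < Real.log n := Real.log_pos (by linarith)
  have tail : ∀ {V t : ℝ}, -t ^ 2 / (2 * V) ≤ -((6 : ℕ) * Real.log n) →
      ENNReal.ofReal (2 * Real.exp (-t ^ 2 / (2 * V))) ≤ ENNReal.ofReal (2 / (n : ℝ) ^ 6) := by
    intro V t h
    refine ENNReal.ofReal_le_ofReal ?_
    have := exp_neg_mul_log_le (by omega) h
    calc 2 * Real.exp (-t ^ 2 / (2 * V)) ≤ 2 * (1 / (n : ℝ) ^ 6) := by gcongr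
      _ = _ := by ring
  have hsymm : ∀ (j : Fin n) (s : Finset (Fin n)),
      Set.InjOn (fun k => sortedPair ((fun m => (j, m)) k : Fin n × Fin n).1
        ((fun m => (j, m)) k : Fin n × Fin n).2) s := by
    intro j s a _ b _ hab
    rcases sortedPair_eq_iff.1 hab with h | h
    · exact h.2
    · exact h.2.trans h.1
  rcases w with ⟨i, j⟩ | ⟨t, i, j⟩ | ⟨t, i, j⟩ | ⟨t, i, j, p, right⟩
  · have h := hE.measure_weighted_sum_le (fun _ _ => False) (s := Finset.univ)
      (e := fun _ : Unit => (i, j)) (fun _ _ _ _ _ => rfl) (by simp) (c := fun _ _ => 1)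
      (fun _ => measurable_const) (fun _ _ _ => rfl) (V := 1) (t := 5 * √(Real.log n))
      (by positivity)
    refine (measure_mono fun ω hω => ?_).trans (h.trans (tail ?_))
    · have h1 : 5 * √(Real.log n) < |E ω i j| := hω
      simpa using h1
    · rw [mul_pow, Real.sq_sqrt hL.le]
      push_cast
      linarith
  · have h := hE.measure_weighted_sum_le (fun _ _ => False) (s := Finset.univ)
      (e := fun m : Fin n => (j, m)) (hsymm j _) (by simp)
      (c := fun _ m => masked (signal F π) (region s t) i m)
      (fun _ => measurable_const) (fun _ _ _ => rfl) (V := n) (t := 5 * √(n * Real.log n))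
      (by positivity)
    refine (measure_mono fun ω hω => ?_).trans (h.trans (tail ?_))
    · have h1 : 5 * √(n * Real.log n) <
        |∑ m, masked (signal F π) (region s t) i m * E ω j m| := hω
      refine ⟨?_, h1⟩
      have h2 : ∀ m ∈ Finset.univ, masked (signal F π) (region s t) i m ^ 2 ≤ 1 := by
        intro m _
        unfold masked
        split_ifs
        · exact pow_le_one₀ (hF _ _).1 (hF _ _).2
        · simp
      simpa using Finset.sum_le_sum h2
    · rw [mul_pow, Real.sq_sqrt (by positivity), neg_div, neg_le_neg_iff, le_div_iff₀ (by positivity)]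
      push_cast
      nlinarith [mul_pos hn0 hL]
  -- condition on row `i`, without its entry `j`, which also belongs to row `j`
  · by_cases hij : i = j
    · refine (measure_mono (t := ∅) fun ω hω => ?_).trans (by simp)
      exact absurd hij hω.1
    have h := hE.measure_weighted_sum_le (fun k l => k = i ∧ l ≠ j)
      (s := Finset.univ.filter fun m => m ≠ i ∧ m ≠ j)
      (e := fun m : Fin n => (j, m)) (hsymm j _) (by
        intro k hk
        simp only [Finset.mem_filter, Finset.mem_univ, true_and] at hk
        exact ⟨fun h => hij h.1.symm, fun h => h.2 rfl⟩)
      (c := fun x m => if region s t m = true ∧ m ≠ i ∧ m ≠ j then x i m else 0)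
      (fun m => by
        split_ifs
        · exact measurable_entry i m
        · exact measurable_const)
      (fun x y hxy => by
        funext m
        refine if_ctx_congr Iff.rfl (fun hm => hxy i m ⟨rfl, hm.2.2⟩) fun _ => rfl)
      (V := 25 * (n * Real.log n)) (t := 25 * (√n * Real.log n))
      (by positivity)
    refine (measure_mono fun ω hω => ?_).trans (h.trans (tail ?_))
    · obtain ⟨-, h1, h2⟩ := hω
      constructor
      · have h3 : ∀ m ∈ Finset.univ.filter fun m : Fin n => m ≠ i ∧ m ≠ j,
            (if region s t m = true ∧ m ≠ i ∧ m ≠ j then E ω i m else 0) ^ 2 ≤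
              25 * Real.log n := by
          intro m _
          split_ifs
          · rw [← sq_abs]
            refine (pow_le_pow_left₀ (abs_nonneg _) (h1 m) 2).trans_eq ?_
            rw [mul_pow, Real.sq_sqrt hL.le]; norm_num
          · simp; positivity
        refine (Finset.sum_le_card_nsmul _ _ _ h3).trans ?_
        rw [nsmul_eq_mul]
        have h4 : ((Finset.univ.filter fun m : Fin n => m ≠ i ∧ m ≠ j).card : ℝ) ≤ n := by
          exact_mod_cast (Finset.card_le_univ _).trans_eq (Fintype.card_fin n)
        nlinarith [mul_le_mul_of_nonneg_right h4 hL.le]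
      · rw [Finset.sum_filter_of_ne]
        · exact h2
        · intro m _ hm
          by_contra hcon
          exact hm (by rw [if_neg (fun h => hcon h.2), zero_mul])
    · rw [mul_pow, mul_pow, Real.sq_sqrt hn0.le, neg_div, neg_le_neg_iff, le_div_iff₀ (by positivity)]
      push_cast
      nlinarith [mul_pos hn0 (pow_pos hL 2)]
  -- condition on the entries inside the block, which determine the set of summation; the block has at
  -- most `(n + 2) / 3` elements, and each contributes two coefficients `±1`
  · by_cases hij : i ≠ j ∧ s i ≠ t ∧ s j ≠ t
    swap
    · refine (measure_mono (t := ∅) fun ω hω => ?_).trans (by simp)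
      exact absurd ⟨hω.1, hω.2.1, hω.2.2.1⟩ hij
    obtain ⟨hij, hi, hj⟩ := hij
    have h := hE.measure_weighted_sum_le (fun k l => s k = t ∧ s l = t)
      (s := Finset.univ ×ˢ Finset.univ.filter fun m => s m = t)
      (e := fun q : Bool × Fin n => (if q.1 = true then i else j, q.2)) (by
        rintro ⟨a, k⟩ ha ⟨b, l⟩ hb hab
        simp only [Finset.coe_product, Finset.coe_univ, Set.mem_prod, Set.mem_univ, true_and,
          Finset.coe_filter, Finset.mem_univ, Set.mem_ofPred_eq] at ha hb
        rcases sortedPair_eq_iff.1 hab with h | h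
        · obtain ⟨h1, h2⟩ := h
          cases a <;> cases b <;> simp_all
        · obtain ⟨h1, h2⟩ := h
          exfalso
          simp only at h1 h2
          split_ifs at h1 <;> simp_all)
      (by
        rintro ⟨a, k⟩ hk
        cases a <;> simp [hi, hj])
      (c := fun x q => if block s t q.2 = true ∧
        δ₄ ≤ (estimateDistance (observation F π σ x) (block s t)).val p q.2 ∧
          onSide π right p q.2 = true then (if q.1 = true then 1 else -1) else 0)
      (fun q => Measurable.ite (measurable_sideSum_coefficient F π σ δ₄ _ right p q.2)
        measurable_const measurable_const)
      (fun x y hxy => by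
        funext q
        have : (estimateDistance (observation F π σ x) (block s t)).val =
            (estimateDistance (observation F π σ y) (block s t)).val := by
          refine estimateDistance_congr fun k l hk hl => ?_
          simp only [block, decide_eq_true_eq] at hk hl
          simp [observation, hxy k l ⟨hk, hl⟩]
        simp only [this])
      (V := 2 * ((n + 2) / 3)) (t := 3 * √(n * Real.log n))
      (by positivity)
    refine (measure_mono fun ω hω => ?_).trans (h.trans (tail ?_))
    · obtain ⟨-, -, -, h2⟩ := hω
      constructor
      · refine (Finset.sum_le_card_nsmul _ _ 1 fun q _ => ?_).trans ?_
        · split_ifs <;> norm_num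
        · have h3 : (3 : ℝ) * (Finset.univ.filter fun k => s k = t).card ≤ n + 2 := by
            have := (hs t).2
            exact_mod_cast (by omega : 3 * (Finset.univ.filter fun k => s k = t).card ≤ n + 2)
          rw [Finset.card_product, nsmul_eq_mul]
          push_cast [Finset.card_univ, Fintype.card_bool]
          linarith
      · refine h2.trans_eq (congrArg abs ?_)
        rw [Finset.sum_product, Fintype.sum_bool, ← Finset.sum_add_distrib, sideSum]
        rw [Finset.sum_filter]
        refine Finset.sum_congr rfl fun k _ => ?_
        by_cases hk : s k = t
        · simp only [hk, if_true]
          split_ifs <;> simp_all [sub_eq_add_neg]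
        · simp [hk, block]
    · rw [mul_pow, Real.sq_sqrt (by positivity), neg_div, neg_le_neg_iff, le_div_iff₀ (by positivity)]
      push_cast
      nlinarith [mul_pos hn0 hL]

theorem gram_accurate_of_not_exceptional {F x : Mat n ℝ} {π : Equiv.Perm (Fin n)} {σ δ₄ : ℝ}
    {s : Fin n → Fin 3} (hσ : 0 ≤ σ) (hn : 3 ≤ n) (hx : ∀ w, x ∉ exceptional F π σ δ₄ s w)
    {S : Fin n → Bool} (hS : S = (fun _ => true) ∨ ∃ t, S = block s t) {i j : Fin n}
    (hi : S i = true) (hj : S j = true) (hij : i ≠ j) :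
    |gram (observation F π σ x) S i j - gram (signal F π) S i j| ≤
      (10 * σ + 75 * σ ^ 2) * (√n * Real.log n) := by
  obtain ⟨t, rfl⟩ : ∃ t, S = region s t := by
    rcases hS with rfl | ⟨t, rfl⟩
    · exact ⟨none, rfl⟩
    · exact ⟨some t, rfl⟩
  have hn0 : (3 : ℝ) ≤ n := by exact_mod_cast hn
  have hL : 1 ≤ Real.log n := by
    rw [Real.le_log_iff_exp_le (by linarith)]
    linarith [Real.exp_one_lt_d9]
  have hs : 1 ≤ √(n : ℝ) := Real.one_le_sqrt.2 (by linarith)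
  have h0 : ∀ k l, |x k l| ≤ 5 * √(Real.log n) := fun k l => not_lt.1 (hx (.inl (k, l)))
  have h1 : ∀ k l, |∑ m, masked (signal F π) (region s t) k m * x l m| ≤ 5 * √(n * Real.log n) :=
    fun k l => not_lt.1 (hx (.inr (.inl (t, k, l))))
  have h2 : |∑ m, (if region s t m = true ∧ m ≠ i ∧ m ≠ j then x i m else 0) * x j m| ≤
      25 * (√n * Real.log n) :=
    not_lt.1 fun h => hx (.inr (.inr (.inl (t, i, j)))) ⟨hij, fun m => h0 i m, h⟩
  refine (abs_gram_observation_sub_le hσ hi hj hij h0 h1 h2).trans ?_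
  have h3 : √(n * Real.log n) ≤ √n * Real.log n := by
    rw [Real.sqrt_mul (by linarith)]
    gcongr
    exact Real.sqrt_le_iff.2 ⟨by linarith, by nlinarith⟩
  have h4 : Real.log n ≤ √n * Real.log n := le_mul_of_one_le_left (by linarith) hs
  rw [mul_pow, Real.sq_sqrt (by linarith)]
  have h5 := mul_le_mul_of_nonneg_left h3 hσ
  have h6 := mul_le_mul_of_nonneg_left h4 (sq_nonneg σ)
  linarith

theorem IsNoise.measure_iUnion_exceptional_le {Ω : Type*} [MeasurableSpace Ω] {μ : Measure Ω}
    [IsProbabilityMeasure μ] {E : Ω → Mat n ℝ} (hE : IsNoise E μ) {F : Mat n ℝ}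
    (hF : ∀ i j, F i j ∈ Set.Icc (0 : ℝ) 1) (π : Equiv.Perm (Fin n)) (σ δ₄ : ℝ)
    {s : Fin n → Fin 3} (hs : s ∈ balancedPartitions n) (hn : 16 ≤ n) :
    μ (E ⁻¹' ⋃ w, exceptional F π σ δ₄ s w) ≤ ENNReal.ofReal (30 / (n : ℝ) ^ 3) := by
  have hn0 : (16 : ℝ) ≤ n := by exact_mod_cast hn
  rw [Set.preimage_iUnion]
  refine (measure_iUnion_fintype_le μ _).trans ?_
  refine (Finset.sum_le_card_nsmul _ _ _ fun w _ =>
    hE.measure_exceptional_le hF π σ δ₄ hs hn w).trans ?_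
  rw [nsmul_eq_mul, ← ENNReal.ofReal_natCast, ← ENNReal.ofReal_mul (by positivity)]
  refine ENNReal.ofReal_le_ofReal ?_
  simp only [Finset.card_univ, Fintype.card_sum, Fintype.card_prod, Fintype.card_fin,
    Fintype.card_option, Fintype.card_bool]
  rw [mul_div_assoc', div_le_div_iff₀ (by positivity) (by positivity)]
  push_cast
  have h1 : (n : ℝ) * n ≤ n * n * n := le_mul_of_one_le_right (by positivity) (by linarith)
  have h2 : (n : ℝ) * n + (4 * (n * n) + (4 * (n * n) + 3 * (n * (n * (n * 2))))) ≤
      15 * n ^ 3 := by nlinarith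
  calc _ ≤ 15 * (n : ℝ) ^ 3 * 2 * n ^ 3 := by gcongr
    _ = _ := by ring

/-- The random partition is independent of the noise, so it can be treated as fixed. -/
theorem IsNoise.measure_exists_exceptional_le {Ω : Type*} [MeasurableSpace Ω] {μ : Measure Ω}
    [IsProbabilityMeasure μ] {E : Ω → Mat n ℝ} (hE : IsNoise E μ) {part : Ω → Fin n → Fin 3}
    (hpart : Measurable part) (hind : IndepFun E part μ) {F : Mat n ℝ}
    (hF : ∀ i j, F i j ∈ Set.Icc (0 : ℝ) 1) (π : Equiv.Perm (Fin n)) (σ δ₄ : ℝ) (hn : 16 ≤ n) :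
    μ {ω | part ω ∈ balancedPartitions n ∧ ∃ w, E ω ∈ exceptional F π σ δ₄ (part ω) w} ≤
      ENNReal.ofReal (30 / (n : ℝ) ^ 3) := by
  set B : Set ((Fin n → Fin 3) × Mat n ℝ) := ⋃ s : balancedPartitions n,
    {(s : Fin n → Fin 3)} ×ˢ ⋃ w, exceptional F π σ δ₄ s w with hB
  have hmem : ∀ z, z ∈ B ↔ z.1 ∈ balancedPartitions n ∧ ∃ w, z.2 ∈ exceptional F π σ δ₄ z.1 w := by
    rintro ⟨s, x⟩
    simp only [hB, Set.mem_iUnion, Set.mem_prod, Set.mem_singleton_iff]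
    constructor
    · rintro ⟨⟨s', hs'⟩, rfl, h⟩
      exact ⟨hs', h⟩
    · rintro ⟨hs, h⟩
      exact ⟨⟨s, hs⟩, rfl, h⟩
  have hBm : MeasurableSet B := MeasurableSet.iUnion fun s => (measurableSet_singleton _).prod
    (MeasurableSet.iUnion fun w => measurableSet_exceptional F π σ δ₄ s w)
  refine (measure_mono fun ω hω => ?_).trans
    (measure_prod_mem_le hind.symm hpart hE.measurable hBm (q := ENNReal.ofReal (30 / (n : ℝ) ^ 3))
      fun s => ?_)
  · exact (hmem (part ω, E ω)).2 hω
  · by_cases hs : s ∈ balancedPartitions n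
    · refine (measure_mono fun ω hω => ?_).trans
        (hE.measure_iUnion_exceptional_le hF π σ δ₄ hs hn)
      exact Set.mem_iUnion.2 ((hmem (s, E ω)).1 hω).2
    · refine (measure_mono (t := ∅) fun ω hω => ?_).trans (by simp)
      exact hs ((hmem (s, E ω)).1 hω).1

/-! ### Sampling a balanced partition -/

/-- The product of factorials gains a factor `n / 3 + 1` when `n` is replaced by `n + 1`. -/
theorem three_pow_mul_factorial_le (n : ℕ) :
    3 ^ n * ((n / 3).factorial * ((n + 1) / 3).factorial * ((n + 2) / 3).factorial) ≤
      n.factorial * (n + 1) ^ 2 := by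
  induction n with
  | zero => simp
  | succ n ih =>
    have h1 : (n + 1 + 2) / 3 = n / 3 + 1 := by omega
    rw [h1, Nat.factorial_succ (n / 3), Nat.factorial_succ n]
    calc 3 ^ (n + 1) * (((n + 1) / 3).factorial * ((n + 1 + 1) / 3).factorial *
          ((n / 3 + 1) * (n / 3).factorial))
        = 3 * (n / 3 + 1) * (3 ^ n *
          ((n / 3).factorial * ((n + 1) / 3).factorial * ((n + 2) / 3).factorial)) := by ring
      _ ≤ 3 * (n / 3 + 1) * (n.factorial * (n + 1) ^ 2) := by gcongr
      _ ≤ (n + 3) * (n.factorial * (n + 1) ^ 2) := by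
          gcongr
          omega
      _ = (n + 1) * n.factorial * ((n + 3) * (n + 1)) := by ring
      _ ≤ (n + 1) * n.factorial * (n + 1 + 1) ^ 2 := by
          gcongr
          nlinarith

open Finset in
/-- A uniformly random map to three blocks is balanced with probability at least `1 / (n + 1)²`; the
maps with block sizes `⌊n / 3⌋`, `⌊(n + 1) / 3⌋` and `⌊(n + 2) / 3⌋` suffice. -/
theorem three_pow_le_card_balancedPartitions (n : ℕ) [DecidablePred (· ∈ balancedPartitions n)] :
    3 ^ n ≤ (Finset.univ.filter (· ∈ balancedPartitions n)).card * (n + 1) ^ 2 := by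
  classical
  obtain ⟨a, ha⟩ : ∃ a, a = n / 3 := ⟨_, rfl⟩
  obtain ⟨b, hb⟩ : ∃ b, b = (n + 1) / 3 := ⟨_, rfl⟩
  have hc : (n + 2) / 3 = n - a - b := by
    have : n % 3 = 0 ∨ n % 3 = 1 ∨ n % 3 = 2 := by omega
    rcases this with h | h | h <;> omega
  set pairs : Finset (Σ _ : Finset (Fin n), Finset (Fin n)) :=
    (powersetCard a (univ : Finset (Fin n))).sigma fun P => powersetCard b (univ \ P) with hpairs
  have hcard : pairs.card = n.choose a * (n - a).choose b := by
    rw [hpairs, card_sigma, sum_congr rfl (g := fun _ => (n - a).choose b), sum_const,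
      card_powersetCard, card_univ, Fintype.card_fin, smul_eq_mul]
    intro P hP
    rw [card_powersetCard, card_sdiff_of_subset (subset_univ P), (mem_powersetCard.1 hP).2, card_univ,
      Fintype.card_fin]
  set f : (Σ _ : Finset (Fin n), Finset (Fin n)) → Fin n → Fin 3 := fun z k =>
    if k ∈ z.1 then 0 else if k ∈ z.2 then 1 else 2 with hf
  have hfib : ∀ z ∈ pairs, univ.filter (fun k => f z k = 0) = z.1 ∧
      univ.filter (fun k => f z k = 1) = z.2 ∧ univ.filter (fun k => f z k = 2) = (univ \ z.1) \ z.2 ∧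
      z.1.card = a ∧ z.2.card = b ∧ ((univ \ z.1) \ z.2).card = (n + 2) / 3 := by
    rintro ⟨P, Q⟩ hz
    obtain ⟨h1, h2⟩ := mem_sigma.1 hz
    rw [mem_powersetCard] at h1 h2
    have h3 : ∀ k, k ∈ Q → k ∉ P := fun k hk => (mem_sdiff.1 (h2.1 hk)).2
    refine ⟨?_, ?_, ?_, h1.2, h2.2, ?_⟩
    · ext k; simp only [hf, mem_filter, mem_univ, true_and]
      split_ifs <;> simp_all
    · ext k; simp only [hf, mem_filter, mem_univ, true_and]
      have := h3 k
      grind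
    · ext k; simp only [hf, mem_filter, mem_univ, true_and, mem_sdiff]
      split_ifs <;> simp_all
    · rw [card_sdiff_of_subset h2.1, card_sdiff_of_subset (subset_univ P), h1.2, h2.2, card_univ,
        Fintype.card_fin, hc]
  have hle : pairs.card ≤ (univ.filter (· ∈ balancedPartitions n)).card := by
    refine card_le_card_of_injOn f (fun z hz => ?_) fun z hz z' hz' h => ?_
    · obtain ⟨h0, h1, h2, h3, h4, h5⟩ := hfib z hz
      refine mem_coe.2 (mem_filter.2 ⟨mem_univ _, fun t => ?_⟩)
      fin_cases t
      · simp only [Fin.zero_eta, h0, h3]; omega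
      · simp only [Fin.mk_one, h1, h4]; omega
      · simp only [Fin.reduceFinMk, h2, h5]; omega
    · obtain ⟨h0, h1, -⟩ := hfib z hz
      obtain ⟨h0', h1', -⟩ := hfib z' hz'
      have e1 : z.1 = z'.1 := by rw [← h0, ← h0', h]
      have e2 : z.2 = z'.2 := by rw [← h1, ← h1', h]
      exact Sigma.ext e1 (heq_of_eq e2)
  have h1 := Nat.choose_mul_factorial_mul_factorial (n := n) (k := a) (by omega)
  have h2 := Nat.choose_mul_factorial_mul_factorial (n := n - a) (k := b) (by omega)
  have h3 := three_pow_mul_factorial_le n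
  rw [← ha, ← hb, hc] at h3
  have hpos : 0 < a.factorial * b.factorial * (n - a - b).factorial := by positivity
  refine Nat.le_of_mul_le_mul_right (h3.trans ?_) hpos
  calc n.factorial * (n + 1) ^ 2
      = n.choose a * (n - a).choose b * (n + 1) ^ 2 *
        (a.factorial * b.factorial * (n - a - b).factorial) := by
        rw [← h1, ← h2]; ring
    _ ≤ _ := by rw [← hcard]; gcongr

/-- A Chernoff bound: among all maps to three blocks, those for which one block receives less than
a quarter of the total weight are rare. The exponential moments are taken at `-1 / 8`. -/
theorem card_light_le {x : Fin n → ℝ} (hx : ∀ k, x k ∈ Set.Icc (0 : ℝ) 1) (t : Fin 3) :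
    ((Finset.univ.filter fun s : Fin n → Fin 3 =>
      (∑ k, if s k = t then x k else 0) < (∑ k, x k) / 4).card : ℝ) ≤
      3 ^ n * Real.exp (-(∑ k, x k) / 192) := by
  have hpt : ∀ s : Fin n → Fin 3, (if (∑ k, if s k = t then x k else 0) < (∑ k, x k) / 4
      then (1 : ℝ) else 0) ≤
      Real.exp ((∑ k, x k) / 32) * ∏ k, Real.exp (if s k = t then -(x k / 8) else 0) := by
    intro s
    split_ifs with h
    · rw [← Real.exp_sum, ← Real.exp_add, Real.one_le_exp_iff]
      have : ∑ k, (if s k = t then -(x k / 8) else 0) = -(∑ k, if s k = t then x k else 0) / 8 := by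
        rw [← Finset.sum_neg_distrib, Finset.sum_div]
        refine Finset.sum_congr rfl fun k _ => ?_
        split_ifs <;> ring
      rw [this]
      linarith
    · positivity
  have hfac : ∀ k, ∑ c : Fin 3, Real.exp (if c = t then -(x k / 8) else 0) ≤
      3 * Real.exp (-(7 * x k / 192)) := by
    intro k
    obtain ⟨h0, h1⟩ := hx k
    have h2 : ∑ c : Fin 3, Real.exp (if c = t then -(x k / 8) else 0) =
        2 + Real.exp (-(x k / 8)) := by
      fin_cases t <;> simp [Fin.sum_univ_three] <;> ring
    rw [h2]
    have h3 : Real.exp (-(x k / 8)) ≤ 1 - x k / 8 + (x k / 8) ^ 2 := by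
      have h4 := Real.add_one_le_exp (x k / 8)
      have h5 : Real.exp (-(x k / 8)) ≤ 1 / (1 + x k / 8) := by
        rw [Real.exp_neg, one_div]
        exact inv_anti₀ (by positivity) (by linarith)
      refine h5.trans ?_
      rw [div_le_iff₀ (by positivity)]
      have : 0 ≤ (x k / 8) ^ 3 := by positivity
      nlinarith
    have h6 := Real.add_one_le_exp (-(7 * x k / 192))
    nlinarith
  have hsum : ((Finset.univ.filter fun s : Fin n → Fin 3 =>
      (∑ k, if s k = t then x k else 0) < (∑ k, x k) / 4).card : ℝ) =
      ∑ s : Fin n → Fin 3, if (∑ k, if s k = t then x k else 0) < (∑ k, x k) / 4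
        then (1 : ℝ) else 0 := by
    rw [Finset.sum_boole]
  rw [hsum]
  calc _ ≤ ∑ s : Fin n → Fin 3, Real.exp ((∑ k, x k) / 32) *
        ∏ k, Real.exp (if s k = t then -(x k / 8) else 0) := Finset.sum_le_sum fun s _ => hpt s
    _ = Real.exp ((∑ k, x k) / 32) *
        ∏ k, ∑ c : Fin 3, Real.exp (if c = t then -(x k / 8) else 0) := by
        rw [← Finset.mul_sum, Finset.prod_univ_sum, Fintype.piFinset_univ]
    _ ≤ Real.exp ((∑ k, x k) / 32) * ∏ k, 3 * Real.exp (-(7 * x k / 192)) := by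
        gcongr with k _
        exact hfac k
    _ = 3 ^ n * Real.exp (-(∑ k, x k) / 192) := by
        rw [Finset.prod_mul_distrib, Finset.prod_const, Finset.card_univ, Fintype.card_fin,
          ← Real.exp_sum, mul_left_comm, ← Real.exp_add]
        congr 2
        rw [Finset.sum_neg_distrib, ← Finset.sum_div, ← Finset.mul_sum]
        ring

/-- The law of a random balanced partition is dominated by `(n + 1)²` times the uniform law on all
maps to three blocks. -/
theorem IsUniformPartition.measure_mem_le {Ω : Type*} [MeasurableSpace Ω] {μ : Measure Ω}
    {part : Ω → Fin n → Fin 3} (h : IsUniformPartition part μ) (A : Finset (Fin n → Fin 3)) :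
    μ (part ⁻¹' A) ≤ ENNReal.ofReal ((n + 1) ^ 2 * A.card / 3 ^ n) := by
  classical
  have hB : balancedPartitions n = ((Finset.univ.filter (· ∈ balancedPartitions n) :
    Finset (Fin n → Fin 3)) : Set (Fin n → Fin 3)) := by
    ext s
    rw [Finset.mem_coe, Finset.mem_filter]
    exact ⟨fun h => ⟨Finset.mem_univ _, h⟩, fun h => h.2⟩
  have h3 := three_pow_le_card_balancedPartitions n
  rw [← Measure.map_apply h.measurable A.measurableSet, h.law, hB, uniformOn_apply_finset]
  set B : Finset (Fin n → Fin 3) := Finset.univ.filter (· ∈ balancedPartitions n)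
  have hpos : 0 < B.card := by
    by_contra hcon
    have : B.card = 0 := by omega
    rw [this] at h3
    have : 0 < 3 ^ n := by positivity
    omega
  have hpos' : (0 : ℝ) < B.card := by exact_mod_cast hpos
  rw [← ENNReal.ofReal_natCast, ← ENNReal.ofReal_natCast, ← ENNReal.ofReal_div_of_pos hpos']
  refine ENNReal.ofReal_le_ofReal ?_
  rw [div_le_div_iff₀ hpos' (by positivity)]
  have h4 : ((B ∩ A).card : ℝ) ≤ A.card := by
    exact_mod_cast Finset.card_le_card Finset.inter_subset_right
  have h5 : (3 : ℝ) ^ n ≤ B.card * (n + 1) ^ 2 := by exact_mod_cast h3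
  calc ((B ∩ A).card : ℝ) * 3 ^ n ≤ A.card * (B.card * (n + 1) ^ 2) :=
        mul_le_mul h4 h5 (pow_nonneg (by norm_num) n) (Nat.cast_nonneg _)
    _ = _ := by ring

theorem IsUniformPartition.measure_notMem {Ω : Type*} [MeasurableSpace Ω] {μ : Measure Ω}
    {part : Ω → Fin n → Fin 3} (h : IsUniformPartition part μ) :
    μ {ω | part ω ∉ balancedPartitions n} = 0 := by
  have h1 : μ {ω | part ω ∉ balancedPartitions n} = μ (part ⁻¹' (balancedPartitions n)ᶜ) := rfl
  rw [h1, ← Measure.map_apply h.measurable (Set.toFinite _).measurableSet, h.law,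
    uniformOn_eq_zero_iff (Set.toFinite _), Set.inter_compl_self]

theorem weights_mem_Icc {F : Mat n ℝ} (hR : IsRobinson F)
    (hF : ∀ i j, F i j ∈ Set.Icc (0 : ℝ) 1) (π : Equiv.Perm (Fin n)) (w) (k : Fin n) :
    weights F π w k ∈ Set.Icc (0 : ℝ) 1 := by
  have hsub : ∀ i j k l, signal F π i j - signal F π k l ≤ 1 := fun i j k l => by
    linarith [(hF (π i) (π j)).2, (hF (π k) (π l)).1, show signal F π i j = F (π i) (π j) from rfl,
      show signal F π k l = F (π k) (π l) from rfl]
  rcases w with i | ⟨t, i, j⟩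
  · simp only [weights, window]
    split_ifs <;> simp
  · fin_cases t
    · simp only [weights, squaredDifference]
      refine ⟨sq_nonneg _, ?_⟩
      rw [sq_le_one_iff_abs_le_one, abs_le]
      exact ⟨by linarith [hsub j k i k], hsub i k j k⟩
    · simp only [weights, trimmedLeft]
      split_ifs with h
      · refine ⟨?_, hsub _ _ _ _⟩
        have h1 : (π k : Fin n) ≤ π i := by
          have : ((π k : ℕ) : ℝ) ≤ (π i : ℕ) := by
            have : (0 : ℝ) ≤ n := n.cast_nonneg
            linarith [h.2]
          exact_mod_cast this
        exact sub_nonneg.2 (hR.left (π k) (π i) (π j) h1 h.1)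
      · simp
    · simp only [weights, trimmedRight]
      split_ifs with h
      · refine ⟨?_, hsub _ _ _ _⟩
        have h1 : (π j : Fin n) ≤ π k := by
          have : ((π j : ℕ) : ℝ) ≤ (π k : ℕ) := by
            have : (0 : ℝ) ≤ n := n.cast_nonneg
            linarith [h.2]
          exact_mod_cast this
        exact sub_nonneg.2 (hR.right (π i) (π j) (π k) h.1 h1)
      · simp

theorem IsUniformPartition.measure_light_le {Ω : Type*} [MeasurableSpace Ω] {μ : Measure Ω}
    {part : Ω → Fin n → Fin 3} (h : IsUniformPartition part μ) {F : Mat n ℝ} (hR : IsRobinson F)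
    (hF : ∀ i j, F i j ∈ Set.Icc (0 : ℝ) 1) (π : Equiv.Perm (Fin n)) :
    μ {ω | ∃ t w, √n ≤ ∑ k, weights F π w k ∧
      (∑ k, if block (part ω) t k = true then weights F π w k else 0) <
        (∑ k, weights F π w k) / 4} ≤
      ENNReal.ofReal (12 * (n + 1) ^ 4 * Real.exp (-√n / 192)) := by
  have hone : ∀ z : Fin 3 × (Fin n ⊕ Fin 3 × Fin n × Fin n),
      μ {ω | √n ≤ ∑ k, weights F π z.2 k ∧
        (∑ k, if block (part ω) z.1 k = true then weights F π z.2 k else 0) <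
          (∑ k, weights F π z.2 k) / 4} ≤
      ENNReal.ofReal ((n + 1) ^ 2 * Real.exp (-√n / 192)) := by
    rintro ⟨t, w⟩
    by_cases hw : √n ≤ ∑ k, weights F π w k
    · refine (measure_mono fun ω hω => ?_).trans ((h.measure_mem_le (Finset.univ.filter
        fun s : Fin n → Fin 3 => (∑ k, if s k = t then weights F π w k else 0) <
          (∑ k, weights F π w k) / 4)).trans (ENNReal.ofReal_le_ofReal ?_))
      · have := hω.2
        simp only [block, decide_eq_true_eq] at this
        simpa using this
      · have h1 := card_light_le (weights_mem_Icc hR hF π w) t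
        rw [mul_div_assoc]
        gcongr
        rw [div_le_iff₀ (by positivity), mul_comm]
        refine h1.trans ?_
        gcongr
    · refine (measure_mono (t := ∅) fun ω hω => ?_).trans (by simp)
      exact hw hω.1
  have hset : {ω | ∃ t w, √n ≤ ∑ k, weights F π w k ∧
      (∑ k, if block (part ω) t k = true then weights F π w k else 0) <
        (∑ k, weights F π w k) / 4} ⊆ ⋃ z : Fin 3 × (Fin n ⊕ Fin 3 × Fin n × Fin n),
      {ω | √n ≤ ∑ k, weights F π z.2 k ∧
        (∑ k, if block (part ω) z.1 k = true then weights F π z.2 k else 0) <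
          (∑ k, weights F π z.2 k) / 4} := by
    rintro ω ⟨t, w, hω⟩
    exact Set.mem_iUnion.2 ⟨(t, w), hω⟩
  refine (measure_mono hset).trans ((measure_iUnion_fintype_le μ _).trans ?_)
  refine (Finset.sum_le_card_nsmul _ _ _ fun z _ => hone z).trans ?_
  rw [nsmul_eq_mul, ← ENNReal.ofReal_natCast, ← ENNReal.ofReal_mul (by positivity)]
  refine ENNReal.ofReal_le_ofReal ?_
  simp only [Finset.card_univ, Fintype.card_sum, Fintype.card_prod, Fintype.card_fin]
  push_cast
  have hn : (0 : ℝ) ≤ n := n.cast_nonneg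
  have : 3 * ((n : ℝ) + 3 * (n * n)) ≤ 12 * (n + 1) ^ 2 := by nlinarith
  calc 3 * ((n : ℝ) + 3 * (n * n)) * ((n + 1) ^ 2 * Real.exp (-√n / 192))
      ≤ 12 * (n + 1) ^ 2 * ((n + 1) ^ 2 * Real.exp (-√n / 192)) := by gcongr
    _ = _ := by ring

/-! ### The success probability -/

theorem isGood_of_not_exceptional {F x : Mat n ℝ} {π : Equiv.Perm (Fin n)} {σ δ₄ : ℝ}
    {s : Fin n → Fin 3} (hσ : 0 ≤ σ) (hn : 3 ≤ n) (hx : ∀ w, x ∉ exceptional F π σ δ₄ s w)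
    (hs : ¬ ∃ t w, √n ≤ ∑ k, weights F π w k ∧
      (∑ k, if block s t k = true then weights F π w k else 0) < (∑ k, weights F π w k) / 4) :
    IsGood F π σ δ₄ ((10 * σ + 75 * σ ^ 2) * (√n * Real.log n)) x s where
  gram _ hS _ _ hi hj hij := gram_accurate_of_not_exceptional hσ hn hx hS hi hj hij
  comparison t i j p right hij hi hj :=
    not_lt.1 fun h => hx (.inr (.inr (.inr (t, i, j, p, right)))) ⟨hij, hi, hj, h⟩
  sample t w hw := not_lt.1 fun h => hs ⟨t, w, hw, h⟩

theorem eventually_failure_le : ∀ᶠ n : ℕ in Filter.atTop,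
    2 * (30 / (n : ℝ) ^ 3) + 2 * (12 * (n + 1) ^ 4 * Real.exp (-√n / 192)) ≤ 1 / (n : ℝ) ^ 2 := by
  have h1 : Filter.Tendsto (fun n : ℕ => √(n : ℝ) / 192) Filter.atTop Filter.atTop :=
    (Real.tendsto_sqrt_atTop.comp tendsto_natCast_atTop_atTop).atTop_div_const (by norm_num)
  have h2 := (Real.tendsto_pow_mul_exp_neg_atTop_nhds_zero 12).comp h1
  have h3 : (0 : ℝ) < 1 / (768 * 192 ^ 12) := by norm_num
  filter_upwards [h2.eventually (gt_mem_nhds h3), Filter.eventually_ge_atTop 120] with n hn hn1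
  have hn2 : (120 : ℝ) ≤ n := by exact_mod_cast hn1
  have hn0 : (0 : ℝ) < n := by linarith
  simp only [Function.comp_apply, div_pow] at hn
  -- `(n + 1)⁴ n² ≤ 16 n⁶ = 16 (√n)¹²`
  have h4 : √(n : ℝ) ^ 12 = n ^ 6 := by
    rw [show (12 : ℕ) = 2 * 6 from rfl, pow_mul, Real.sq_sqrt hn0.le]
  rw [h4, ← neg_div, div_mul_eq_mul_div, div_lt_div_iff₀ (by positivity) (by positivity)] at hn
  have h5 : (n : ℝ) ^ 6 * Real.exp (-√n / 192) ≤ 1 / 768 := by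
    rw [le_div_iff₀ (by norm_num)]
    have : (n : ℝ) ^ 6 * Real.exp (-√n / 192) * 768 * 192 ^ 12 ≤ 1 * 192 ^ 12 := by linarith
    exact le_of_mul_le_mul_right this (by norm_num)
  have h6 : 12 * ((n : ℝ) + 1) ^ 4 * Real.exp (-√n / 192) ≤ 1 / (4 * n ^ 2) := by
    rw [le_div_iff₀ (by positivity)]
    have h7 : ((n : ℝ) + 1) ^ 4 ≤ (2 * n) ^ 4 := by gcongr; linarith
    calc 12 * ((n : ℝ) + 1) ^ 4 * Real.exp (-√n / 192) * (4 * n ^ 2)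
        ≤ 12 * (2 * n) ^ 4 * Real.exp (-√n / 192) * (4 * n ^ 2) := by gcongr
      _ = 768 * (n ^ 6 * Real.exp (-√n / 192)) := by ring
      _ ≤ 1 := by linarith
  have h8 : 30 / (n : ℝ) ^ 3 ≤ 1 / (4 * n ^ 2) := by
    rw [div_le_div_iff₀ (by positivity) (by positivity)]
    nlinarith [mul_le_mul_of_nonneg_right hn2 (sq_nonneg (n : ℝ))]
  calc _ ≤ 2 * (1 / (4 * (n : ℝ) ^ 2)) + 2 * (1 / (4 * n ^ 2)) := by gcongr
    _ = _ := by field_simp; norm_num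

/-- The success probability, by a union bound over the noise and the partition, each for the latent
order and for its reversal. -/
theorem IsNoise.measureReal_maxLoss_ge {α β r r' σ : ℝ} (hα : 0 < α) (hβ : 0 < β) (hr : 0 < r)
    (hr' : 0 < r') (hσ : 0 < σ) {F : Mat n ℝ} (hR : IsRobinson F)
    (hF : IsAverageLipschitz α β r r' F) (π : Equiv.Perm (Fin n)) {Ω : Type*} [MeasurableSpace Ω]
    {μ : Measure Ω} [IsProbabilityMeasure μ] {E : Ω → Mat n ℝ} {part : Ω → Fin n → Fin 3}
    (hE : IsNoise E μ) (hpart : IsUniformPartition part μ) (hind : IndepFun E part μ)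
    {δ₁ δ₂ δ₃ δ₄ : ℝ} (hn : 16 ≤ n)
    (hs : IsScale n (min α r') (max β (1 / r)) r ((10 * σ + 75 * σ ^ 2) * (√n * Real.log n))
      (σ * √(n * Real.log n)) δ₁ δ₂ δ₃ δ₄) :
    1 - (2 * (30 / (n : ℝ) ^ 3) + 2 * (12 * (n + 1) ^ 4 * Real.exp (-√n / 192))) ≤
      μ.real {ω | maxLoss (sabre (observation F π σ (E ω)) σ δ₁ δ₂ δ₃ δ₄ (part ω)).val π ≤
        40 * (σ / α) * √(Real.log n / n)} := by
  have hF' := hF.reversed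
  have hR' := hR.reversed
  set G := {ω | maxLoss (sabre (observation F π σ (E ω)) σ δ₁ δ₂ δ₃ δ₄ (part ω)).val π ≤
        40 * (σ / α) * √(Real.log n / n)} with hG
  set light : Mat n ℝ → Equiv.Perm (Fin n) → Set Ω := fun F π =>
    {ω | ∃ t w, √n ≤ ∑ k, weights F π w k ∧
      (∑ k, if block (part ω) t k = true then weights F π w k else 0) <
        (∑ k, weights F π w k) / 4} with hlight
  set noisy : Mat n ℝ → Equiv.Perm (Fin n) → Set Ω := fun F π =>
    {ω | part ω ∈ balancedPartitions n ∧ ∃ w, E ω ∈ exceptional F π σ δ₄ (part ω) w} with hnoisy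
  set unbalanced : Set Ω := {ω | part ω ∉ balancedPartitions n} with hunb
  have hcover : Set.univ ⊆ G ∪ (unbalanced ∪ ((noisy F π ∪ noisy (reversedMatrix F) (reversed π)) ∪
      (light F π ∪ light (reversedMatrix F) (reversed π)))) := by
    intro ω _
    by_contra hcon
    simp only [Set.mem_union, not_or] at hcon
    obtain ⟨h1, h2, ⟨h3, h4⟩, h5, h6⟩ := hcon
    have hbal : part ω ∈ balancedPartitions n := not_not.1 h2
    refine h1 (IsGood.maxLoss_le (isGood_of_not_exceptional hσ.le (by omega)
      (fun w hw => h3 ⟨hbal, w, hw⟩) h5) (isGood_of_not_exceptional hσ.le (by omega)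
      (fun w hw => h4 ⟨hbal, w, hw⟩) h6) hF hR hα hβ hr hr' ?_ hσ rfl hs)
    have := Real.log_natCast_nonneg n
    positivity
  have htoReal : ∀ {s : Set Ω} {q : ℝ}, 0 ≤ q → μ s ≤ ENNReal.ofReal q → μ.real s ≤ q :=
    fun hq h => ENNReal.toReal_le_of_le_ofReal hq h
  have hN : ∀ (F : Mat n ℝ) (π : Equiv.Perm (Fin n)), (∀ i j, F i j ∈ Set.Icc (0 : ℝ) 1) →
      μ.real (noisy F π) ≤ 30 / (n : ℝ) ^ 3 := fun F π h =>
    htoReal (by positivity) (hE.measure_exists_exceptional_le hpart.measurable hind h π σ δ₄ hn)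
  have hL : ∀ (F : Mat n ℝ) (π : Equiv.Perm (Fin n)), IsRobinson F →
      (∀ i j, F i j ∈ Set.Icc (0 : ℝ) 1) →
      μ.real (light F π) ≤ 12 * (n + 1) ^ 4 * Real.exp (-√n / 192) := fun F π hR h =>
    htoReal (by positivity) (hpart.measure_light_le hR h π)
  have hU : μ.real unbalanced = 0 := by
    rw [Measure.real, hpart.measure_notMem, ENNReal.toReal_zero]
  have h1 := measureReal_mono (μ := μ) hcover
  rw [probReal_univ] at h1
  have h2 := measureReal_union_le (μ := μ) G (unbalanced ∪ ((noisy F π ∪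
    noisy (reversedMatrix F) (reversed π)) ∪ (light F π ∪ light (reversedMatrix F) (reversed π))))
  have h3 := measureReal_union_le (μ := μ) unbalanced ((noisy F π ∪
    noisy (reversedMatrix F) (reversed π)) ∪ (light F π ∪ light (reversedMatrix F) (reversed π)))
  have h4 := measureReal_union_le (μ := μ) (noisy F π ∪
    noisy (reversedMatrix F) (reversed π)) (light F π ∪ light (reversedMatrix F) (reversed π))
  have h5 := measureReal_union_le (μ := μ) (noisy F π) (noisy (reversedMatrix F) (reversed π))
  have h6 := measureReal_union_le (μ := μ) (light F π) (light (reversedMatrix F) (reversed π))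
  have h7 := hN F π hF.mem_Icc
  have h8 := hN (reversedMatrix F) (reversed π) hF'.mem_Icc
  have h9 := hL F π hR hF.mem_Icc
  have h10 := hL (reversedMatrix F) (reversed π) hR' hF'.mem_Icc
  linarith

end Seriation

open Seriation in
theorem theorem4p1 :
    (∃ K : ℕ, ∀ n : ℕ, 1 ≤ n →
      ∀ (A : Mat n ℝ) (σ δ₁ δ₂ δ₃ δ₄ : ℝ) (part : Fin n → Fin 3),
        (sabre A σ δ₁ δ₂ δ₃ δ₄ part).steps ≤ K * n ^ 3) ∧
    ∀ α β r r' σ : ℝ, 0 < α → 0 < β → 0 < r → 0 < r' → 0 < σ →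
      ∃ C : ℕ, ∀ n : ℕ, C ≤ n →
        ∀ F : Mat n ℝ, IsRobinson F → IsAverageLipschitz α β r r' F →
        ∀ π : Equiv.Perm (Fin n),
        ∀ (Ω : Type*) [MeasurableSpace Ω] (μ : Measure Ω) [IsProbabilityMeasure μ]
          (E : Ω → Mat n ℝ) (part : Ω → Fin n → Fin 3),
          IsNoise E μ → IsUniformPartition part μ → IndepFun E part μ →
          1 - 1 / (n : ℝ) ^ 2 ≤
            μ.real {ω | maxLoss
              (sabre (observation F π σ (E ω)) σ
                (tuning n 1) (tuning n 2) (tuning n 3) (tuning n 4) (part ω)).val π ≤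
              40 * (σ / α) * Real.sqrt (Real.log n / n)} := by
  refine ⟨⟨1000, fun n hn A σ δ₁ δ₂ δ₃ δ₄ part => sabre_steps_le A σ δ₁ δ₂ δ₃ δ₄ part hn⟩,
    fun α β r r' σ hα hβ hr hr' hσ => ?_⟩
  have hev := (eventually_isScale (a := min α r') (b := max β (1 / r)) (r := r)
    (C := 10 * σ + 75 * σ ^ 2) (σ := σ) (lt_min hα hr') (lt_max_of_lt_left hβ) hr (by positivity)
    hσ).and (eventually_failure_le.and (Filter.eventually_ge_atTop 16))
  obtain ⟨C, hC⟩ := Filter.eventually_atTop.1 hev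
  refine ⟨C, fun n hn F hR hF π Ω _ μ _ E part hE hpart hind => ?_⟩
  obtain ⟨hs, hfail, hn16⟩ := hC n hn
  exact (sub_le_sub_left hfail 1).trans
    (hE.measureReal_maxLoss_ge hα hβ hr hr' hσ hR hF π hpart hind hn16 hs)
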